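/- **Setting.** A *QPath diagram* $d : m \to n$ ($m,n\in\mathbb N$) is a term built by sequential composition ($;$, read left to right) and parallel composition ($\otimes$) from identities, wire permutations, and the generators $\delta:1\to2$, $\epsilon:1\to0$, $\mu:2\to1$, $\eta:0\to1$, $r:1\to1$ ($r\in\mathbb C$), the creation $|n\rangle:0\to1$ and the annihilation $\langle n|:1\to0$ of $n\ge1$ photons. Diagrams are rewritten inside formal $\mathbb C$-linear combinations of diagrams (on which both compositions are bilinear) by the congruence, compatible with linear combinations and both compositions, generated by the following axioms: * *Path axioms*: the axioms of a PROP (strict symmetric monoidal category with objects $\mathbb N$); $(\mu,\eta,\delta,\epsilon)$ is a commutative and cocommutative bialgebra; every $r$ is a bialgebra homomorphism, $r;s=rs$, the endomorphism $1$ is the identity, $\delta;(r\otimes s);\mu=r+s$, and the endomorphism $0$ is $\epsilon;\eta$; * *normalisation*: $|n\rangle=\frac1{\sqrt{n!}}\,|1\rangle^{\otimes n};\mu_n$ and $\langle n|=\frac1{\sqrt{n!}}\,\delta_n;\langle1|^{\otimes n}$, where $\mu_n:n\to1$ and $\delta_n:1\to n$ are the $n$-fold (co)multiplications; * *branching*: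 $|1\rangle;\delta=|1\rangle\otimes\eta+\eta\otimes|1\rangle$ and $\mu;\langle1|=\langle1|\otimes\epsilon+\epsilon\otimes\langle1|$; * *scalar laws*: $|1\rangle;\epsilon=0$, $\eta;\langle1|=0$, and $|1\rangle;r;\langle1|=r\cdot\mathrm{id}_0$. The *bosonic interpretation* $\mathcal B$ sends $m$ wires to the bosonic Fock space on $m$ modes with orthonormal basis $|s_1,\dots,s_m\rangle$, $s_i\in\mathbb N$. It sends the diagrams to linear maps on the dense subspace of finite linear combinations of basis states (on all of $\ell^2(\mathbb N^m)$ these operators are in general unbounded). It sends $;$ to composition, $\otimes$ to the tensor product, permutations to permutations of modes, and $$\mathcal B(\delta)|n\rangle=\sum_{k=0}^n\binom nk^{1/2}|k,n-k\rangle,\quad \mathcal B(\mu)=\mathcal B(\delta)^\dagger,\quad \mathcal B(\eta)=|0\rangle,\quad \mathcal B(\epsilon)=\langle0|,\quad \mathcal B(r)|n\rangle=r^n|n\rangle,$$ and creation and annihilation of $n$ photons to $|n\rangle$ and $\langle n|$. It is extended linearly to formal sums. A closed diagram $d:0\to0$ is interpreted as a complex number $\mathcal B(d)$. A *weighted bipartite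 graph* $G$ has node classes of sizes $p$ and $q$, edges between the two classes, and a weight $w_e\in\mathbb C$ on each edge $e$. It is drawn as a closed diagram $D(G)$: $p$ preparations of one photon, each copied along its edges; each edge carrying its weight; the edges at each node of the second class merged and annihilated by $\langle1|$. A pair $(G,N)$ with $N\in\mathbb C$ is a *normal form* of a closed diagram $d$ if $d$ can be rewritten to $N\cdot D(G)$ with the Path axioms and the normalisation law only. **Theorem (Completeness).** 1. The rewrite rules of QPath are sound for $\mathcal B$. For closed diagrams $d,d':0\to0$ they are complete: if $\mathcal B(d)=\mathcal B(d')$, then $d$ can be rewritten to $d'$. The same holds for formal sums of closed diagrams. 2. Every closed diagram $d$ has a normal form $(G_d,N_d)$ in which $N_d$ is the product of the factors $1/\sqrt{n!}$ over all creations and annihilations of $n$ photons in $d$. 3. For every closed diagram $d$ and every normal form $(G_d,N_d)$ of $d$, $$\mathcal B(d)=N_d\sum_M\prod_{e\in M}w_e ,$$ where $M$ ranges over the perfect matchings of $G_d$ (sets of edges such that every node lies in exactly one of them). If $p=q$ this is $N_d$ times the permanent of the $p\times q$ adjacency matrix of weights of $G_d$ (with respect to any identification of its row and column indices), and if $p\ne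 q$ it is $0$. -/

import Mathlib

noncomputable section

namespace QPath

/-! ### Diagrams -/

/-- Diagrams `m → n` of the QPath calculus: the terms generated, under sequential composition
`seq` (read from left to right) and parallel composition `par`, by the structure of a PROP
(identities and symmetries), by the generators of Path over `ℂ`, and by photon creation and
annihilation. The symmetry on one pair of wires is `swap 1 1`. -/
inductive Diag : ℕ → ℕ → Type
  | idn (n : ℕ) : Diag n n
  | seq {l m n : ℕ} (f : Diag l m) (g : Diag m n) : Diag l n
  | par {m n m' n' : ℕ} (f : Diag m n) (g : Diag m' n') : Diag (m + m') (n + n')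
  | swap (m n : ℕ) : Diag (m + n) (n + m)
  | copy : Diag 1 2
  | discard : Diag 1 0
  | merge : Diag 2 1
  | unit : Diag 0 1
  | endo (r : ℂ) : Diag 1 1
  | create (n : ℕ+) : Diag 0 1
  | annihilate (n : ℕ+) : Diag 1 0

namespace Diag

/-- Transport along equalities of the numbers of wires. -/
def cast {m n m' n' : ℕ} (hm : m = m') (hn : n = n') (d : Diag m n) : Diag m' n' :=
  hm ▸ hn ▸ d

/-- The `n`-fold comonoid `1 → n`. -/
def copyN : (n : ℕ) → Diag 1 n
  | 0 => discard
  | n + 1 => copy.seq ((copyN n).par (idn 1))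

/-- The `n`-fold monoid `n → 1`. -/
def mergeN : (n : ℕ) → Diag n 1
  | 0 => unit
  | n + 1 => Diag.seq (m := 1 + 1) ((mergeN n).par (idn 1)) merge

/-- `n` empty modes `0 → n`. -/
def units : (n : ℕ) → Diag 0 n
  | 0 => idn 0
  | n + 1 => (units n).par unit

/-- `n` modes, each prepared with one photon. -/
def creates : (n : ℕ) → Diag 0 n
  | 0 => idn 0
  | n + 1 => (creates n).par (create 1)

/-- `n` modes, each post-selected on one photon. -/
def annihilates : (n : ℕ) → Diag n 0
  | 0 => idn 0
  | n + 1 => (annihilates n).par (annihilate 1)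

/-- The parallel composition of `n` one-wire diagrams. -/
def parN : (n : ℕ) → (Fin n → Diag 1 1) → Diag n n
  | 0, _ => idn 0
  | n + 1, f => (parN n fun i => f i.castSucc).par (f (Fin.last n))

/-- The monoid applied wire by wire to two bundles of `n` wires. -/
def mergeBundle : (n : ℕ) → Diag (n + n) n
  | 0 => idn 0
  | n + 1 =>
    Diag.seq (m := (n + n) + (1 + 1))
      (Diag.cast (m' := (n + 1) + (n + 1)) (n' := (n + n) + (1 + 1)) (by omega) (by omega)
        (((idn n).par (swap 1 n)).par (idn 1)))
      ((mergeBundle n).par merge)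

/-- The bipartite diagram `p → q` in which the input `i` is copied to all outputs, the wire
from `i` to `j` carries the one-wire diagram `f i j`, and the wires arriving at an output are
merged. -/
def wires : (p q : ℕ) → (Fin p → Fin q → Diag 1 1) → Diag p q
  | 0, q, _ => units q
  | p + 1, q, f =>
    ((wires p q fun i => f i.castSucc).par ((copyN q).seq (parN q (f (Fin.last p))))).seq
      (mergeBundle q)

/-- The product of the factors `1 / √(n!)` over all the creations and annihilations of `n`
photons in a diagram. -/
def normFactor : {m n : ℕ} → Diag m n → ℂ
  | _, _, seq f g => normFactor f * normFactor g
  | _, _, par f g => normFactor f * normFactor g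
  | _, _, create n => 1 / (Real.sqrt (Nat.factorial n) : ℂ)
  | _, _, annihilate n => 1 / (Real.sqrt (Nat.factorial n) : ℂ)
  | _, _, idn _ => 1
  | _, _, swap _ _ => 1
  | _, _, copy => 1
  | _, _, discard => 1
  | _, _, merge => 1
  | _, _, unit => 1
  | _, _, endo _ => 1

end Diag

open Diag

/-! ### Formal sums of diagrams -/

/-- Formal `ℂ`-linear combinations of diagrams `m → n`. -/
abbrev Lin (m n : ℕ) : Type := Diag m n →₀ ℂ

/-- A diagram as a formal sum. -/
def Lin.of {m n : ℕ} (d : Diag m n) : Lin m n := Finsupp.single d 1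

/-- Sequential composition, extended bilinearly. -/
def Lin.seq {l m n : ℕ} (x : Lin l m) (y : Lin m n) : Lin l n :=
  x.sum fun d a => y.sum fun e b => Finsupp.single (Diag.seq d e) (a * b)

/-- Parallel composition, extended bilinearly. -/
def Lin.par {m n m' n' : ℕ} (x : Lin m n) (y : Lin m' n') : Lin (m + m') (n + n') :=
  x.sum fun d a => y.sum fun e b => Finsupp.single (Diag.par d e) (a * b)

/-! ### Axioms and rewriting -/

/-- The axioms of the Path calculus: those of a PROP (a strict symmetric monoidal category with
objects the natural numbers), those of a commutative and cocommutative bialgebra, and those of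
the endomorphisms `endo r`, which are bialgebra homomorphisms carrying the semiring structure
of `ℂ`. -/
inductive PathAxiom : {m n : ℕ} → Diag m n → Diag m n → Prop
  -- PROP structure
  | id_seq {m n : ℕ} (f : Diag m n) : PathAxiom ((idn m).seq f) f
  | seq_id {m n : ℕ} (f : Diag m n) : PathAxiom (f.seq (idn n)) f
  | seq_assoc {k l m n : ℕ} (f : Diag k l) (g : Diag l m) (h : Diag m n) :
      PathAxiom ((f.seq g).seq h) (f.seq (g.seq h))
  | par_id (m n : ℕ) : PathAxiom ((idn m).par (idn n)) (idn (m + n))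
  | interchange {l m n l' m' n' : ℕ} (f : Diag l m) (g : Diag m n) (f' : Diag l' m')
      (g' : Diag m' n') :
      PathAxiom ((f.seq g).par (f'.seq g')) ((f.par f').seq (g.par g'))
  | empty_par {m n : ℕ} (f : Diag m n) :
      PathAxiom (Diag.cast (Nat.zero_add m) (Nat.zero_add n) ((idn 0).par f)) f
  | par_empty {m n : ℕ} (f : Diag m n) : PathAxiom (f.par (idn 0)) f
  | par_assoc {m n m' n' m'' n'' : ℕ} (f : Diag m n) (g : Diag m' n') (h : Diag m'' n'') :
      PathAxiom (Diag.cast (Nat.add_assoc m m' m'') (Nat.add_assoc n n' n'') ((f.par g).par h))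
        (f.par (g.par h))
  | swap_natural {m n m' n' : ℕ} (f : Diag m n) (g : Diag m' n') :
      PathAxiom ((f.par g).seq (swap n n')) ((swap m m').seq (g.par f))
  | swap_swap (m n : ℕ) : PathAxiom ((swap m n).seq (swap n m)) (idn (m + n))
  | swap_zero (m : ℕ) : PathAxiom (Diag.cast rfl (Nat.zero_add m) (swap m 0)) (idn m)
  | swap_add (m n k : ℕ) :
      PathAxiom (swap m (n + k))
        (Diag.seq (m := n + (m + k))
          (Diag.cast (Nat.add_assoc m n k) (Nat.add_assoc n m k) ((swap m n).par (idn k)))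
          (Diag.cast rfl (Nat.add_assoc n k m).symm ((idn n).par (swap m k))))
  -- commutative comonoid
  | copy_assoc : PathAxiom (copy.seq (copy.par (idn 1))) (copy.seq ((idn 1).par copy))
  | copy_comm : PathAxiom (copy.seq (swap 1 1)) copy
  | copy_discard : PathAxiom (copy.seq (discard.par (idn 1))) (idn 1)
  -- commutative monoid
  | merge_assoc : PathAxiom ((merge.par (idn 1)).seq merge)
      (Diag.seq (l := 3) (m := 1 + 1) ((idn 1).par merge) merge)
  | merge_comm : PathAxiom ((swap 1 1).seq merge) merge
  | merge_unit : PathAxiom (Diag.seq (l := 1) (m := 1 + 1) (unit.par (idn 1)) merge) (idn 1)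
  -- bialgebra
  | merge_copy : PathAxiom (merge.seq copy)
      (Diag.seq (m := 4) (copy.par copy)
        (Diag.seq (m := 4) (((idn 1).par (swap 1 1)).par (idn 1)) (merge.par merge)))
  | unit_copy : PathAxiom (unit.seq copy) (unit.par unit)
  | merge_discard : PathAxiom (merge.seq discard) (discard.par discard)
  | unit_discard : PathAxiom (unit.seq discard) (idn 0)
  -- endomorphisms
  | endo_mul (r s : ℂ) : PathAxiom ((endo r).seq (endo s)) (endo (r * s))
  | endo_one : PathAxiom (endo 1) (idn 1)
  | endo_add (r s : ℂ) :
      PathAxiom (copy.seq (Diag.seq (m := 1 + 1) ((endo r).par (endo s)) merge)) (endo (r + s))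
  | endo_zero : PathAxiom (endo 0) (discard.seq unit)
  | endo_copy (r : ℂ) : PathAxiom ((endo r).seq copy) (copy.seq ((endo r).par (endo r)))
  | endo_discard (r : ℂ) : PathAxiom ((endo r).seq discard) discard
  | merge_endo (r : ℂ) :
      PathAxiom (merge.seq (endo r)) (Diag.seq (m := 1 + 1) ((endo r).par (endo r)) merge)
  | unit_endo (r : ℂ) : PathAxiom (unit.seq (endo r)) unit

/-- The axioms of Path together with the normalisation law. -/
inductive NormAxiom : {m n : ℕ} → Lin m n → Lin m n → Prop
  | path {m n : ℕ} {d e : Diag m n} (h : PathAxiom d e) : NormAxiom (Lin.of d) (Lin.of e)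
  | create_norm (n : ℕ+) : NormAxiom (Lin.of (create n))
      ((1 / (Real.sqrt (Nat.factorial n) : ℂ)) • Lin.of ((creates n).seq (mergeN n)))
  | annihilate_norm (n : ℕ+) : NormAxiom (Lin.of (annihilate n))
      ((1 / (Real.sqrt (Nat.factorial n) : ℂ)) • Lin.of ((copyN n).seq (annihilates n)))

/-- The axioms of QPath: those of Path, and the normalisation, branching and scalar laws. -/
inductive QPathAxiom : {m n : ℕ} → Lin m n → Lin m n → Prop
  | norm {m n : ℕ} {x y : Lin m n} (h : NormAxiom x y) : QPathAxiom x y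
  -- branching: a photon entering a copy leaves through one of its two legs
  | create_branch : QPathAxiom (Lin.of ((create 1).seq copy))
      (Lin.of ((create 1).par unit) + Lin.of (unit.par (create 1)))
  | annihilate_branch : QPathAxiom (Lin.of (merge.seq (annihilate 1)))
      (Lin.of ((annihilate 1).par discard) + Lin.of (discard.par (annihilate 1)))
  -- scalars
  | create_discard : QPathAxiom (Lin.of ((create 1).seq discard)) 0
  | unit_annihilate : QPathAxiom (Lin.of (unit.seq (annihilate 1))) 0
  | scalar (r : ℂ) : QPathAxiom (Lin.of ((create 1).seq ((endo r).seq (annihilate 1))))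
      (r • Lin.of (idn 0))

/-- Rewriting with a set `ax` of axioms, each usable in both directions and inside any diagram:
the congruence generated by `ax` on formal sums of diagrams. -/
inductive Rewrites (ax : ∀ m n : ℕ, Lin m n → Lin m n → Prop) :
    {m n : ℕ} → Lin m n → Lin m n → Prop
  | rule {m n : ℕ} {x y : Lin m n} (h : ax m n x y) : Rewrites ax x y
  | refl {m n : ℕ} (x : Lin m n) : Rewrites ax x x
  | symm {m n : ℕ} {x y : Lin m n} (h : Rewrites ax x y) : Rewrites ax y x
  | trans {m n : ℕ} {x y z : Lin m n} (h : Rewrites ax x y) (k : Rewrites ax y z) :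
      Rewrites ax x z
  | add {m n : ℕ} {x y x' y' : Lin m n} (h : Rewrites ax x y) (k : Rewrites ax x' y') :
      Rewrites ax (x + x') (y + y')
  | smul {m n : ℕ} {x y : Lin m n} (c : ℂ) (h : Rewrites ax x y) : Rewrites ax (c • x) (c • y)
  | seq {l m n : ℕ} {x y : Lin l m} {x' y' : Lin m n} (h : Rewrites ax x y)
      (k : Rewrites ax x' y') : Rewrites ax (x.seq x') (y.seq y')
  | par {m n m' n' : ℕ} {x y : Lin m n} {x' y' : Lin m' n'} (h : Rewrites ax x y)
      (k : Rewrites ax x' y') : Rewrites ax (x.par x') (y.par y')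

/-! ### The bosonic interpretation -/

/-- The bosonic Fock space on `m` modes: finite linear combinations of the occupation number
states `|s₁, …, sₘ⟩`. This is the dense subspace of `ℓ²(ℕ)^{⊗ m} = ℓ²(ℕ^m)` on which the
(in general unbounded) operators that interpret the generators are defined; all of them map
such combinations to such combinations. -/
abbrev Fock (m : ℕ) : Type := (Fin m → ℕ) →₀ ℂ

/-- The basis state with occupation numbers `s`. -/
def ket {m : ℕ} (s : Fin m → ℕ) : Fock m := Finsupp.single s 1

/-- The linear map with prescribed values on the basis states. -/
def ofKets {m n : ℕ} (v : (Fin m → ℕ) → Fock n) : Fock m →ₗ[ℂ] Fock n :=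
  Finsupp.linearCombination ℂ v

/-- The tensor product of two vectors, `|s⟩ ⊗ |t⟩ = |s, t⟩`. -/
def tensorVec {m n : ℕ} (x : Fock m) (y : Fock n) : Fock (m + n) :=
  x.sum fun s a => y.sum fun t b => Finsupp.single (Fin.append s t) (a * b)

/-- The tensor product of two linear maps, `|s, t⟩ ↦ f |s⟩ ⊗ g |t⟩`. -/
def tensorMap {m n m' n' : ℕ} (f : Fock m →ₗ[ℂ] Fock n) (g : Fock m' →ₗ[ℂ] Fock n') :
    Fock (m + m') →ₗ[ℂ] Fock (n + n') :=
  ofKets fun s => tensorVec (f (ket fun i => s (Fin.castAdd m' i)))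
    (g (ket fun i => s (Fin.natAdd m i)))

/-- The bosonic interpretation of diagrams. -/
def bosonic : {m n : ℕ} → Diag m n → (Fock m →ₗ[ℂ] Fock n)
  | _, _, idn _ => LinearMap.id
  | _, _, seq f g => bosonic g ∘ₗ bosonic f
  | _, _, par f g => tensorMap (bosonic f) (bosonic g)
  | _, _, swap m n => ofKets fun s =>
      ket (Fin.append (fun j => s (Fin.natAdd m j)) (fun i => s (Fin.castAdd n i)))
  | _, _, copy => ofKets fun s =>
      ∑ k ∈ Finset.range (s 0 + 1), (Real.sqrt ((s 0).choose k) : ℂ) • ket ![k, s 0 - k]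
  | _, _, merge => ofKets fun s =>
      (Real.sqrt ((s 0 + s 1).choose (s 0)) : ℂ) • ket ![s 0 + s 1]
  | _, _, .discard => ofKets fun s => if s 0 = 0 then ket ![] else 0
  | _, _, unit => ofKets fun _ => ket ![0]
  | _, _, endo r => ofKets fun s => r ^ s 0 • ket s
  | _, _, create n => ofKets fun _ => ket ![(n : ℕ)]
  | _, _, annihilate n => ofKets fun s => if s 0 = n then ket ![] else 0

/-- The bosonic interpretation of formal sums. -/
def bosonicLin {m n : ℕ} : Lin m n →ₗ[ℂ] (Fock m →ₗ[ℂ] Fock n) :=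
  Finsupp.linearCombination ℂ bosonic

/-- The complex number `⟨ |B(d)| ⟩` to which a closed diagram `d` is interpreted, under the
identification of linear maps `ℂ → ℂ` with complex numbers. -/
def amplitude (d : Diag 0 0) : ℂ := bosonic d (ket ![]) ![]

/-! ### Weighted bipartite graphs and perfect matchings -/

/-- An undirected bipartite graph with complex edge weights; its two classes of nodes are
`Fin p` (photon preparations) and `Fin q` (photon annihilations). -/
structure WeightedBipartiteGraph (p q : ℕ) where
  graph : SimpleGraph (Fin p ⊕ Fin q)
  bipartite : graph ≤ completeBipartiteGraph (Fin p) (Fin q)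
  weight : graph.edgeSet → ℂ

namespace WeightedBipartiteGraph

variable {p q : ℕ} (G : WeightedBipartiteGraph p q)

open Classical in
/-- The `p × q` (bi)adjacency matrix of weights. -/
def adjacency : Matrix (Fin p) (Fin q) ℂ := fun i j =>
  if h : G.graph.Adj (Sum.inl i) (Sum.inr j) then
    G.weight ⟨s(Sum.inl i, Sum.inr j), (SimpleGraph.mem_edgeSet G.graph).mpr h⟩
  else 0

open Classical in
/-- The closed diagram drawn by the graph: each node of `Fin p` is the preparation of one
photon, each node of `Fin q` is the annihilation of one photon, and each edge is a wire that
carries its weight. A pair of nodes without an edge is disconnected. -/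
def diagram : Diag 0 0 :=
  (creates p).seq
    ((wires p q fun i j =>
      if h : G.graph.Adj (Sum.inl i) (Sum.inr j) then
        endo (G.weight ⟨s(Sum.inl i, Sum.inr j), (SimpleGraph.mem_edgeSet G.graph).mpr h⟩)
      else discard.seq unit).seq
      (annihilates q))

/-- A set of edges is a perfect matching if every node lies in exactly one of them. -/
def IsPerfectMatching (M : Finset G.graph.edgeSet) : Prop :=
  ∀ v : Fin p ⊕ Fin q, ∃! e : G.graph.edgeSet, e ∈ M ∧ v ∈ (e : Sym2 (Fin p ⊕ Fin q))

open Classical in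
/-- The sum over the perfect matchings of the product of the weights of their edges. -/
def matchingSum : ℂ :=
  ∑ M : Finset G.graph.edgeSet with G.IsPerfectMatching M, ∏ e ∈ M, G.weight e

end WeightedBipartiteGraph

/-- The closed diagram `d` reduces to the graph `G` with normalisation factor `N`, using only
the axioms of Path and the normalisation law. -/
def IsNormalForm (d : Diag 0 0) {p q : ℕ} (G : WeightedBipartiteGraph p q) (N : ℂ) : Prop :=
  Rewrites @NormAxiom (Lin.of d) (N • Lin.of G.diagram)

end QPath

end

/-! ### Soundness, and the amplitude of a bipartite diagram. -/

noncomputable section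

namespace QPath

open Diag MvPolynomial

/-! ### Vectors and maps on Fock space -/

/-! Soundness and the matching formula come from reading states as polynomials: the monomial `X^s`
is the vector √(s!) |s⟩ (`polyState`). In this picture every Path generator is an algebra
homomorphism substituting linear forms for the variables (`IsSubst`). Composition multiplies the
matrices and ⊗ forms block sums, so the bialgebra and endomorphism axioms become small matrix
identities (`PathAxiom.sound`). A bipartite diagram with weights M substitutes M, so its amplitude
is the coefficient of X_1⋯X_q in ∏_i ∑_j M_ij X_j. This is a sum over bijections
(`amplitude_bipartite`), that is, over perfect matchings (`WeightedBipartiteGraph.matchingSum_eq`).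
Soundness of the Path and normalisation axioms transfers the formula to every diagram with that
normal form.

Normal forms exist because diagrams modulo rewriting form a symmetric monoidal category in which a
bundle of wires is a commutative monoid. A matrix of wires is assembled from its rows by this
multiplication, and composing any Path generator in front of a matrix of wires again gives one:
merging repeats a row, copying adds two rows, discarding inserts a zero row (`Absorbs`). Since the
identity is itself a matrix of wires, every Path diagram is one (`Absorbs.exists_eq`). Photon
preparations and annihilations are slid to the two ends by symmetries (`NormalEffect`), and `Scales`
records the scalar that the normalisation law releases.

Completeness does not use normal forms. Modulo the QPath axioms, every state 0 → n lies in the span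
of products of one-mode states made by merging weighted photons: each generator preserves these
spans (`preserves`), by the bialgebra, branching and scalar laws. For n = 0 the only such product is
the empty diagram, so every closed formal sum rewrites to a multiple of it
(`exists_rewrites_smul_idn`), and soundness determines the multiple. -/

lemma Fock.map_ext {m n : ℕ} {f g : Fock m →ₗ[ℂ] Fock n} (h : ∀ s, f (ket s) = g (ket s)) :
    f = g :=
  Finsupp.lhom_ext' fun s => LinearMap.ext_ring (h s)

@[simp] lemma ofKets_ket {m n : ℕ} (v : (Fin m → ℕ) → Fock n) (s : Fin m → ℕ) :
    ofKets v (ket s) = v s := by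
  simp [ofKets, ket]

/-- The tensor product of vectors as a bilinear map. -/
def tensorBil (m n : ℕ) : Fock m →ₗ[ℂ] Fock n →ₗ[ℂ] Fock (m + n) :=
  Finsupp.linearCombination ℂ fun s =>
    Finsupp.linearCombination ℂ fun t => ket (Fin.append s t)

lemma tensorVec_eq {m n : ℕ} (x : Fock m) (y : Fock n) : tensorVec x y = tensorBil m n x y := by
  simp only [tensorVec, tensorBil, Finsupp.linearCombination_apply, Finsupp.sum,
    LinearMap.sum_apply, LinearMap.smul_apply, Finset.smul_sum, ket,
    Finsupp.smul_single, smul_eq_mul, mul_one]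

@[simp] lemma tensorBil_ket {m n : ℕ} (s : Fin m → ℕ) (t : Fin n → ℕ) :
    tensorBil m n (ket s) (ket t) = ket (Fin.append s t) := by
  simp [tensorBil, ket]

lemma exists_append {m n : ℕ} (s : Fin (m + n) → ℕ) :
    ∃ (a : Fin m → ℕ) (b : Fin n → ℕ), s = Fin.append a b :=
  ⟨_, _, Fin.append_castAdd_natAdd.symm⟩

lemma Fock.map_ext_append {m m' n : ℕ} {f g : Fock (m + m') →ₗ[ℂ] Fock n}
    (h : ∀ a b, f (ket (Fin.append a b)) = g (ket (Fin.append a b))) : f = g := by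
  refine Fock.map_ext fun s => ?_
  obtain ⟨a, b, rfl⟩ := exists_append s
  exact h a b

@[simp] lemma tensorMap_ket {m n m' n' : ℕ} (f : Fock m →ₗ[ℂ] Fock n)
    (g : Fock m' →ₗ[ℂ] Fock n') (a : Fin m → ℕ) (b : Fin m' → ℕ) :
    tensorMap f g (ket (Fin.append a b)) = tensorBil n n' (f (ket a)) (g (ket b)) := by
  simp [tensorMap, tensorVec_eq]

lemma Fock.bil_ext {m n k : ℕ} {f g : Fock m →ₗ[ℂ] Fock n →ₗ[ℂ] Fock k}
    (h : ∀ a b, f (ket a) (ket b) = g (ket a) (ket b)) : f = g :=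
  Finsupp.lhom_ext' fun s => LinearMap.ext_ring <|
    Finsupp.lhom_ext' fun t => LinearMap.ext_ring (h s t)

lemma tensorMap_tensorBil {m n m' n' : ℕ} (f : Fock m →ₗ[ℂ] Fock n)
    (g : Fock m' →ₗ[ℂ] Fock n') (x : Fock m) (y : Fock m') :
    tensorMap f g (tensorBil m m' x y) = tensorBil n n' (f x) (g y) := by
  have : (tensorBil m m').compr₂ (tensorMap f g) = (tensorBil n n').compl₁₂ f g :=
    Fock.bil_ext fun a b => by simp
  exact congr($this x y)

/-- Renumbering of modes along an equality of numbers of modes. -/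
def reindex {m n : ℕ} (h : m = n) : Fock m →ₗ[ℂ] Fock n :=
  ofKets fun s => ket fun i => s (Fin.cast h.symm i)

@[simp] lemma reindex_ket {m n : ℕ} (h : m = n) (s : Fin m → ℕ) :
    reindex h (ket s) = ket fun i => s (Fin.cast h.symm i) := by
  simp [reindex]

lemma reindex_rfl {m : ℕ} (h : m = m) : reindex h = LinearMap.id :=
  Fock.map_ext fun s => by simp

lemma reindex_symm_eq_iff {m n : ℕ} (h : m = n) (x : Fock m) (y : Fock n) :
    reindex h.symm y = x ↔ y = reindex h x := by
  subst h
  simp [reindex_rfl]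

lemma bosonic_cast {m n m' n' : ℕ} (hm : m = m') (hn : n = n') (d : Diag m n) :
    bosonic (d.cast hm hn) = reindex hn ∘ₗ bosonic d ∘ₗ reindex hm.symm := by
  subst hm hn
  simp [reindex_rfl, Diag.cast]

/-- The exchange of two groups of modes. -/
def swapF (m n : ℕ) : Fock (m + n) →ₗ[ℂ] Fock (n + m) := bosonic (swap m n)

@[simp] lemma swapF_ket {m n : ℕ} (a : Fin m → ℕ) (b : Fin n → ℕ) :
    swapF m n (ket (Fin.append a b)) = ket (Fin.append b a) := by
  simp [swapF, bosonic]

lemma swapF_tensorBil {m n : ℕ} (x : Fock m) (y : Fock n) :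
    swapF m n (tensorBil m n x y) = tensorBil n m y x := by
  have : (tensorBil m n).compr₂ (swapF m n) = (tensorBil n m).flip :=
    Fock.bil_ext fun a b => by simp
  exact congr($this x y)

lemma reindex_tensorBil_assoc {m n k : ℕ} (x : Fock m) (y : Fock n) (z : Fock k) :
    reindex (Nat.add_assoc m n k) (tensorBil _ _ (tensorBil _ _ x y) z)
      = tensorBil _ _ x (tensorBil _ _ y z) := by
  -- With z fixed, both sides are bilinear in x and y; once these are basis states, both sides are
  -- linear in z.
  have : ((tensorBil _ _).compr₂ ((tensorBil _ _).flip z)).compr₂ (reindex (Nat.add_assoc m n k))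
      = (tensorBil _ _).compl₂ ((tensorBil _ _).flip z) := by
    refine Fock.bil_ext fun a b => ?_
    have : (reindex (Nat.add_assoc m n k)) ∘ₗ (tensorBil _ _ (ket (Fin.append a b)))
      = (tensorBil _ _ (ket a)) ∘ₗ (tensorBil _ _ (ket b)) := by
      refine Fock.map_ext fun c => ?_
      simp [Fin.append_assoc, Function.comp_def]
    simpa using congr($this z)
  exact congr($this x y)

lemma ket_zero_tensorBil {n : ℕ} (s : Fin 0 → ℕ) (x : Fock n) :
    reindex (Nat.zero_add n) (tensorBil 0 n (ket s) x) = x := by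
  have : reindex (Nat.zero_add n) ∘ₗ (tensorBil 0 n (ket s)) = LinearMap.id := by
    refine Fock.map_ext fun t => ?_
    simp only [LinearMap.comp_apply, tensorBil_ket, reindex_ket, LinearMap.id_apply,
      Fin.append_left_nil s t rfl]
    rfl
  exact congr($this x)

lemma tensorBil_ket_zero {n : ℕ} (s : Fin 0 → ℕ) (x : Fock n) :
    tensorBil n 0 x (ket s) = x := by
  have : (tensorBil n 0).flip (ket s) = LinearMap.id := by
    refine Fock.map_ext fun t => ?_
    simp only [LinearMap.flip_apply, tensorBil_ket, LinearMap.id_apply,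
      Fin.append_right_nil t s rfl]
    rfl
  exact congr($this x)

/-! ### Polynomials as states -/

/-- The squared norm of the monomial with exponents `s`. -/
def occFact {m : ℕ} (s : Fin m → ℕ) : ℕ := ∏ i, (s i).factorial

/-- The norm of the monomial with exponents `s`. -/
def occNorm {m : ℕ} (s : Fin m → ℕ) : ℂ := (Real.sqrt (occFact s) : ℂ)

lemma occFact_pos {m : ℕ} (s : Fin m → ℕ) : 0 < occFact s :=
  Finset.prod_pos fun _ _ => Nat.factorial_pos _

lemma occNorm_ne_zero {m : ℕ} (s : Fin m → ℕ) : occNorm s ≠ 0 := by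
  have := Real.sqrt_pos.mpr (Nat.cast_pos (α := ℝ).mpr (occFact_pos s))
  exact Complex.ofReal_ne_zero.mpr this.ne'

lemma occFact_append {m n : ℕ} (s : Fin m → ℕ) (t : Fin n → ℕ) :
    occFact (Fin.append s t) = occFact s * occFact t := by
  simp [occFact, Fin.prod_univ_add]

lemma occNorm_append {m n : ℕ} (s : Fin m → ℕ) (t : Fin n → ℕ) :
    occNorm (Fin.append s t) = occNorm s * occNorm t := by
  simp [occNorm, occFact_append]

/-- The state created by a polynomial in the creation operators. -/
def polyState (m : ℕ) : MvPolynomial (Fin m) ℂ →ₗ[ℂ] Fock m :=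
  (basisMonomials (Fin m) ℂ).constr ℂ fun s => occNorm s • ket s

lemma polyState_monomial {m : ℕ} (s : Fin m →₀ ℕ) (c : ℂ) :
    polyState m (monomial s c) = (c * occNorm s) • ket s := by
  have : monomial s c = c • basisMonomials (Fin m) ℂ s := by
    simp [smul_monomial]
  rw [this, map_smul, polyState, Module.Basis.constr_basis, smul_smul]

/-- The norms are nonzero, so polynomials reach every state and a map of Fock spaces is determined
by its values on them. -/
lemma ket_eq_polyState {m : ℕ} (s : Fin m → ℕ) :
    ket s = polyState m (monomial (Finsupp.equivFunOnFinite.symm s) (occNorm s)⁻¹) := by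
  simp [polyState_monomial, occNorm_ne_zero]

lemma monomial_append {m n : ℕ} (s : Fin m →₀ ℕ) (t : Fin n →₀ ℕ) :
    ⇑(s.mapDomain (Fin.castAdd n) + t.mapDomain (Fin.natAdd m)) = Fin.append s t := by
  ext i
  refine Fin.addCases (fun i => ?_) (fun i => ?_) i
  · rw [Finsupp.add_apply, Finsupp.mapDomain_apply (Fin.castAdd_injective _ _),
      Finsupp.mapDomain_of_notMem_range]
    · simp
    · rintro ⟨j, hj⟩
      simp [Fin.ext_iff] at hj
      omega
  · rw [Finsupp.add_apply, Finsupp.mapDomain_apply (Fin.natAdd_injective _ _),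
      Finsupp.mapDomain_of_notMem_range]
    · simp
    · rintro ⟨j, hj⟩
      simp [Fin.ext_iff] at hj
      omega

lemma linearMap_ext_monomial {σ : Type*} {V : Type*} [AddCommMonoid V] [Module ℂ V]
    {f g : MvPolynomial σ ℂ →ₗ[ℂ] V} (h : ∀ s, f (monomial s 1) = g (monomial s 1)) : f = g :=
  (basisMonomials σ ℂ).ext fun s => by simpa using h s

/-- The norm of a monomial is multiplicative over disjoint sets of variables, so tensoring states is
multiplying polynomials in separate variables. -/
lemma polyState_mul {m n : ℕ} (p : MvPolynomial (Fin m) ℂ) (q : MvPolynomial (Fin n) ℂ) :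
    polyState (m + n) (rename (Fin.castAdd n) p * rename (Fin.natAdd m) q)
      = tensorBil m n (polyState m p) (polyState n q) := by
  have : ((LinearMap.mul ℂ _).compl₁₂ (rename (R := ℂ) (Fin.castAdd n)).toLinearMap
      (rename (R := ℂ) (Fin.natAdd m)).toLinearMap).compr₂ (polyState (m + n))
      = (tensorBil m n).compl₁₂ (polyState m) (polyState n) := by
    refine linearMap_ext_monomial fun s => linearMap_ext_monomial fun t => ?_
    simp [rename_monomial, monomial_mul, polyState_monomial, monomial_append,
      occNorm_append, mul_smul, -Finsupp.coe_add]
    exact smul_comm _ _ _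
  exact congr($this p q)

/-! ### Linear substitutions -/

/-- The linear substitution with a given matrix. -/
def linSubst {m n : ℕ} (M : Matrix (Fin m) (Fin n) ℂ) :
    MvPolynomial (Fin m) ℂ →ₐ[ℂ] MvPolynomial (Fin n) ℂ :=
  aeval fun i => ∑ j, M i j • X j

/-- A map of Fock spaces is the second quantisation of the matrix `M`. -/
def IsSubst {m n : ℕ} (f : Fock m →ₗ[ℂ] Fock n) (M : Matrix (Fin m) (Fin n) ℂ) : Prop :=
  ∀ p, f (polyState m p) = polyState n (linSubst M p)

lemma IsSubst.of_monomial {m n : ℕ} {f : Fock m →ₗ[ℂ] Fock n} {M : Matrix (Fin m) (Fin n) ℂ}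
    (h : ∀ s : Fin m →₀ ℕ, occNorm s • f (ket s) = polyState n (∏ i, (∑ j, M i j • X j) ^ s i)) :
    IsSubst f M := by
  have : f ∘ₗ polyState m = polyState n ∘ₗ (linSubst M).toLinearMap := by
    refine linearMap_ext_monomial fun s => ?_
    simp only [LinearMap.comp_apply, AlgHom.toLinearMap_apply, linSubst, aeval_monomial, map_one,
      one_mul, polyState_monomial, map_smul, h s]
    rw [Finsupp.prod_fintype _ _ fun _ => pow_zero _]
  exact fun p => congr($this p)

/-- This reduces an equality of operators on Fock space to an equality of finite matrices. -/
lemma IsSubst.unique {m n : ℕ} {f g : Fock m →ₗ[ℂ] Fock n} {M N : Matrix (Fin m) (Fin n) ℂ}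
    (hf : IsSubst f M) (hg : IsSubst g N) (h : M = N) : f = g := by
  subst h
  refine Fock.map_ext fun s => ?_
  rw [ket_eq_polyState, hf, hg]

lemma linSubst_mul {l m n : ℕ} (M : Matrix (Fin l) (Fin m) ℂ) (N : Matrix (Fin m) (Fin n) ℂ) :
    linSubst (M * N) = (linSubst N).comp (linSubst M) := by
  refine MvPolynomial.algHom_ext fun i => ?_
  simp [linSubst, Matrix.mul_apply, Finset.smul_sum, smul_smul, Finset.sum_smul]
  exact Finset.sum_comm

lemma IsSubst.comp {l m n : ℕ} {f : Fock l →ₗ[ℂ] Fock m} {g : Fock m →ₗ[ℂ] Fock n}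
    {M : Matrix (Fin l) (Fin m) ℂ} {N : Matrix (Fin m) (Fin n) ℂ}
    (hf : IsSubst f M) (hg : IsSubst g N) : IsSubst (g ∘ₗ f) (M * N) := fun p => by
  rw [LinearMap.comp_apply, hf, hg, linSubst_mul]; rfl

lemma IsSubst.id (m : ℕ) : IsSubst (LinearMap.id : Fock m →ₗ[ℂ] Fock m) 1 := by
  have : linSubst (1 : Matrix (Fin m) (Fin m) ℂ) = AlgHom.id ℂ _ :=
    MvPolynomial.algHom_ext fun i => by simp [linSubst, Matrix.one_apply]
  intro p
  simp [this]

/-- The direct sum of two matrices. -/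
def blockDiag {m n m' n' : ℕ} (M : Matrix (Fin m) (Fin n) ℂ) (N : Matrix (Fin m') (Fin n') ℂ) :
    Matrix (Fin (m + m')) (Fin (n + n')) ℂ :=
  (Matrix.fromBlocks M 0 0 N).submatrix finSumFinEquiv.symm finSumFinEquiv.symm

@[simp] lemma blockDiag_castAdd_castAdd {m n m' n' : ℕ} (M : Matrix (Fin m) (Fin n) ℂ)
    (N : Matrix (Fin m') (Fin n') ℂ) (i j) :
    blockDiag M N (Fin.castAdd _ i) (Fin.castAdd _ j) = M i j := by simp [blockDiag]
@[simp] lemma blockDiag_castAdd_natAdd {m n m' n' : ℕ} (M : Matrix (Fin m) (Fin n) ℂ)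
    (N : Matrix (Fin m') (Fin n') ℂ) (i j) :
    blockDiag M N (Fin.castAdd _ i) (Fin.natAdd _ j) = 0 := by simp [blockDiag]
@[simp] lemma blockDiag_natAdd_castAdd {m n m' n' : ℕ} (M : Matrix (Fin m) (Fin n) ℂ)
    (N : Matrix (Fin m') (Fin n') ℂ) (i j) :
    blockDiag M N (Fin.natAdd _ i) (Fin.castAdd _ j) = 0 := by simp [blockDiag]
@[simp] lemma blockDiag_natAdd_natAdd {m n m' n' : ℕ} (M : Matrix (Fin m) (Fin n) ℂ)
    (N : Matrix (Fin m') (Fin n') ℂ) (i j) :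
    blockDiag M N (Fin.natAdd _ i) (Fin.natAdd _ j) = N i j := by simp [blockDiag]

lemma linSubst_blockDiag {m n m' n' : ℕ} (M : Matrix (Fin m) (Fin n) ℂ)
    (N : Matrix (Fin m') (Fin n') ℂ) (p : MvPolynomial (Fin m) ℂ)
    (q : MvPolynomial (Fin m') ℂ) :
    linSubst (blockDiag M N) (rename (Fin.castAdd m') p * rename (Fin.natAdd m) q)
      = rename (Fin.castAdd n') (linSubst M p) * rename (Fin.natAdd n) (linSubst N q) := by
  have h1 : (linSubst (blockDiag M N)).comp (rename (Fin.castAdd m'))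
      = (rename (Fin.castAdd n')).comp (linSubst M) :=
    MvPolynomial.algHom_ext fun i => by simp [linSubst, Fin.sum_univ_add]
  have h2 : (linSubst (blockDiag M N)).comp (rename (Fin.natAdd m))
      = (rename (Fin.natAdd n)).comp (linSubst N) :=
    MvPolynomial.algHom_ext fun i => by simp [linSubst, Fin.sum_univ_add]
  rw [map_mul]
  exact congr($h1 p * $h2 q)

lemma IsSubst.tensor {m n m' n' : ℕ} {f : Fock m →ₗ[ℂ] Fock n} {g : Fock m' →ₗ[ℂ] Fock n'}
    {M : Matrix (Fin m) (Fin n) ℂ} {N : Matrix (Fin m') (Fin n') ℂ}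
    (hf : IsSubst f M) (hg : IsSubst g N) : IsSubst (tensorMap f g) (blockDiag M N) := by
  have : tensorMap f g ∘ₗ polyState _ = polyState _ ∘ₗ (linSubst (blockDiag M N)).toLinearMap := by
    refine linearMap_ext_monomial fun s => ?_
    -- Each monomial factors into its part in the first m variables and its part in the last m'.
    have hs : monomial s (1 : ℂ) =
        rename (Fin.castAdd m')
            (monomial (Finsupp.equivFunOnFinite.symm fun i => s (Fin.castAdd m' i)) 1)
        * rename (Fin.natAdd m)
            (monomial (Finsupp.equivFunOnFinite.symm fun i => s (Fin.natAdd m i)) 1) := by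
      rw [rename_monomial, rename_monomial, monomial_mul, mul_one]
      refine congr(monomial $(DFunLike.coe_injective ?_) 1)
      rw [monomial_append]
      exact Fin.append_castAdd_natAdd.symm
    simp only [LinearMap.comp_apply, AlgHom.toLinearMap_apply]
    rw [hs, linSubst_blockDiag, polyState_mul, polyState_mul, tensorMap_tensorBil, hf, hg]
  exact fun p => congr($this p)

/-! ### The generators of Path as linear substitutions -/

lemma polyState_prod_X {m : ℕ} (t : Fin m → ℕ) :
    polyState m (∏ i, X i ^ t i) = occNorm t • ket t := by
  have : (∏ i, X i ^ t i : MvPolynomial (Fin m) ℂ)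
      = monomial (Finsupp.equivFunOnFinite.symm t) 1 := by
    rw [monomial_eq, Finsupp.prod_fintype _ _ fun _ => pow_zero _]
    simp
  simp [this, polyState_monomial]

lemma occNorm_comp_equiv {m n : ℕ} (e : Fin n ≃ Fin m) (s : Fin m → ℕ) :
    occNorm (s ∘ e) = occNorm s := by
  simp only [occNorm, occFact, Function.comp_apply]
  rw [e.prod_comp fun i => (s i).factorial]

/-- The matrix of a relabelling of modes. -/
def relabel {m n : ℕ} (e : Fin n ≃ Fin m) : Matrix (Fin m) (Fin n) ℂ :=
  Matrix.of fun i j => if e j = i then 1 else 0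

lemma isSubst_relabel {m n : ℕ} {f : Fock m →ₗ[ℂ] Fock n} (e : Fin n ≃ Fin m)
    (h : ∀ s, f (ket s) = ket (s ∘ e)) : IsSubst f (relabel e) := by
  refine IsSubst.of_monomial fun s => ?_
  have h1 : ∀ i, (∑ j, relabel e i j • X j : MvPolynomial (Fin n) ℂ) = X (e.symm i) := fun i => by
    rw [Finset.sum_eq_single (e.symm i)]
    · simp [relabel]
    · intro j _ hj
      have : e j ≠ i := fun h => hj (by simp [← h])
      simp [relabel, this]
    · simp
  simp only [h1, h]
  rw [← e.prod_comp, ← occNorm_comp_equiv e s]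
  simpa using (polyState_prod_X (s ∘ e)).symm

lemma isSubst_swap (m n : ℕ) : IsSubst (bosonic (swap m n)) (relabel finAddFlip) := by
  refine isSubst_relabel _ fun s => ?_
  simp only [bosonic, ofKets_ket]
  congr 1
  ext i
  refine Fin.addCases (fun i => ?_) (fun i => ?_) i <;> simp

lemma occNorm_cons {n : ℕ} (a : ℕ) (t : Fin n → ℕ) :
    occNorm (Matrix.vecCons a t) = (Real.sqrt a.factorial : ℂ) * occNorm t := by
  simp [occNorm, occFact, Fin.prod_univ_succ]

@[simp] lemma occNorm_empty (t : Fin 0 → ℕ) : occNorm t = 1 := by simp [occNorm, occFact]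

/-- Square root of (a+b)! = C(a+b, a) a! b!. It is why the amplitudes √C of copy and merge disappear
in the polynomial normalisation. -/
lemma sqrt_factorial_add (a b : ℕ) :
    (Real.sqrt (a + b).factorial : ℂ)
      = Real.sqrt ((a + b).choose a) * (Real.sqrt a.factorial * Real.sqrt b.factorial) := by
  rw [← Nat.add_choose_mul_factorial_mul_factorial a b]
  push_cast
  rw [Real.sqrt_mul (by positivity), Real.sqrt_mul (by positivity), ← Nat.choose_symm_add]
  push_cast
  ring

lemma sqrt_mul_self_natCast (n : ℕ) : (Real.sqrt n : ℂ) * Real.sqrt n = n := by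
  rw [← Complex.ofReal_mul, Real.mul_self_sqrt (by positivity)]
  simp

/-- Copying is the substitution X ↦ X_0 + X_1, and its matrix elements are those of the binomial
theorem. -/
lemma isSubst_copy : IsSubst (bosonic copy) (Matrix.of fun _ _ => 1) := by
  refine IsSubst.of_monomial fun s => ?_
  obtain ⟨n, hn⟩ : ∃ n, s 0 = n := ⟨_, rfl⟩
  have hs : occNorm s = Real.sqrt n.factorial := by simp [occNorm, occFact, hn]
  simp only [bosonic, ofKets_ket, hs, hn, Finset.univ_unique, Fin.default_eq_zero,
    Finset.prod_singleton, Matrix.of_apply, one_smul, Fin.sum_univ_two, add_pow, map_sum,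
    Finset.smul_sum, smul_smul]
  refine Finset.sum_congr rfl fun k hk => ?_
  -- Writing n = k + l, the claim is √n! √C(n, k) = C(n, k) √k! √l!.
  obtain ⟨l, rfl⟩ := Nat.exists_eq_add_of_le (Nat.lt_succ_iff.mp (Finset.mem_range.mp hk))
  have h1 : (X 0 ^ k * X 1 ^ (k + l - k) * ((k + l).choose k : MvPolynomial (Fin 2) ℂ))
      = ((k + l).choose k : ℂ) • ∏ i, X i ^ ((![k, k + l - k] : Fin 2 → ℕ) i) := by
    rw [Fin.prod_univ_two, mul_comm, smul_eq_C_mul]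
    simp
  rw [h1, map_smul, polyState_prod_X, occNorm_cons, occNorm_cons, smul_smul]
  simp only [occNorm_empty, add_tsub_cancel_left, mul_one]
  rw [sqrt_factorial_add, ← sqrt_mul_self_natCast]
  congr 1
  ring

lemma isSubst_merge : IsSubst (bosonic merge) (Matrix.of fun _ _ => 1) := by
  refine IsSubst.of_monomial fun s => ?_
  have h1 : (∏ i, (∑ j : Fin 1, (1 : ℂ) • X j) ^ s i : MvPolynomial (Fin 1) ℂ)
      = ∏ i, X i ^ ((![s 0 + s 1] : Fin 1 → ℕ) i) := by
    simp [Fin.prod_univ_two, pow_add]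
  have h2 : occNorm s = Real.sqrt (s 0).factorial * Real.sqrt (s 1).factorial := by
    simp [occNorm, occFact, Fin.prod_univ_two]
  simp only [Matrix.of_apply]
  rw [h1, polyState_prod_X, occNorm_cons, occNorm_empty, h2, sqrt_factorial_add]
  simp only [bosonic, ofKets_ket, smul_smul]
  congr 1
  ring

/-- The only variable goes to an empty sum, and 0 ^ s is 1 exactly for the vacuum s = 0. -/
lemma isSubst_discard : IsSubst (bosonic .discard) (Matrix.of fun _ _ => 0) := by
  refine IsSubst.of_monomial fun s => ?_
  have h2 : occNorm s = Real.sqrt (s 0).factorial := by simp [occNorm, occFact]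
  have h3 := polyState_prod_X (![] : Fin 0 → ℕ)
  simp only [Finset.univ_eq_empty, Finset.prod_empty, occNorm_empty, one_smul] at h3
  by_cases h : s 0 = 0
  · simp [bosonic, h, h2, h3]
  · simp [bosonic, h]

lemma isSubst_unit : IsSubst (bosonic unit) (Matrix.of fun _ _ => 0) := by
  refine IsSubst.of_monomial fun s => ?_
  have h3 := polyState_prod_X (![0] : Fin 1 → ℕ)
  simp only [occNorm_cons, occNorm_empty] at h3
  simp at h3
  simp [bosonic, h3]

lemma isSubst_endo (r : ℂ) : IsSubst (bosonic (endo r)) (Matrix.of fun _ _ => r) := by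
  refine IsSubst.of_monomial fun s => ?_
  have h3 := polyState_prod_X s
  simp only [Finset.univ_unique, Fin.default_eq_zero, Finset.prod_singleton] at h3
  simp [bosonic, smul_pow, h3, smul_smul, mul_comm]

/-! ### Soundness -/

lemma bosonic_seq {l m n : ℕ} (f : Diag l m) (g : Diag m n) :
    bosonic (f.seq g) = bosonic g ∘ₗ bosonic f := rfl

lemma bosonic_par {m n m' n' : ℕ} (f : Diag m n) (g : Diag m' n') :
    bosonic (f.par g) = tensorMap (bosonic f) (bosonic g) := rfl

lemma bosonic_idn (n : ℕ) : bosonic (idn n) = LinearMap.id := rfl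

lemma bosonic_swap (m n : ℕ) : bosonic (swap m n) = swapF m n := rfl

lemma isSubst_swap_one_one : IsSubst (bosonic (swap 1 1)) !![0, 1; 1, 0] := by
  have : relabel (m := 1 + 1) finAddFlip = !![0, 1; 1, 0] := by
    ext i j
    fin_cases i <;> fin_cases j <;> rfl
  rw [← this]
  exact isSubst_swap 1 1

lemma blockDiag_eq_ite {m n m' n' : ℕ} (M : Matrix (Fin m) (Fin n) ℂ)
    (N : Matrix (Fin m') (Fin n') ℂ) (i : Fin (m + m')) (j : Fin (n + n')) :
    blockDiag M N i j =
      if hi : (i : ℕ) < m then if hj : (j : ℕ) < n then M ⟨i, hi⟩ ⟨j, hj⟩ else 0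
      else if hj : (j : ℕ) < n then 0 else N ⟨i - m, by omega⟩ ⟨j - n, by omega⟩ := by
  refine Fin.addCases (fun i => ?_) (fun i => ?_) i <;>
    refine Fin.addCases (fun j => ?_) (fun j => ?_) j <;> simp

set_option linter.unusedSimpArgs false in
set_option linter.unreachableTactic false in
set_option linter.unusedTactic false in
set_option linter.unnecessarySeqFocus false in
-- The PROP axioms hold by definition or are checked on tensor products of vectors; every other
-- axiom compares two linear substitutions.
theorem PathAxiom.sound {m n : ℕ} {d e : Diag m n} (h : PathAxiom d e) :
    bosonic d = bosonic e := by
  cases h with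
  | id_seq f => rfl
  | seq_id f => rfl
  | seq_assoc f g h => rfl
  | par_id m n => exact Fock.map_ext_append fun a b => by simp [bosonic]
  | interchange f g f' g' =>
    exact Fock.map_ext_append fun a b => by simp [bosonic, tensorMap_tensorBil]
  | empty_par f =>
    rw [bosonic_cast, bosonic_par]
    refine LinearMap.ext fun x => ?_
    -- Every vector is the tensor product of the empty ket with itself, up to renumbering.
    have h1 : reindex (Nat.zero_add _).symm x = _ :=
      (reindex_symm_eq_iff _ _ _).mpr (ket_zero_tensorBil ![] x).symm
    simp only [LinearMap.comp_apply]
    rw [h1, tensorMap_tensorBil, bosonic_idn, LinearMap.id_apply, ket_zero_tensorBil]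
  | par_empty f =>
    refine LinearMap.ext fun x => ?_
    have := tensorMap_tensorBil (bosonic f) (bosonic (idn 0)) x (ket ![])
    rw [tensorBil_ket_zero, bosonic_idn, LinearMap.id_apply, tensorBil_ket_zero] at this
    exact this
  | par_assoc f g h =>
    rw [bosonic_cast]
    refine Fock.map_ext_append fun a b => ?_
    obtain ⟨b, c, rfl⟩ := exists_append b
    have h1 : reindex (Nat.add_assoc _ _ _).symm (ket (Fin.append a (Fin.append b c))) = _ :=
      (reindex_symm_eq_iff _ (ket (Fin.append (Fin.append a b) c)) _).mpr (by
        simpa only [tensorBil_ket] using (reindex_tensorBil_assoc (ket a) (ket b) (ket c)).symm)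
    simp only [LinearMap.comp_apply]
    rw [h1]
    simp [bosonic_par, reindex_tensorBil_assoc]
  | swap_natural f g =>
    refine Fock.map_ext_append fun a b => ?_
    simp [bosonic_seq, bosonic_par, bosonic_swap, swapF_tensorBil]
  | swap_swap m n =>
    exact Fock.map_ext_append fun a b => by simp [bosonic_seq, bosonic_swap, bosonic_idn]
  | swap_zero m =>
    rw [bosonic_cast, reindex_rfl]
    refine LinearMap.ext fun x => ?_
    have := swapF_tensorBil x (ket ![])
    rw [tensorBil_ket_zero] at this
    exact (congrArg _ this).trans (ket_zero_tensorBil _ _)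
  | swap_add m n k =>
    rw [bosonic_seq, bosonic_cast, bosonic_cast]
    refine Fock.map_ext_append fun a b => ?_
    obtain ⟨b, c, rfl⟩ := exists_append b
    have h1 : reindex (Nat.add_assoc _ _ _).symm (ket (Fin.append a (Fin.append b c))) = _ :=
      (reindex_symm_eq_iff _ (ket (Fin.append (Fin.append a b) c)) _).mpr (by
        simpa only [tensorBil_ket] using (reindex_tensorBil_assoc (ket a) (ket b) (ket c)).symm)
    simp only [LinearMap.comp_apply, bosonic_swap]
    rw [h1]
    have h2 := reindex_tensorBil_assoc (ket b) (ket a) (ket c)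
    have h3 : reindex (Nat.add_assoc _ _ _).symm (ket (Fin.append b (Fin.append c a))) = _ :=
      (reindex_symm_eq_iff _ (ket (Fin.append (Fin.append b c) a)) _).mpr (by
        simpa only [tensorBil_ket] using (reindex_tensorBil_assoc (ket b) (ket c) (ket a)).symm)
    simp only [tensorBil_ket] at h2
    simp only [bosonic_par, tensorMap_ket, bosonic_swap, bosonic_idn, swapF_ket,
      LinearMap.id_apply, tensorBil_ket, h2, reindex_rfl]
    rw [h3]
  | copy_assoc =>
    -- From here on the axioms involve only generators with known matrices, so what is left is an
    -- entrywise check.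
    refine IsSubst.unique (isSubst_copy.comp (isSubst_copy.tensor (IsSubst.id 1)))
      (isSubst_copy.comp ((IsSubst.id 1).tensor isSubst_copy)) ?_
    ext i j
    fin_cases i <;> fin_cases j <;>
      simp [Matrix.mul_apply, blockDiag_eq_ite, Fin.sum_univ_succ, Matrix.one_apply,
        -Finset.sum_boole]
  | copy_comm =>
    refine IsSubst.unique (isSubst_copy.comp isSubst_swap_one_one) isSubst_copy ?_
    ext i j
    fin_cases i <;> fin_cases j <;>
      simp [Matrix.mul_apply, blockDiag_eq_ite, Fin.sum_univ_succ, Matrix.one_apply,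
        -Finset.sum_boole]
  | copy_discard =>
    refine IsSubst.unique (isSubst_copy.comp (isSubst_discard.tensor (IsSubst.id 1)))
      (IsSubst.id 1) ?_
    ext i j
    fin_cases i <;> fin_cases j <;>
      simp [Matrix.mul_apply, blockDiag_eq_ite, Fin.sum_univ_succ, Matrix.one_apply,
        -Finset.sum_boole]
  | merge_assoc =>
    refine IsSubst.unique ((isSubst_merge.tensor (IsSubst.id 1)).comp isSubst_merge)
      (((IsSubst.id 1).tensor isSubst_merge).comp isSubst_merge) ?_
    ext i j
    fin_cases i <;> fin_cases j <;>
      simp [Matrix.mul_apply, blockDiag_eq_ite, Fin.sum_univ_succ, Matrix.one_apply,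
        -Finset.sum_boole]
  | merge_comm =>
    refine IsSubst.unique (isSubst_swap_one_one.comp isSubst_merge) isSubst_merge ?_
    ext i j
    fin_cases i <;> fin_cases j <;>
      simp [Matrix.mul_apply, blockDiag_eq_ite, Fin.sum_univ_succ, Matrix.one_apply,
        -Finset.sum_boole]
  | merge_unit =>
    refine IsSubst.unique ((isSubst_unit.tensor (IsSubst.id 1)).comp isSubst_merge)
      (IsSubst.id 1) ?_
    ext i j
    fin_cases i <;> fin_cases j <;>
      simp [Matrix.mul_apply, blockDiag_eq_ite, Fin.sum_univ_succ, Matrix.one_apply,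
        -Finset.sum_boole]
  | merge_copy =>
    refine IsSubst.unique (isSubst_merge.comp isSubst_copy)
      ((isSubst_copy.tensor isSubst_copy).comp
        ((((IsSubst.id 1).tensor isSubst_swap_one_one).tensor (IsSubst.id 1)).comp
          (isSubst_merge.tensor isSubst_merge))) ?_
    ext i j
    fin_cases i <;> fin_cases j <;>
      simp [Matrix.mul_apply, blockDiag_eq_ite, Fin.sum_univ_succ, Matrix.one_apply,
        -Finset.sum_boole]
  | unit_copy =>
    refine IsSubst.unique (isSubst_unit.comp isSubst_copy) (isSubst_unit.tensor isSubst_unit) ?_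
    ext i j
    fin_cases i <;> fin_cases j <;>
      simp [Matrix.mul_apply, blockDiag_eq_ite, Fin.sum_univ_succ, Matrix.one_apply,
        -Finset.sum_boole]
  | merge_discard =>
    refine IsSubst.unique (isSubst_merge.comp isSubst_discard)
      (isSubst_discard.tensor isSubst_discard) ?_
    ext i j
    fin_cases i <;> fin_cases j <;>
      simp [Matrix.mul_apply, blockDiag_eq_ite, Fin.sum_univ_succ, Matrix.one_apply,
        -Finset.sum_boole]
  | unit_discard =>
    refine IsSubst.unique (isSubst_unit.comp isSubst_discard) (IsSubst.id 0) ?_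
    ext i j
    fin_cases i <;> fin_cases j <;>
      simp [Matrix.mul_apply, blockDiag_eq_ite, Fin.sum_univ_succ, Matrix.one_apply,
        -Finset.sum_boole]
  | endo_mul r s =>
    refine IsSubst.unique ((isSubst_endo r).comp (isSubst_endo s)) (isSubst_endo _) ?_
    ext i j
    fin_cases i <;> fin_cases j <;>
      simp [Matrix.mul_apply, blockDiag_eq_ite, Fin.sum_univ_succ, Matrix.one_apply,
        -Finset.sum_boole]
  | endo_one =>
    refine IsSubst.unique (isSubst_endo 1) (IsSubst.id 1) ?_
    ext i j
    fin_cases i <;> fin_cases j <;>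
      simp [Matrix.mul_apply, blockDiag_eq_ite, Fin.sum_univ_succ, Matrix.one_apply,
        -Finset.sum_boole]
  | endo_add r s =>
    refine IsSubst.unique (isSubst_copy.comp
      (((isSubst_endo r).tensor (isSubst_endo s)).comp isSubst_merge)) (isSubst_endo _) ?_
    ext i j
    fin_cases i <;> fin_cases j <;>
      simp [Matrix.mul_apply, blockDiag_eq_ite, Fin.sum_univ_succ, Matrix.one_apply,
        -Finset.sum_boole]
  | endo_zero =>
    refine IsSubst.unique (isSubst_endo 0) (isSubst_discard.comp isSubst_unit) ?_
    ext i j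
    fin_cases i <;> fin_cases j <;>
      simp [Matrix.mul_apply, blockDiag_eq_ite, Fin.sum_univ_succ, Matrix.one_apply,
        -Finset.sum_boole]
  | endo_copy r =>
    refine IsSubst.unique ((isSubst_endo r).comp isSubst_copy)
      (isSubst_copy.comp ((isSubst_endo r).tensor (isSubst_endo r))) ?_
    ext i j
    fin_cases i <;> fin_cases j <;>
      simp [Matrix.mul_apply, blockDiag_eq_ite, Fin.sum_univ_succ, Matrix.one_apply,
        -Finset.sum_boole]
  | endo_discard r =>
    refine IsSubst.unique ((isSubst_endo r).comp isSubst_discard) isSubst_discard ?_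
    ext i j
    fin_cases i <;> fin_cases j <;>
      simp [Matrix.mul_apply, blockDiag_eq_ite, Fin.sum_univ_succ, Matrix.one_apply,
        -Finset.sum_boole]
  | merge_endo r =>
    refine IsSubst.unique (isSubst_merge.comp (isSubst_endo r))
      (((isSubst_endo r).tensor (isSubst_endo r)).comp isSubst_merge) ?_
    ext i j
    fin_cases i <;> fin_cases j <;>
      simp [Matrix.mul_apply, blockDiag_eq_ite, Fin.sum_univ_succ, Matrix.one_apply,
        -Finset.sum_boole]
  | unit_endo r =>
    refine IsSubst.unique (isSubst_unit.comp (isSubst_endo r)) isSubst_unit ?_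
    ext i j
    fin_cases i <;> fin_cases j <;>
      simp [Matrix.mul_apply, blockDiag_eq_ite, Fin.sum_univ_succ, Matrix.one_apply,
        -Finset.sum_boole]

/-! ### Bipartite diagrams as linear substitutions -/

lemma IsSubst.congr {m n : ℕ} {f : Fock m →ₗ[ℂ] Fock n} {M N : Matrix (Fin m) (Fin n) ℂ}
    (hf : IsSubst f M) (h : M = N) : IsSubst f N := h ▸ hf

lemma isSubst_copyN (n : ℕ) : IsSubst (bosonic (copyN n)) (Matrix.of fun _ _ => 1) := by
  induction n with
  | zero => exact isSubst_discard.congr (by ext i j; exact j.elim0)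
  | succ n ih =>
    refine (isSubst_copy.comp (ih.tensor (IsSubst.id 1))).congr ?_
    ext i j
    rw [Matrix.mul_apply, Fin.sum_univ_add (a := 1) (b := 1)]
    refine Fin.addCases (fun j => ?_) (fun j => ?_) j <;>
      simp only [Finset.univ_unique, Finset.sum_singleton, blockDiag_castAdd_castAdd,
        blockDiag_castAdd_natAdd, blockDiag_natAdd_castAdd, blockDiag_natAdd_natAdd] <;>
      simp [Matrix.one_apply, eq_iff_true_of_subsingleton]

lemma isSubst_mergeN (n : ℕ) : IsSubst (bosonic (mergeN n)) (Matrix.of fun _ _ => 1) := by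
  induction n with
  | zero => exact isSubst_unit.congr (by ext i j; exact i.elim0)
  | succ n ih =>
    refine ((ih.tensor (IsSubst.id 1)).comp isSubst_merge).congr ?_
    ext i j
    rw [Matrix.mul_apply, Fin.sum_univ_add (a := 1) (b := 1)]
    refine Fin.addCases (fun j => ?_) (fun j => ?_) i <;>
      simp only [Finset.univ_unique, Finset.sum_singleton, blockDiag_castAdd_castAdd,
        blockDiag_castAdd_natAdd, blockDiag_natAdd_castAdd, blockDiag_natAdd_natAdd] <;>
      simp [Matrix.one_apply, eq_iff_true_of_subsingleton]

/-- The matrix has no rows, so any M will do. -/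
lemma isSubst_units (n : ℕ) (M : Matrix (Fin 0) (Fin n) ℂ) : IsSubst (bosonic (units n)) M := by
  induction n with
  | zero => exact (IsSubst.id 0).congr (by ext i; exact i.elim0)
  | succ n ih => exact ((ih fun i => i.elim0).tensor isSubst_unit).congr (by ext i; exact i.elim0)

lemma isSubst_parN (n : ℕ) (f : Fin n → Diag 1 1) (r : Fin n → ℂ)
    (h : ∀ i, IsSubst (bosonic (f i)) (Matrix.of fun _ _ => r i)) :
    IsSubst (bosonic (parN n f)) (Matrix.diagonal r) := by
  induction n with
  | zero => exact (IsSubst.id 0).congr (by ext i; exact i.elim0)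
  | succ n ih =>
    refine ((ih _ _ fun i => h i.castSucc).tensor (h (Fin.last n))).congr ?_
    ext i j
    refine Fin.addCases (fun i => ?_) (fun i => ?_) i <;>
      refine Fin.addCases (fun j => ?_) (fun j => ?_) j
    · rw [blockDiag_castAdd_castAdd]
      simp only [Matrix.diagonal_apply, (Fin.castAdd_injective n 1).eq_iff]
      rfl
    · have : Fin.castAdd 1 i ≠ Fin.natAdd n j := by simp [Fin.ext_iff]; omega
      rw [blockDiag_castAdd_natAdd, Matrix.diagonal_apply_ne _ this]
    · have : Fin.natAdd n i ≠ Fin.castAdd 1 j := by simp [Fin.ext_iff]; omega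
      rw [blockDiag_natAdd_castAdd, Matrix.diagonal_apply_ne _ this]
    · rw [blockDiag_natAdd_natAdd, Subsingleton.elim i 0, Subsingleton.elim j 0]
      simp
      rfl

lemma append_eq_dite {m n : ℕ} (a : Fin m → ℕ) (b : Fin n → ℕ) (i : Fin (m + n)) :
    Fin.append a b i =
      if h : (i : ℕ) < m then a ⟨i, h⟩ else b ⟨i - m, by omega⟩ := by
  refine Fin.addCases (fun i => ?_) (fun i => ?_) i <;> simp

lemma bosonic_shuffle_ket {n : ℕ} (a b : Fin n → ℕ) (x y : Fin 1 → ℕ) (h h') :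
    bosonic (Diag.cast (m' := (n + 1) + (n + 1)) (n' := (n + n) + (1 + 1)) h h'
        (((idn n).par (swap 1 n)).par (idn 1)))
      (ket (Fin.append (Fin.append a x) (Fin.append b y)))
      = ket (Fin.append (Fin.append a b) (Fin.append x y)) := by
  have h1 : reindex h.symm (ket (Fin.append (Fin.append a x) (Fin.append b y)))
      = ket (Fin.append (Fin.append a (Fin.append x b)) y) := by
    rw [reindex_ket]
    congr 1
    ext i
    simp only [append_eq_dite, Fin.val_cast]
    split_ifs <;> first | omega | (congr 2; try omega)
  have h2 : reindex h' (ket (Fin.append (Fin.append a (Fin.append b x)) y))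
      = ket (Fin.append (Fin.append a b) (Fin.append x y)) := by
    rw [reindex_ket]
    congr 1
    ext i
    simp only [append_eq_dite, Fin.val_cast]
    split_ifs <;> first | omega | (congr 2; try omega)
  rw [bosonic_cast, LinearMap.comp_apply, LinearMap.comp_apply, h1]
  simp [bosonic_par, bosonic_idn, bosonic_swap, -reindex_ket, h2]

/-- The recursion permutes wires through transports, which are easier to follow on occupation
numbers than on matrices. -/
lemma bosonic_mergeBundle_ket {n : ℕ} (a b : Fin n → ℕ) :
    bosonic (mergeBundle n) (ket (Fin.append a b))
      = (∏ i, (Real.sqrt ((a i + b i).choose (a i)) : ℂ)) • ket fun i => a i + b i := by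
  induction n with
  | zero =>
    simp only [mergeBundle, bosonic_idn, Finset.univ_eq_empty, Finset.prod_empty, one_smul]
    exact congrArg ket (funext fun i => i.elim0)
  | succ n ih =>
    obtain ⟨a, x, rfl⟩ := exists_append (m := n) (n := 1) a
    obtain ⟨b, y, rfl⟩ := exists_append (m := n) (n := 1) b
    have h1 : bosonic merge (ket (Fin.append x y))
        = (Real.sqrt ((x 0 + y 0).choose (x 0)) : ℂ) • ket ![x 0 + y 0] := by
      have h0 : Fin.append x y 0 = x 0 := Fin.append_left x y 0
      have h0' : Fin.append x y 1 = y 0 := Fin.append_right x y 0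
      simp [bosonic, h0, h0']
    rw [mergeBundle, bosonic_seq, LinearMap.comp_apply, bosonic_shuffle_ket, bosonic_par,
      tensorMap_ket, ih, h1, Fin.prod_univ_add]
    simp only [map_smul, LinearMap.smul_apply, smul_smul, tensorBil_ket, Fin.append_left,
      Fin.append_right, Finset.univ_unique, Fin.default_eq_zero, Finset.prod_singleton]
    congr 1
    · exact mul_comm _ _
    · congr 1
      ext i
      refine Fin.addCases (fun i => ?_) (fun i => ?_) i
      · simp
      · simp [Subsingleton.elim i 0]

/-- The matrix is two identity matrices stacked on each other: both copies of a variable are sent to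
the same X_j. -/
lemma isSubst_mergeBundle (n : ℕ) : IsSubst (bosonic (mergeBundle n))
    (Matrix.of fun i j => Fin.append (fun i => if i = j then 1 else 0)
      (fun i => if i = j then 1 else 0) i) := by
  refine IsSubst.of_monomial fun s => ?_
  obtain ⟨a, b, hs⟩ := exists_append s
  rw [hs, bosonic_mergeBundle_ket, Fin.prod_univ_add]
  have h1 : (∏ i, (X i : MvPolynomial (Fin n) ℂ) ^ (a i)) * ∏ i, X i ^ (b i)
      = ∏ i, X i ^ (a i + b i) := by
    rw [← Finset.prod_mul_distrib]
    simp only [pow_add]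
  simp only [Matrix.of_apply, Fin.append_left, Fin.append_right, ite_smul, one_smul, zero_smul,
    Finset.sum_ite_eq, Finset.mem_univ, if_true, smul_smul]
  rw [h1, polyState_prod_X]
  congr 1
  have : ∀ s : Fin n → ℕ, occNorm s = ∏ i, (Real.sqrt (s i).factorial : ℂ) := fun s => by
    rw [occNorm, occFact, Nat.cast_prod, Real.sqrt_prod _ fun _ _ => by positivity]
    push_cast
    rfl
  rw [occNorm_append, this, this, this, ← Finset.prod_mul_distrib, ← Finset.prod_mul_distrib]
  refine Finset.prod_congr rfl fun i _ => ?_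
  rw [sqrt_factorial_add]
  ring

/-- The wires are arbitrary one-wire diagrams, so that an edge (`endo`) and a missing edge
(`discard` then `unit`, weight 0) are treated together. -/
lemma isSubst_wires (p q : ℕ) (f : Fin p → Fin q → Diag 1 1) (M : Fin p → Fin q → ℂ)
    (h : ∀ i j, IsSubst (bosonic (f i j)) (Matrix.of fun _ _ => M i j)) :
    IsSubst (bosonic (wires p q f)) (Matrix.of M) := by
  induction p with
  | zero => exact isSubst_units q _
  | succ p ih =>
    refine (((ih (fun i => f i.castSucc) (fun i => M i.castSucc) fun i => h i.castSucc).tensor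
      ((isSubst_copyN q).comp (isSubst_parN q _ _ (h (Fin.last p))))).comp
      (isSubst_mergeBundle q)).congr ?_
    ext i j
    rw [Matrix.mul_apply, Fin.sum_univ_add]
    refine Fin.addCases (fun i => ?_) (fun i => ?_) i
    · simp [-Fin.natAdd_eq_addNat]
      rfl
    · rw [Subsingleton.elim i 0]
      simp [Matrix.mul_apply, Matrix.diagonal_apply, -Fin.natAdd_eq_addNat]
      rfl

/-! ### Amplitudes of bipartite diagrams -/

lemma bosonic_creates (n : ℕ) :
    bosonic (creates n) (ket ![]) = ket fun _ => 1 := by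
  induction n with
  | zero => exact congrArg ket (Subsingleton.elim _ _)
  | succ n ih =>
    have h1 : (![] : Fin (0 + 0) → ℕ) = Fin.append ![] ![] := Subsingleton.elim _ _
    rw [creates, bosonic_par]
    refine (congrArg (fun s => tensorMap _ _ (ket s)) h1).trans ?_
    rw [tensorMap_ket, ih]
    simp only [bosonic, ofKets_ket, tensorBil_ket]
    congr 1
    ext i
    refine Fin.addCases (fun i => ?_) (fun i => ?_) i <;> simp

lemma bosonic_annihilates_ket (n : ℕ) (s : Fin n → ℕ) :
    bosonic (annihilates n) (ket s) = if s = fun _ => 1 then ket ![] else 0 := by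
  induction n with
  | zero =>
    rw [if_pos (Subsingleton.elim _ _)]
    exact congrArg ket (funext fun i => i.elim0)
  | succ n ih =>
    obtain ⟨a, x, rfl⟩ := exists_append (m := n) (n := 1) s
    have h1 : (Fin.append a x = fun _ => 1) ↔ (a = fun _ => 1) ∧ x 0 = 1 := by
      constructor
      · intro h
        exact ⟨funext fun i => by simpa using congrFun h (Fin.castAdd 1 i),
          by simpa using congrFun h (Fin.natAdd n 0)⟩
      · rintro ⟨rfl, h⟩
        ext i
        refine Fin.addCases (fun i => ?_) (fun i => ?_) i
        · simp
        · simp [Subsingleton.elim i 0, h]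
    rw [annihilates, bosonic_par, tensorMap_ket, ih]
    simp only [h1, bosonic, ofKets_ket, PNat.one_coe]
    split_ifs <;> simp_all
    exact (tensorBil_ket _ _).trans (congrArg ket (funext fun i => i.elim0))

lemma bosonic_annihilates (n : ℕ) (x : Fock n) :
    bosonic (annihilates n) x = x (fun _ => 1) • ket ![] := by
  induction x using Finsupp.induction_linear with
  | zero => simp
  | add f g hf hg => simp [hf, hg, add_smul]
  | single s c =>
    have : Finsupp.single s c = c • ket s := by simp [ket]
    rw [this, map_smul, bosonic_annihilates_ket]
    by_cases h : s = fun _ => 1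
    · simp [h, ket]
    · simp [h, ket]

/-- Expanding the product gives one term for each choice σ of a column in every row; only bijective
choices produce the squarefree monomial in all the variables. -/
lemma polyState_prod_sum_ones {p q : ℕ} (M : Matrix (Fin p) (Fin q) ℂ) :
    polyState q (∏ i, ∑ j, M i j • X j) (fun _ => 1)
      = ∑ σ : Fin p → Fin q with Function.Bijective σ, ∏ i, M i (σ i) := by
  rw [Finset.prod_univ_sum, map_sum, Finsupp.finsetSum_apply, Finset.sum_filter]
  simp only [Fintype.piFinset_univ]
  refine Finset.sum_congr rfl fun σ _ => ?_
  -- The exponent of X_j is the size of the fibre of σ over j.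
  have h1 : ∏ i, M i (σ i) • (X (σ i) : MvPolynomial (Fin q) ℂ)
      = (∏ i, M i (σ i)) • ∏ j, X j ^ (Finset.univ.filter fun i => σ i = j).card := by
    rw [Finset.prod_smul,
      ← Finset.prod_fiberwise Finset.univ σ fun i => (X (σ i) : MvPolynomial (Fin q) ℂ)]
    congr 1
    refine Finset.prod_congr rfl fun j _ => ?_
    rw [Finset.prod_congr rfl fun i hi => by rw [(Finset.mem_filter.mp hi).2], Finset.prod_const]
  -- A map is bijective exactly when every fibre has one element.
  have h2 : Function.Bijective σ ↔
      (fun j => (Finset.univ.filter fun i => σ i = j).card) = fun _ => 1 := by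
    simp only [funext_iff, Finset.card_eq_one, Function.bijective_iff_existsUnique]
    refine forall_congr' fun j => ?_
    simp [ExistsUnique, Finset.eq_singleton_iff_unique_mem]
  rw [h1, map_smul, polyState_prod_X]
  split_ifs with h
  · rw [h2] at h
    rw [h]
    simp [ket, occNorm, occFact]
  · rw [h2] at h
    simp [ket, h]

lemma amplitude_bipartite {p q : ℕ} {d : Diag p q} {M : Matrix (Fin p) (Fin q) ℂ}
    (h : IsSubst (bosonic d) M) :
    amplitude ((creates p).seq (d.seq (annihilates q)))
      = ∑ σ : Fin p → Fin q with Function.Bijective σ, ∏ i, M i (σ i) := by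
  have h1 := polyState_prod_X (fun _ : Fin p => 1)
  have h2 : occNorm (fun _ : Fin p => 1) = 1 := by simp [occNorm, occFact]
  rw [h2, one_smul] at h1
  rw [amplitude, bosonic_seq, bosonic_seq, LinearMap.comp_apply, LinearMap.comp_apply,
    bosonic_creates, bosonic_annihilates, ← h1, h]
  rw [← polyState_prod_sum_ones]
  simp [ket, linSubst]

/-! ### Soundness on formal sums -/

/-- Sequential composition of formal sums as a bilinear map. -/
def Lin.seqBil (l m n : ℕ) : Lin l m →ₗ[ℂ] Lin m n →ₗ[ℂ] Lin l n :=
  Finsupp.linearCombination ℂ fun d =>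
    Finsupp.linearCombination ℂ fun e => Lin.of (Diag.seq d e)

/-- Parallel composition of formal sums as a bilinear map. -/
def Lin.parBil (m n m' n' : ℕ) : Lin m n →ₗ[ℂ] Lin m' n' →ₗ[ℂ] Lin (m + m') (n + n') :=
  Finsupp.linearCombination ℂ fun d =>
    Finsupp.linearCombination ℂ fun e => Lin.of (Diag.par d e)

lemma Lin.seq_eq {l m n : ℕ} (x : Lin l m) (y : Lin m n) : x.seq y = seqBil l m n x y := by
  simp only [Lin.seq, seqBil, Finsupp.linearCombination_apply, Finsupp.sum,
    LinearMap.sum_apply, LinearMap.smul_apply, Finset.smul_sum, Lin.of,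
    Finsupp.smul_single, smul_eq_mul, mul_one]

lemma Lin.par_eq {m n m' n' : ℕ} (x : Lin m n) (y : Lin m' n') :
    x.par y = parBil m n m' n' x y := by
  simp only [Lin.par, parBil, Finsupp.linearCombination_apply, Finsupp.sum,
    LinearMap.sum_apply, LinearMap.smul_apply, Finset.smul_sum, Lin.of,
    Finsupp.smul_single, smul_eq_mul, mul_one]

@[simp] lemma Lin.seqBil_of {l m n : ℕ} (d : Diag l m) (e : Diag m n) :
    seqBil l m n (of d) (of e) = of (d.seq e) := by simp [seqBil, of]

@[simp] lemma Lin.parBil_of {m n m' n' : ℕ} (d : Diag m n) (e : Diag m' n') :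
    parBil m n m' n' (of d) (of e) = of (d.par e) := by simp [parBil, of]

@[simp] lemma bosonicLin_of {m n : ℕ} (d : Diag m n) : bosonicLin (Lin.of d) = bosonic d := by
  simp [bosonicLin, Lin.of]

lemma Lin.map_ext {m n : ℕ} {V : Type*} [AddCommMonoid V] [Module ℂ V] {f g : Lin m n →ₗ[ℂ] V}
    (h : ∀ d, f (Lin.of d) = g (Lin.of d)) : f = g :=
  Finsupp.lhom_ext' fun d => LinearMap.ext_ring (h d)

lemma Lin.bil_ext {l m n k : ℕ} {V : Type*} [AddCommMonoid V] [Module ℂ V]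
    {f g : Lin l m →ₗ[ℂ] Lin n k →ₗ[ℂ] V}
    (h : ∀ d e, f (Lin.of d) (Lin.of e) = g (Lin.of d) (Lin.of e)) : f = g :=
  Lin.map_ext fun d => Lin.map_ext fun e => h d e

lemma bosonicLin_seq {l m n : ℕ} (x : Lin l m) (y : Lin m n) :
    bosonicLin (x.seq y) = bosonicLin y ∘ₗ bosonicLin x := by
  have : (Lin.seqBil l m n).compr₂ bosonicLin
      = ((LinearMap.llcomp ℂ (Fock l) (Fock m) (Fock n)).compl₁₂ bosonicLin bosonicLin).flip :=
    Lin.bil_ext fun d e => by simp [bosonic_seq]; rfl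
  rw [Lin.seq_eq]
  exact congr($this x y)

lemma tensorMap_add_left {m n m' n' : ℕ} (f f' : Fock m →ₗ[ℂ] Fock n)
    (g : Fock m' →ₗ[ℂ] Fock n') : tensorMap (f + f') g = tensorMap f g + tensorMap f' g :=
  Fock.map_ext_append fun a b => by simp

lemma tensorMap_add_right {m n m' n' : ℕ} (f : Fock m →ₗ[ℂ] Fock n)
    (g g' : Fock m' →ₗ[ℂ] Fock n') : tensorMap f (g + g') = tensorMap f g + tensorMap f g' :=
  Fock.map_ext_append fun a b => by simp

lemma tensorMap_smul_left {m n m' n' : ℕ} (c : ℂ) (f : Fock m →ₗ[ℂ] Fock n)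
    (g : Fock m' →ₗ[ℂ] Fock n') : tensorMap (c • f) g = c • tensorMap f g :=
  Fock.map_ext_append fun a b => by simp

lemma tensorMap_smul_right {m n m' n' : ℕ} (c : ℂ) (f : Fock m →ₗ[ℂ] Fock n)
    (g : Fock m' →ₗ[ℂ] Fock n') : tensorMap f (c • g) = c • tensorMap f g :=
  Fock.map_ext_append fun a b => by simp

lemma bosonicLin_par {m n m' n' : ℕ} (x : Lin m n) (y : Lin m' n') :
    bosonicLin (x.par y) = tensorMap (bosonicLin x) (bosonicLin y) := by
  have : (Lin.parBil m n m' n').compr₂ bosonicLin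
      = (LinearMap.mk₂ ℂ tensorMap tensorMap_add_left tensorMap_smul_left tensorMap_add_right
          tensorMap_smul_right).compl₁₂ bosonicLin bosonicLin :=
    Lin.bil_ext fun d e => by simp [bosonic_par]
  rw [Lin.par_eq]
  exact congr($this x y)

/-- `Matrix.permanent` lets the permutation act on rows, hence τ corresponds to the bijection e ∘
τ⁻¹. -/
lemma sum_bijective_eq_permanent {p q : ℕ} (A : Matrix (Fin p) (Fin q) ℂ) (e : Fin p ≃ Fin q) :
    ∑ σ : Fin p → Fin q with Function.Bijective σ, ∏ i, A i (σ i)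
      = (A.submatrix id e).permanent := by
  rw [Matrix.permanent]
  symm
  refine Finset.sum_bij (fun τ _ => e ∘ τ.symm) ?_ ?_ ?_ ?_
  · intro τ _
    exact Finset.mem_filter.mpr ⟨Finset.mem_univ _, e.bijective.comp τ.symm.bijective⟩
  · intro τ _ τ' _ h
    have : τ.symm = τ'.symm := Equiv.ext fun i => e.injective (congrFun h i)
    simpa using congrArg Equiv.symm this
  · intro σ hσ
    have hσ := (Finset.mem_filter.mp hσ).2
    exact ⟨((Equiv.ofBijective σ hσ).trans e.symm).symm, Finset.mem_univ _, by ext; simp⟩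
  · intro τ _
    rw [← Equiv.prod_comp τ fun i => A i ((e ∘ τ.symm) i)]
    simp

lemma card_bijective (p q : ℕ) :
    ((Finset.univ.filter fun σ : Fin p → Fin q => Function.Bijective σ).card : ℂ)
      = if p = q then (q.factorial : ℂ) else 0 := by
  split_ifs with h
  · subst h
    have := sum_bijective_eq_permanent (Matrix.of fun (_ _ : Fin p) => (1 : ℂ)) (Equiv.refl _)
    simpa [Matrix.permanent, Fintype.card_perm] using this
  · rw [Finset.filter_false_of_mem, Finset.card_empty, Nat.cast_zero]
    intro σ _ hσ
    exact h (by simpa using Fintype.card_of_bijective hσ)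

lemma bosonic_creates_mergeN (n : ℕ) :
    bosonic ((creates n).seq (mergeN n)) (ket ![]) = (Real.sqrt n.factorial : ℂ) • ket ![n] := by
  have h1 := polyState_prod_X (fun _ : Fin n => 1)
  have h2 : occNorm (fun _ : Fin n => 1) = 1 := by simp [occNorm, occFact]
  have h3 := polyState_prod_X ![n]
  rw [h2, one_smul] at h1
  rw [occNorm_cons, occNorm_empty, mul_one] at h3
  rw [bosonic_seq, LinearMap.comp_apply, bosonic_creates, ← h1, isSubst_mergeN, ← h3]
  simp [linSubst]

/-- The left side is the coefficient of X_1⋯X_n in (X_1 + ⋯ + X_n)^k. The factor √k! is kept on the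
left because √k! |k⟩ is the state of X^k. -/
lemma bosonic_copyN_annihilates (n k : ℕ) :
    (Real.sqrt k.factorial : ℂ) • bosonic ((copyN n).seq (annihilates n)) (ket ![k])
      = if k = n then (n.factorial : ℂ) • ket ![] else 0 := by
  have h3 := polyState_prod_X ![k]
  rw [occNorm_cons, occNorm_empty, mul_one] at h3
  rw [← map_smul, ← h3, bosonic_seq, LinearMap.comp_apply, isSubst_copyN, bosonic_annihilates]
  have h4 := polyState_prod_sum_ones (p := k) (q := n) (Matrix.of fun _ _ => 1)
  simp only [Matrix.of_apply, Finset.prod_const_one, Finset.sum_const, nsmul_eq_mul, mul_one,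
    card_bijective] at h4
  have h5 : linSubst (Matrix.of fun _ _ => 1) (∏ i, X i ^ ![k] i)
    = ∏ _i : Fin k, ∑ j : Fin n, (1 : ℂ) • X j := by simp [linSubst]
  rw [h5, h4, ite_smul, zero_smul]

lemma bosonic_annihilate_ket (n : ℕ+) (k : ℕ) :
    bosonic (annihilate n) (ket ![k]) = if k = n then ket ![] else 0 :=
  ofKets_ket _ _

lemma NormAxiom.sound {m n : ℕ} {x y : Lin m n} (h : NormAxiom x y) :
    bosonicLin x = bosonicLin y := by
  cases h with
  | path h => simp [h.sound]
  | create_norm n =>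
    refine Fock.map_ext fun s => ?_
    rw [Subsingleton.elim s ![], map_smul, bosonicLin_of, bosonicLin_of, LinearMap.smul_apply,
      bosonic_creates_mergeN, smul_smul, one_div, inv_mul_cancel₀, one_smul]
    · simp [bosonic]
    · simp [Nat.factorial_ne_zero]
  | annihilate_norm n =>
    refine Fock.map_ext fun s => ?_
    obtain ⟨k, rfl⟩ : ∃ k, s = ![k] := ⟨s 0, by ext i; rw [Subsingleton.elim i 0]; rfl⟩
    have h1 := bosonic_copyN_annihilates n k
    have h0 : ∀ k : ℕ, (Real.sqrt k.factorial : ℂ) ≠ 0 := fun k => by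
      simp [Nat.factorial_ne_zero]
    have h2 : bosonic ((copyN n).seq (annihilates n)) (ket ![k])
        = if k = n then (Real.sqrt (n : ℕ).factorial : ℂ) • ket ![] else 0 := by
      refine smul_right_injective _ (h0 k) ?_
      simp only [h1]
      split_ifs with h
      · rw [h, smul_smul, sqrt_mul_self_natCast]
      · simp
    rw [map_smul, bosonicLin_of, bosonicLin_of, LinearMap.smul_apply, h2,
      bosonic_annihilate_ket]
    by_cases h : k = n
    · rw [if_pos h, if_pos h, smul_smul, one_div, inv_mul_cancel₀ (h0 _), one_smul]
    · rw [if_neg h, if_neg h, smul_zero]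

lemma QPathAxiom.sound {m n : ℕ} {x y : Lin m n} (h : QPathAxiom x y) :
    bosonicLin x = bosonicLin y := by
  cases h with
  | norm h => exact h.sound
  | create_branch =>
    refine Fock.map_ext fun s => ?_
    have h1 : bosonic copy (ket ![1]) = ket ![0, 1] + ket ![1, 0] := by
      simp [bosonic, Finset.sum_range_succ]
    have h2 : bosonic ((create 1).par unit) (ket (Fin.append ![] ![])) = ket ![1, 0] := by
      rw [bosonic_par, tensorMap_ket]
      simp only [bosonic, ofKets_ket, tensorBil_ket, PNat.one_coe]
      exact congrArg ket (by ext i; fin_cases i <;> rfl)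
    have h3 : bosonic (unit.par (create 1)) (ket (Fin.append ![] ![])) = ket ![0, 1] := by
      rw [bosonic_par, tensorMap_ket]
      simp only [bosonic, ofKets_ket, tensorBil_ket, PNat.one_coe]
      exact congrArg ket (by ext i; fin_cases i <;> rfl)
    have h4 : bosonic (create 1) (ket s) = ket ![1] := by simp [bosonic]
    rw [map_add, bosonicLin_of, bosonicLin_of, bosonicLin_of, LinearMap.add_apply, bosonic_seq,
      LinearMap.comp_apply, h4, h1, add_comm]
    obtain rfl : s = Fin.append (m := 0) (n := 0) ![] ![] := Subsingleton.elim _ _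
    exact congrArg₂ _ h2.symm h3.symm
  | annihilate_branch =>
    refine Fock.map_ext_append (m := 1) (m' := 1) fun a b => ?_
    have h1 : bosonic merge (ket (Fin.append a b))
        = (Real.sqrt ((a 0 + b 0).choose (a 0)) : ℂ) • ket ![a 0 + b 0] :=
      (ofKets_ket _ _).trans rfl
    have h0 : tensorBil 0 0 (ket ![]) (ket ![]) = ket ![] :=
      (tensorBil_ket _ _).trans (congrArg ket (Subsingleton.elim (α := Fin 0 → ℕ) _ _))
    have h2 : bosonic ((annihilate 1).par .discard) (ket (Fin.append a b))
        = if a 0 = 1 ∧ b 0 = 0 then ket ![] else 0 := by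
      rw [bosonic_par, tensorMap_ket]
      simp only [bosonic, ofKets_ket, PNat.one_coe]
      by_cases ha : a 0 = 1 <;> by_cases hb : b 0 = 0 <;> simp [ha, hb, -tensorBil_ket, h0]
    have h3 : bosonic (Diag.par .discard (annihilate 1)) (ket (Fin.append a b))
        = if a 0 = 0 ∧ b 0 = 1 then ket ![] else 0 := by
      rw [bosonic_par, tensorMap_ket]
      simp only [bosonic, ofKets_ket, PNat.one_coe]
      by_cases ha : a 0 = 0 <;> by_cases hb : b 0 = 1 <;> simp [ha, hb, -tensorBil_ket, h0]
    rw [map_add, bosonicLin_of, bosonicLin_of, bosonicLin_of, LinearMap.add_apply, bosonic_seq,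
      LinearMap.comp_apply]
    refine Eq.trans ?_ (congrArg₂ (· + ·) h2 h3).symm
    refine (congrArg _ h1).trans ?_
    generalize a 0 = x, b 0 = y
    rw [map_smul, bosonic_annihilate_ket, PNat.one_coe]
    -- Both sides vanish unless x + y = 1, and then the binomial coefficient is 1.
    rcases x with - | - | x
    · rcases y with - | - | y <;> simp
    · rcases y with - | y <;> simp
    · simp
      omega
  | create_discard => 
    refine Fock.map_ext fun s => ?_
    simp [bosonic]
  | unit_annihilate =>
    refine Fock.map_ext fun s => ?_
    simp [bosonic]
  | scalar r =>
    refine Fock.map_ext fun s => ?_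
    simp [bosonic, Subsingleton.elim s ![]]

theorem Rewrites.sound {ax : ∀ m n : ℕ, Lin m n → Lin m n → Prop}
    (hax : ∀ m n x y, ax m n x y → bosonicLin x = bosonicLin y) {m n : ℕ} {x y : Lin m n}
    (h : Rewrites ax x y) : bosonicLin x = bosonicLin y := by
  induction h with
  | rule h => exact hax _ _ _ _ h
  | refl x => rfl
  | symm _ ih => exact ih.symm
  | trans _ _ ih1 ih2 => exact ih1.trans ih2
  | add _ _ ih1 ih2 => rw [map_add, map_add, ih1, ih2]
  | smul c _ ih => rw [map_smul, map_smul, ih]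
  | seq _ _ ih1 ih2 => rw [bosonicLin_seq, bosonicLin_seq, ih1, ih2]
  | par _ _ ih1 ih2 => rw [bosonicLin_par, bosonicLin_par, ih1, ih2]

/-! ### Perfect matchings -/

namespace WeightedBipartiteGraph

variable {p q : ℕ} (G : WeightedBipartiteGraph p q)

lemma exists_of_mem_edgeSet (e : G.graph.edgeSet) :
    ∃ (i : Fin p) (j : Fin q), G.graph.Adj (Sum.inl i) (Sum.inr j) ∧
      (e : Sym2 (Fin p ⊕ Fin q)) = s(Sum.inl i, Sum.inr j) := by
  obtain ⟨e, he⟩ := e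
  induction e with
  | h a b =>
    have hab : G.graph.Adj a b := he
    have := G.bipartite hab
    rcases a with i | j <;> rcases b with i' | j' <;> simp at this
    · exact ⟨i, j', hab, rfl⟩
    · exact ⟨i', j, hab.symm, Sym2.eq_swap⟩

/-- A perfect matching is the graph of a bijection that uses only edges: each left node has one
partner, and each right node is a partner exactly once. -/
lemma matchingSum_eq :
    G.matchingSum = ∑ σ : Fin p → Fin q with Function.Bijective σ, ∏ i, G.adjacency i (σ i) := by
  classical
  symm
  -- A bijection that uses a non-edge contributes a zero factor.
  have h1 : ∑ σ : Fin p → Fin q with Function.Bijective σ, ∏ i, G.adjacency i (σ i)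
      = ∑ σ : Fin p → Fin q with Function.Bijective σ ∧
          ∀ i, G.graph.Adj (Sum.inl i) (Sum.inr (σ i)), ∏ i, G.adjacency i (σ i) := by
    rw [← Finset.filter_filter]
    symm
    refine Finset.sum_filter_of_ne fun σ _ h i => ?_
    by_contra hi
    exact h (Finset.prod_eq_zero (Finset.mem_univ i) (by simp [adjacency, hi]))
  rw [h1, matchingSum]
  let edge : ∀ σ : Fin p → Fin q, (∀ i, G.graph.Adj (Sum.inl i) (Sum.inr (σ i))) →
      Fin p → G.graph.edgeSet := fun σ h i => ⟨s(Sum.inl i, Sum.inr (σ i)), h i⟩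
  have edge_inj : ∀ σ h, Function.Injective (edge σ h) := fun σ h i j hij => by
    have := congrArg Subtype.val hij
    simp [edge] at this
    exact this.1
  refine Finset.sum_bij (fun σ hσ => Finset.univ.image (edge σ (Finset.mem_filter.mp hσ).2.2))
    ?_ ?_ ?_ ?_
  · intro σ hσ
    have hσ' := (Finset.mem_filter.mp hσ).2
    refine Finset.mem_filter.mpr ⟨Finset.mem_univ _, ?_⟩
    rintro (i | j)
    · refine ⟨edge σ hσ'.2 i, ⟨by simp, by simp [edge]⟩, ?_⟩
      rintro e ⟨he, hi⟩
      obtain ⟨i', _, rfl⟩ := Finset.mem_image.mp he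
      simp [edge] at hi
      rw [hi]
    · obtain ⟨i, rfl⟩ := hσ'.1.2 j
      refine ⟨edge σ hσ'.2 i, ⟨by simp, by simp [edge]⟩, ?_⟩
      rintro e ⟨he, hi⟩
      obtain ⟨i', _, rfl⟩ := Finset.mem_image.mp he
      simp [edge] at hi
      rw [hσ'.1.1 hi]
  · intro σ hσ τ hτ h
    ext i
    have : edge σ (Finset.mem_filter.mp hσ).2.2 i
        ∈ Finset.univ.image (edge τ (Finset.mem_filter.mp hτ).2.2) := by
      rw [← h]; simp
    obtain ⟨j, _, hj⟩ := Finset.mem_image.mp this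
    have hj := congrArg Subtype.val hj
    simp [edge] at hj
    rw [← hj.2, hj.1]
  · intro M hM
    have hM := (Finset.mem_filter.mp hM).2
    have h2 : ∀ i, ∃ j, ∃ h : G.graph.Adj (Sum.inl i) (Sum.inr j),
        (⟨s(Sum.inl i, Sum.inr j), h⟩ : G.graph.edgeSet) ∈ M := fun i => by
      obtain ⟨e, ⟨he, hi⟩, -⟩ := hM (Sum.inl i)
      obtain ⟨i', j, hij, h⟩ := G.exists_of_mem_edgeSet e
      rw [h] at hi
      simp at hi
      subst hi
      exact ⟨j, hij, by rwa [show (⟨_, hij⟩ : G.graph.edgeSet) = e from Subtype.ext h.symm]⟩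
    choose σ hσ hσM using h2
    have h3 : ∀ e ∈ M, ∃ i, e = edge σ hσ i := fun e he => by
      obtain ⟨i, j, hij, h⟩ := G.exists_of_mem_edgeSet e
      exact ⟨i, (hM (Sum.inl i)).unique ⟨he, by simp [h]⟩ ⟨hσM i, by simp [edge]⟩⟩
    -- Injectivity is uniqueness of the matching edge at a right node, surjectivity its existence.
    have h4 : Function.Bijective σ := by
      constructor
      · intro i i' hii
        refine edge_inj σ hσ ((hM (Sum.inr (σ i))).unique ⟨hσM i, by simp [edge]⟩ ⟨hσM i', ?_⟩)
        simp [edge, hii]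
      · intro j
        obtain ⟨e, ⟨he, hj⟩, -⟩ := hM (Sum.inr j)
        obtain ⟨i, rfl⟩ := h3 e he
        simp [edge] at hj
        exact ⟨i, hj.symm⟩
    refine ⟨σ, Finset.mem_filter.mpr ⟨Finset.mem_univ _, h4, hσ⟩, ?_⟩
    ext e
    constructor
    · intro he
      obtain ⟨i, _, rfl⟩ := Finset.mem_image.mp he
      exact hσM i
    · intro he
      obtain ⟨i, rfl⟩ := h3 e he
      simp
  · intro σ hσ
    rw [Finset.prod_image fun i _ j _ h => edge_inj _ _ h]
    refine Finset.prod_congr rfl fun i _ => ?_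
    have := (Finset.mem_filter.mp hσ).2.2 i
    simp [adjacency, this, edge]

lemma amplitude_diagram :
    amplitude G.diagram
      = ∑ σ : Fin p → Fin q with Function.Bijective σ, ∏ i, G.adjacency i (σ i) := by
  refine amplitude_bipartite (M := Matrix.of G.adjacency) (isSubst_wires p q _ _ fun i j => ?_)
  split_ifs with h
  · simpa [adjacency, h] using isSubst_endo _
  · exact (isSubst_discard.comp isSubst_unit).congr (by ext; simp [adjacency, h, Matrix.mul_apply])

end WeightedBipartiteGraph

theorem IsNormalForm.amplitude_eq {d : Diag 0 0} {p q : ℕ} {G : WeightedBipartiteGraph p q}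
    {N : ℂ} (h : IsNormalForm d G N) :
    amplitude d
      = N * ∑ σ : Fin p → Fin q with Function.Bijective σ, ∏ i, G.adjacency i (σ i) := by
  have h1 := Rewrites.sound (fun _ _ _ _ h => NormAxiom.sound h) h
  rw [← G.amplitude_diagram, amplitude, amplitude, ← bosonicLin_of, h1]
  simp

end QPath

end

/-! ### The quotient of formal sums by rewriting. -/

noncomputable section

namespace QPath

open Diag

/-! ### Diagrams modulo rewriting -/

/-- A family of relations on formal sums of diagrams. -/
abbrev Rules : Type := ∀ m n : ℕ, Lin m n → Lin m n → Prop

/-- A set of rules from which the axioms of Path can be derived. -/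
class IncludesPath (ax : Rules) : Prop where
  path : ∀ {m n : ℕ} {d e : Diag m n}, PathAxiom d e → Rewrites ax (Lin.of d) (Lin.of e)

instance : IncludesPath @NormAxiom := ⟨fun h => .rule (.path h)⟩

instance : IncludesPath @QPathAxiom := ⟨fun h => .rule (.norm (.path h))⟩

/-- The formal sums of diagrams that can be rewritten to zero. -/
def nullSums (ax : Rules) (m n : ℕ) : Submodule ℂ (Lin m n) where
  carrier := {x | Rewrites ax x 0}
  zero_mem' := .refl 0
  add_mem' hx hy := by simpa using hx.add hy
  smul_mem' c x hx := by simpa using hx.smul c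

/-- Rewriting is compatible with sums, so it is congruence modulo a subspace, and equality in the
linear quotient is rewritability. -/
lemma rewrites_iff_sub_mem {ax : Rules} {m n : ℕ} {x y : Lin m n} :
    Rewrites ax x y ↔ x - y ∈ nullSums ax m n := by
  constructor
  · intro h
    have : Rewrites ax (x + -y) (y + -y) := h.add (.refl _)
    rwa [add_neg_cancel, ← sub_eq_add_neg] at this
  · intro h
    have : Rewrites ax (x - y + y) (0 + y) := Rewrites.add h (.refl _)
    simpa using this

/-- Formal sums of diagrams modulo rewriting. -/
abbrev Cls (ax : Rules) (m n : ℕ) : Type := Lin m n ⧸ nullSums ax m n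

namespace Cls

variable {ax : Rules}

/-- The class of a formal sum. -/
def ofLin (ax : Rules) {m n : ℕ} : Lin m n →ₗ[ℂ] Cls ax m n := (nullSums ax m n).mkQ

/-- The class of a diagram. -/
def mk (ax : Rules) {m n : ℕ} (d : Diag m n) : Cls ax m n := ofLin ax (Lin.of d)

lemma ofLin_eq_iff {m n : ℕ} {x y : Lin m n} : ofLin ax x = ofLin ax y ↔ Rewrites ax x y := by
  rw [rewrites_iff_sub_mem]
  exact Submodule.Quotient.eq _

lemma induction {m n : ℕ} {P : Cls ax m n → Prop} (x : Cls ax m n) (zero : P 0)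
    (add : ∀ x y, P x → P y → P (x + y)) (smul : ∀ (c : ℂ) d, P (c • mk ax d)) : P x := by
  obtain ⟨x, rfl⟩ := Submodule.mkQ_surjective _ x
  induction x using Finsupp.induction_linear with
  | zero => simpa using zero
  | add f g hf hg => rw [map_add]; exact add _ _ hf hg
  | single d c =>
    have : Finsupp.single d c = c • Lin.of d := by simp [Lin.of]
    rw [this, map_smul]
    exact smul c d

/-- Sequential composition as a bilinear map. -/
def seqBil (ax : Rules) (l m n : ℕ) : Cls ax l m →ₗ[ℂ] Cls ax m n →ₗ[ℂ] Cls ax l n :=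
  (nullSums ax l m).liftQ
    (LinearMap.mk₂ ℂ (fun x => (nullSums ax m n).liftQ ((ofLin ax) ∘ₗ Lin.seqBil l m n x)
      fun y (hy : Rewrites ax y 0) => by
        have := ofLin_eq_iff.mpr (Rewrites.seq (Rewrites.refl x) hy)
        simpa [Lin.seq_eq] using this)
      (fun x x' y => by
        obtain ⟨y, rfl⟩ := Submodule.mkQ_surjective _ y
        exact (congrArg (ofLin ax) (LinearMap.congr_fun (map_add (Lin.seqBil l m n) x x') y)).trans
          (map_add (ofLin ax) _ _))
      (fun c x y => by
        obtain ⟨y, rfl⟩ := Submodule.mkQ_surjective _ y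
        exact (congrArg (ofLin ax) (LinearMap.congr_fun (map_smul (Lin.seqBil l m n) c x) y)).trans
          (map_smul (ofLin ax) _ _))
      (fun x y y' => by simp) (fun c x y => by simp))
    fun x (hx : Rewrites ax x 0) => by
      refine LinearMap.ext fun y => ?_
      obtain ⟨y, rfl⟩ := Submodule.mkQ_surjective _ y
      have := ofLin_eq_iff.mpr (Rewrites.seq hx (Rewrites.refl y))
      rw [Lin.seq_eq, Lin.seq_eq, map_zero, LinearMap.zero_apply, map_zero] at this
      exact this

/-- Parallel composition as a bilinear map. -/
def parBil (ax : Rules) (m n m' n' : ℕ) :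
    Cls ax m n →ₗ[ℂ] Cls ax m' n' →ₗ[ℂ] Cls ax (m + m') (n + n') :=
  (nullSums ax m n).liftQ
    (LinearMap.mk₂ ℂ (fun x => (nullSums ax m' n').liftQ ((ofLin ax) ∘ₗ Lin.parBil m n m' n' x)
      fun y (hy : Rewrites ax y 0) => by
        have := ofLin_eq_iff.mpr (Rewrites.par (Rewrites.refl x) hy)
        simpa [Lin.par_eq] using this)
      (fun x x' y => by
        obtain ⟨y, rfl⟩ := Submodule.mkQ_surjective _ y
        exact (congrArg (ofLin ax)
          (LinearMap.congr_fun (map_add (Lin.parBil m n m' n') x x') y)).trans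
          (map_add (ofLin ax) _ _))
      (fun c x y => by
        obtain ⟨y, rfl⟩ := Submodule.mkQ_surjective _ y
        exact (congrArg (ofLin ax)
          (LinearMap.congr_fun (map_smul (Lin.parBil m n m' n') c x) y)).trans
          (map_smul (ofLin ax) _ _))
      (fun x y y' => by simp) (fun c x y => by simp))
    fun x (hx : Rewrites ax x 0) => by
      refine LinearMap.ext fun y => ?_
      obtain ⟨y, rfl⟩ := Submodule.mkQ_surjective _ y
      have := ofLin_eq_iff.mpr (Rewrites.par hx (Rewrites.refl y))
      rw [Lin.par_eq, Lin.par_eq, map_zero, LinearMap.zero_apply, map_zero] at this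
      exact this

/-- Sequential composition. -/
def seq {l m n : ℕ} (x : Cls ax l m) (y : Cls ax m n) : Cls ax l n := seqBil ax l m n x y

/-- Parallel composition. -/
def par {m n m' n' : ℕ} (x : Cls ax m n) (y : Cls ax m' n') : Cls ax (m + m') (n + n') :=
  parBil ax _ _ _ _ x y

/-- Transport along equalities of the numbers of wires. -/
def cast {m n m' n' : ℕ} (hm : m = m') (hn : n = n') (x : Cls ax m n) : Cls ax m' n' :=
  hm ▸ hn ▸ x

@[simp] lemma mk_seq {l m n : ℕ} (d : Diag l m) (e : Diag m n) :
    mk ax (d.seq e) = (mk ax d).seq (mk ax e) := by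
  have : (ofLin ax) (Lin.seqBil l m n (Lin.of d) (Lin.of e)) = (mk ax d).seq (mk ax e) := rfl
  rw [← this, Lin.seqBil_of]; rfl

@[simp] lemma mk_par {m n m' n' : ℕ} (d : Diag m n) (e : Diag m' n') :
    mk ax (d.par e) = (mk ax d).par (mk ax e) := by
  have : (ofLin ax) (Lin.parBil m n m' n' (Lin.of d) (Lin.of e)) = (mk ax d).par (mk ax e) := rfl
  rw [← this, Lin.parBil_of]; rfl

@[simp] lemma mk_cast {m n m' n' : ℕ} (hm : m = m') (hn : n = n') (d : Diag m n) :
    mk ax (d.cast hm hn) = (mk ax d).cast hm hn := by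
  subst hm hn; rfl

section
variable {l m n m' n' : ℕ}
@[simp] lemma zero_seq (y : Cls ax m n) : (0 : Cls ax l m).seq y = 0 := by simp [seq]
@[simp] lemma seq_zero (x : Cls ax l m) : x.seq (0 : Cls ax m n) = 0 := by simp [seq]
@[simp] lemma add_seq (x x' : Cls ax l m) (y : Cls ax m n) :
    (x + x').seq y = x.seq y + x'.seq y := by simp [seq]
@[simp] lemma seq_add (x : Cls ax l m) (y y' : Cls ax m n) :
    x.seq (y + y') = x.seq y + x.seq y' := by simp [seq]
@[simp] lemma smul_seq (c : ℂ) (x : Cls ax l m) (y : Cls ax m n) :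
    (c • x).seq y = c • x.seq y := by simp [seq]
@[simp] lemma seq_smul (c : ℂ) (x : Cls ax l m) (y : Cls ax m n) :
    x.seq (c • y) = c • x.seq y := by simp [seq]
@[simp] lemma zero_par (y : Cls ax m' n') : (0 : Cls ax m n).par y = 0 := by simp [par]
@[simp] lemma par_zero (x : Cls ax m n) : x.par (0 : Cls ax m' n') = 0 := by simp [par]
@[simp] lemma add_par (x x' : Cls ax m n) (y : Cls ax m' n') :
    (x + x').par y = x.par y + x'.par y := by simp [par]
@[simp] lemma par_add (x : Cls ax m n) (y y' : Cls ax m' n') :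
    x.par (y + y') = x.par y + x.par y' := by simp [par]
@[simp] lemma smul_par (c : ℂ) (x : Cls ax m n) (y : Cls ax m' n') :
    (c • x).par y = c • x.par y := by simp [par]
@[simp] lemma par_smul (c : ℂ) (x : Cls ax m n) (y : Cls ax m' n') :
    x.par (c • y) = c • x.par y := by simp [par]
@[simp] lemma cast_zero (hm : m = m') (hn : n = n') : cast hm hn (0 : Cls ax m n) = 0 := by
  subst hm hn; rfl
@[simp] lemma cast_add (hm : m = m') (hn : n = n') (x y : Cls ax m n) :
    cast hm hn (x + y) = cast hm hn x + cast hm hn y := by subst hm hn; rfl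
@[simp] lemma cast_smul (hm : m = m') (hn : n = n') (c : ℂ) (x : Cls ax m n) :
    cast hm hn (c • x) = c • cast hm hn x := by subst hm hn; rfl
end

/-! ### The PROP structure -/

/-- The identity, as a morphism between equal numbers of wires. -/
def castId (ax : Rules) {m n : ℕ} (h : m = n) : Cls ax m n := (mk ax (idn m)).cast rfl h

@[simp] lemma castId_rfl (m : ℕ) : castId ax (rfl : m = m) = mk ax (idn m) := rfl

variable [IncludesPath ax]

lemma mk_eq {m n : ℕ} {d e : Diag m n} (h : PathAxiom d e) : mk ax d = mk ax e :=
  ofLin_eq_iff.mpr (IncludesPath.path h)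

lemma id_seq {m n : ℕ} (x : Cls ax m n) : (mk ax (idn m)).seq x = x := by
  induction x using induction with
  | zero => simp
  | add x y hx hy => simp [hx, hy]
  | smul c d => rw [seq_smul, ← mk_seq, mk_eq (.id_seq d)]

lemma seq_id {m n : ℕ} (x : Cls ax m n) : x.seq (mk ax (idn n)) = x := by
  induction x using induction with
  | zero => simp
  | add x y hx hy => simp [hx, hy]
  | smul c d => rw [smul_seq, ← mk_seq, mk_eq (.seq_id d)]

lemma seq_assoc {k l m n : ℕ} (x : Cls ax k l) (y : Cls ax l m) (z : Cls ax m n) :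
    (x.seq y).seq z = x.seq (y.seq z) := by
  induction x using induction with
  | zero => simp
  | add x x' hx hx' => simp [hx, hx']
  | smul c d =>
    induction y using induction with
    | zero => simp
    | add y y' hy hy' => simp_all
    | smul c' e =>
      induction z using induction with
      | zero => simp
      | add z z' hz hz' => simp_all
      | smul c'' f =>
        simp only [smul_seq, seq_smul, ← mk_seq, mk_eq (.seq_assoc d e f)]

lemma par_id (m n : ℕ) : (mk ax (idn m)).par (mk ax (idn n)) = mk ax (idn (m + n)) := by
  rw [← mk_par, mk_eq (.par_id m n)]

lemma interchange {l m n l' m' n' : ℕ} (x : Cls ax l m) (y : Cls ax m n) (x' : Cls ax l' m')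
    (y' : Cls ax m' n') : (x.seq y).par (x'.seq y') = (x.par x').seq (y.par y') := by
  induction x using induction with
  | zero => simp
  | add x z hx hz => simp [hx, hz]
  | smul c d =>
    induction y using induction with
    | zero => simp
    | add y z hy hz => simp_all
    | smul c' e =>
      induction x' using induction with
      | zero => simp
      | add x z hx hz => simp_all
      | smul c₂ d' =>
        induction y' using induction with
        | zero => simp
        | add y z hy hz => simp_all
        | smul c₂' e' =>
          simp only [smul_seq, seq_smul, smul_par, par_smul, ← mk_seq, ← mk_par,
            mk_eq (.interchange d e d' e')]
          simp only [smul_smul]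
          congr 1
          ring

lemma empty_par {m n : ℕ} (x : Cls ax m n) :
    ((mk ax (idn 0)).par x).cast (Nat.zero_add m) (Nat.zero_add n) = x := by
  induction x using induction with
  | zero => simp
  | add x y hx hy => simp [hx, hy]
  | smul c d => rw [par_smul, cast_smul, ← mk_par, ← mk_cast, mk_eq (.empty_par d)]

lemma par_empty {m n : ℕ} (x : Cls ax m n) : x.par (mk ax (idn 0)) = x := by
  induction x using induction with
  | zero => simp
  | add x y hx hy => rw [add_par, hx, hy]
  | smul c d => rw [smul_par, ← mk_par, mk_eq (.par_empty d)]

lemma par_assoc {m n m' n' m'' n'' : ℕ} (x : Cls ax m n) (y : Cls ax m' n')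
    (z : Cls ax m'' n'') :
    ((x.par y).par z).cast (Nat.add_assoc m m' m'') (Nat.add_assoc n n' n'')
      = x.par (y.par z) := by
  induction x using induction with
  | zero => simp
  | add x x' hx hx' => simp [hx, hx']
  | smul c d =>
    induction y using induction with
    | zero => simp
    | add y y' hy hy' => simp_all
    | smul c' e =>
      induction z using induction with
      | zero => simp
      | add z z' hz hz' => simp_all
      | smul c'' f =>
        simp only [smul_par, par_smul, cast_smul, ← mk_par, ← mk_cast, mk_eq (.par_assoc d e f)]

lemma swap_natural {m n m' n' : ℕ} (x : Cls ax m n) (y : Cls ax m' n') :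
    (x.par y).seq (mk ax (swap n n')) = (mk ax (swap m m')).seq (y.par x) := by
  induction x using induction with
  | zero => simp
  | add x z hx hz => simp [hx, hz]
  | smul c d =>
    induction y using induction with
    | zero => simp
    | add y z hy hz => simp_all
    | smul c' e =>
      simp only [smul_seq, seq_smul, smul_par, par_smul, ← mk_seq, ← mk_par,
        mk_eq (.swap_natural d e)]
      rw [smul_comm]

/-- Transports become composition with identity morphisms, which can then serve as the structure
isomorphisms of a monoidal category. -/
lemma cast_eq {m n m' n' : ℕ} (hm : m = m') (hn : n = n') (x : Cls ax m n) :
    x.cast hm hn = (castId ax hm.symm).seq (x.seq (castId ax hn)) := by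
  subst hm hn
  rw [castId_rfl, castId_rfl, id_seq, seq_id]; rfl

@[simp] lemma castId_castId {l m n : ℕ} (h : l = m) (h' : m = n) :
    (castId ax h).seq (castId ax h') = castId ax (h.trans h') := by
  subst h h'; exact id_seq _

@[simp] lemma castId_par {m n m' n' : ℕ} (h : m = n) (h' : m' = n') :
    (castId ax h).par (castId ax h') = castId ax (congrArg₂ (· + ·) h h') := by
  subst h h'; exact par_id _ _

lemma eq_cast_iff {m n m' n' : ℕ} (hm : m = m') (hn : n = n') (x : Cls ax m n)
    (y : Cls ax m' n') :
    x.cast hm hn = y ↔ x.seq (castId ax hn) = (castId ax hm).seq y := by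
  subst hm hn
  rw [castId_rfl, castId_rfl, id_seq, seq_id]; rfl

end Cls

end QPath

end

/-! ### The symmetric monoidal category of diagrams, and normal forms. -/

noncomputable section

namespace QPath

open Diag CategoryTheory MonoidalCategory

/-! ### The symmetric monoidal category of diagrams -/

/-- Numbers of wires, the objects of the category of diagrams modulo rewriting. -/
structure Wires (ax : Rules) where
  /-- the number of wires -/
  num : ℕ

variable {ax : Rules} [IncludesPath ax]

open Cls

instance : Category (Wires ax) where
  Hom X Y := Cls ax X.num Y.num
  id X := Cls.mk ax (idn X.num)
  comp f g := Cls.seq f g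
  id_comp f := id_seq f
  comp_id f := seq_id f
  assoc f g h := seq_assoc f g h

/-- The isomorphism between equal numbers of wires. -/
def Wires.castIso (X Y : Wires ax) (h : X.num = Y.num) : X ≅ Y where
  hom := castId ax h
  inv := castId ax h.symm
  hom_inv_id := castId_castId h h.symm
  inv_hom_id := castId_castId h.symm h

instance : MonoidalCategoryStruct (Wires ax) where
  tensorObj X Y := ⟨X.num + Y.num⟩
  whiskerLeft X _ _ f := (Cls.mk ax (idn X.num)).par f
  whiskerRight f Y := Cls.par f (Cls.mk ax (idn Y.num))
  tensorHom f g := Cls.par f g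
  tensorUnit := ⟨0⟩
  associator X Y Z := Wires.castIso _ _ (Nat.add_assoc X.num Y.num Z.num)
  leftUnitor X := Wires.castIso _ _ (Nat.zero_add X.num)
  rightUnitor X := Wires.castIso _ _ (Nat.add_zero X.num)

instance : MonoidalCategory (Wires ax) := .ofTensorHom
  (id_tensorHom_id := fun X Y => par_id X.num Y.num)
  (id_tensorHom := fun X _ _ f => rfl)
  (tensorHom_id := fun f Y => rfl)
  (tensorHom_comp_tensorHom := fun f f' g g' => (interchange f g f' g').symm)
  (associator_naturality := fun f g h => (eq_cast_iff _ _ _ _).mp (par_assoc f g h))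
  (leftUnitor_naturality := fun f => (eq_cast_iff _ _ _ _).mp (empty_par f))
  (rightUnitor_naturality := fun f => by
    exact (eq_cast_iff (Nat.add_zero _) (Nat.add_zero _) _ _).mp (par_empty f))
  -- All coherence isomorphisms are transported identities, so both sides are the transported
  -- identity between the same numbers of wires.
  (pentagon := fun W X Y Z => by
    refine (congrArg₂ (fun a b => Cls.seq a (Cls.seq (castId ax _) b)) (castId_par _ rfl)
      (castId_par rfl _)).trans ?_
    simp only [castId_castId]
    exact (castId_castId _ _).symm)
  (triangle := fun X Y => by
    have h := castId_par (ax := ax) (rfl : X.num = X.num) (Nat.zero_add Y.num)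
    have hρ := castId_par (ax := ax) (Nat.add_zero X.num) (rfl : Y.num = Y.num)
    refine (congrArg (Cls.seq (castId ax (Nat.add_assoc X.num 0 Y.num))) h).trans ?_
    exact (castId_castId _ _).trans hρ.symm)

/-- The braiding. -/
def Wires.braid (X Y : Wires ax) : X ⊗ Y ≅ Y ⊗ X where
  hom := Cls.mk ax (swap X.num Y.num)
  inv := Cls.mk ax (swap Y.num X.num)
  hom_inv_id := (mk_seq _ _).symm.trans (mk_eq (.swap_swap _ _))
  inv_hom_id := (mk_seq _ _).symm.trans (mk_eq (.swap_swap _ _))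

/-- This is the axiom `swap_add` with its two transports read as associators. -/
lemma Wires.braid_hexagon (X Y Z : Wires ax) :
    (α_ X Y Z).hom ≫ (Wires.braid X (Y ⊗ Z)).hom ≫ (α_ Y Z X).hom =
      ((Wires.braid X Y).hom ▷ Z) ≫ (α_ Y X Z).hom ≫ (Y ◁ (Wires.braid X Z).hom) := by
  have h := mk_eq (ax := ax) (.swap_add X.num Y.num Z.num)
  rw [mk_seq, mk_cast, mk_cast, Cls.cast_eq, Cls.cast_eq, mk_par, mk_par] at h
  have h' : (Wires.braid X (Y ⊗ Z)).hom =
      (α_ X Y Z).inv ≫ (((Wires.braid X Y).hom ▷ Z) ≫ (α_ Y X Z).hom) ≫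
      𝟙 _ ≫ (Y ◁ (Wires.braid X Z).hom) ≫ (α_ Y Z X).inv := by
    exact h.trans (seq_assoc _ _ _)
  rw [h']
  simp

instance : SymmetricCategory (Wires ax) where
  braiding := Wires.braid
  braiding_naturality_right X _ _ f := swap_natural _ f
  braiding_naturality_left f Z := swap_natural f _
  hexagon_forward := Wires.braid_hexagon
  -- The inverse of a swap is the opposite swap, so inverting the first hexagon gives the second.
  hexagon_reverse X Y Z := by
    have h : α_ Z X Y ≪≫ Wires.braid Z (X ⊗ Y) ≪≫ α_ X Y Z
        = whiskerRightIso (Wires.braid Z X) Y ≪≫ α_ X Z Y ≪≫ whiskerLeftIso X (Wires.braid Z Y) :=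
      Iso.ext (Wires.braid_hexagon Z X Y)
    have h' := congrArg Iso.inv h
    simp only [Iso.trans_inv, Category.assoc, whiskerRightIso_inv, whiskerLeftIso_inv] at h'
    exact h'
  symmetry X Y := (Wires.braid X Y).hom_inv_id

/-! ### The bialgebra on one wire -/

/-- The morphism of a diagram. -/
def arrow (ax : Rules) [IncludesPath ax] {m n : ℕ} (d : Diag m n) :
    (⟨m⟩ : Wires ax) ⟶ ⟨n⟩ := Cls.mk ax d

lemma arrow_eq {m n : ℕ} {d e : Diag m n} (h : PathAxiom d e) : arrow ax d = arrow ax e := mk_eq h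

lemma arrow_seq {l m n : ℕ} (d : Diag l m) (e : Diag m n) :
    arrow ax (d.seq e) = arrow ax d ≫ arrow ax e := mk_seq d e

lemma arrow_par {m n m' n' : ℕ} (d : Diag m n) (e : Diag m' n') :
    arrow ax (d.par e) = arrow ax d ⊗ₘ arrow ax e := mk_par d e

lemma arrow_idn (n : ℕ) : arrow ax (idn n) = 𝟙 _ := rfl

/-- One wire. -/
abbrev wire (ax : Rules) : Wires ax := ⟨1⟩

/-- The multiplication on one wire. -/
def mulW (ax : Rules) [IncludesPath ax] : wire ax ⊗ wire ax ⟶ wire ax := arrow ax merge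
/-- The unit on one wire. -/
def oneW (ax : Rules) [IncludesPath ax] : 𝟙_ (Wires ax) ⟶ wire ax := arrow ax unit
/-- The comultiplication on one wire. -/
def comulW (ax : Rules) [IncludesPath ax] : wire ax ⟶ wire ax ⊗ wire ax := arrow ax copy
/-- The counit on one wire. -/
def counitW (ax : Rules) [IncludesPath ax] : wire ax ⟶ 𝟙_ (Wires ax) := arrow ax .discard

lemma oneW_mulW : oneW ax ▷ wire ax ≫ mulW ax = (λ_ (wire ax)).hom := by
  have h := arrow_eq (ax := ax) .merge_unit
  rw [arrow_seq] at h
  exact (congrArg (· ≫ arrow ax merge) (arrow_par unit (idn 1))).symm.trans h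

lemma mulW_comm : (β_ (wire ax) (wire ax)).hom ≫ mulW ax = mulW ax := by
  have h := arrow_eq (ax := ax) .merge_comm
  rw [arrow_seq] at h
  exact h

lemma mulW_assoc : mulW ax ▷ wire ax ≫ mulW ax
    = (α_ (wire ax) (wire ax) (wire ax)).hom ≫ wire ax ◁ mulW ax ≫ mulW ax := by
  have h := arrow_eq (ax := ax) .merge_assoc
  rw [arrow_seq, arrow_seq] at h
  refine Eq.trans ?_ (h.trans ?_)
  · exact (congrArg (· ≫ arrow ax merge) (arrow_par merge (idn 1))).symm
  · refine (congrArg (· ≫ arrow ax merge) (arrow_par (idn 1) merge)).trans ?_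
    exact (Category.id_comp _).symm

/-- The commutative monoid on one wire. -/
@[reducible] def wireMon (ax : Rules) [IncludesPath ax] : MonObj (wire ax) where
  one := oneW ax
  mul := mulW ax
  one_mul := oneW_mulW
  mul_one := by
    rw [← mulW_comm, BraidedCategory.braiding_naturality_right_assoc, oneW_mulW]
    simp
  mul_assoc := mulW_assoc

/-- The commutative monoid on a bundle of wires. -/
@[reducible] def bundleMon (ax : Rules) [IncludesPath ax] :
    (n : ℕ) → MonObj (⟨n⟩ : Wires ax)
  | 0 => inferInstanceAs (MonObj (𝟙_ (Wires ax)))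
  | n + 1 =>
    letI := bundleMon ax n
    letI := wireMon ax
    inferInstanceAs (MonObj ((⟨n⟩ : Wires ax) ⊗ wire ax))

/-- The multiplication on a bundle of wires. -/
def mulB (ax : Rules) [IncludesPath ax] (n : ℕ) :
    (⟨n⟩ : Wires ax) ⊗ ⟨n⟩ ⟶ ⟨n⟩ := (bundleMon ax n).mul

/-- The unit on a bundle of wires. -/
def oneB (ax : Rules) [IncludesPath ax] (n : ℕ) : 𝟙_ (Wires ax) ⟶ ⟨n⟩ := (bundleMon ax n).one

lemma isCommMonObj_tensor {C : Type*} [Category C] [MonoidalCategory C] [SymmetricCategory C]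
    (X Y : C) [MonObj X] [MonObj Y] [IsCommMonObj X] [IsCommMonObj Y] :
    IsCommMonObj (X ⊗ Y) := inferInstance

lemma bundleMon_comm (n : ℕ) :
    @IsCommMonObj (Wires ax) _ _ _ (⟨n⟩ : Wires ax) (bundleMon ax n) := by
  induction n with
  | zero => exact inferInstanceAs (IsCommMonObj (𝟙_ (Wires ax)))
  | succ n ih =>
    exact @isCommMonObj_tensor _ _ _ _ (⟨n⟩ : Wires ax) (wire ax) (bundleMon ax n) (wireMon ax) ih
      (@IsCommMonObj.mk _ _ _ _ _ (wireMon ax) mulW_comm)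

lemma mulB_comm (n : ℕ) : (β_ (⟨n⟩ : Wires ax) ⟨n⟩).hom ≫ mulB ax n = mulB ax n :=
  (bundleMon_comm n).mul_comm

lemma mulB_assoc (n : ℕ) : mulB ax n ▷ ⟨n⟩ ≫ mulB ax n
    = (α_ (⟨n⟩ : Wires ax) ⟨n⟩ ⟨n⟩).hom ≫ ⟨n⟩ ◁ mulB ax n ≫ mulB ax n :=
  (bundleMon ax n).mul_assoc

lemma oneB_mulB (n : ℕ) : oneB ax n ▷ ⟨n⟩ ≫ mulB ax n = (λ_ (⟨n⟩ : Wires ax)).hom :=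
  (bundleMon ax n).one_mul

lemma mulB_oneB (n : ℕ) : (⟨n⟩ : Wires ax) ◁ oneB ax n ≫ mulB ax n = (ρ_ (⟨n⟩ : Wires ax)).hom :=
  (bundleMon ax n).mul_one

lemma mulB_succ (n : ℕ) : mulB ax (n + 1)
    = tensorμ (⟨n⟩ : Wires ax) (wire ax) ⟨n⟩ (wire ax) ≫ (mulB ax n ⊗ₘ mulW ax) := rfl

lemma oneB_succ (n : ℕ) : oneB ax (n + 1)
    = (λ_ (𝟙_ (Wires ax))).inv ≫ (oneB ax n ⊗ₘ oneW ax) := rfl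

/-- The wire permutation inside `mergeBundle` is the canonical exchange of the two middle factors,
which makes `mergeBundle` the multiplication of a tensor product of monoids. -/
lemma arrow_shuffle (n : ℕ) (h h') :
    arrow ax (Diag.cast (m' := (n + 1) + (n + 1)) (n' := (n + n) + (1 + 1)) h h'
        (((idn n).par (swap 1 n)).par (idn 1)))
      = tensorμ (⟨n⟩ : Wires ax) (wire ax) ⟨n⟩ (wire ax) := by
  have h1 : arrow ax (Diag.cast (m' := (n + 1) + (n + 1)) (n' := (n + n) + (1 + 1)) h h'
        (((idn n).par (swap 1 n)).par (idn 1)))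
      = (Wires.castIso ⟨(n + 1) + (n + 1)⟩ ⟨n + (1 + n) + 1⟩ h.symm).hom ≫
        (((⟨n⟩ : Wires ax) ◁ (β_ (wire ax) ⟨n⟩).hom) ▷ wire ax) ≫
        (Wires.castIso ⟨n + (n + 1) + 1⟩ ⟨(n + n) + (1 + 1)⟩ h').hom := by
    unfold arrow
    rw [mk_cast, Cls.cast_eq, mk_par, mk_par]
    rfl
  have h2 : (Wires.castIso (ax := ax) ⟨(n + 1) + (n + 1)⟩ ⟨n + (1 + n) + 1⟩ h.symm).hom
      ≫ (α_ (⟨n⟩ : Wires ax) (wire ax ⊗ ⟨n⟩) (wire ax)).hom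
      = (α_ (⟨n⟩ : Wires ax) (wire ax) (⟨n⟩ ⊗ wire ax)).hom ≫
        (⟨n⟩ ◁ (α_ (wire ax) (⟨n⟩ : Wires ax) (wire ax)).inv) := by
    have e := castId_par (ax := ax) (rfl : n = n) (Nat.add_assoc 1 n 1).symm
    refine (castId_castId h.symm (Nat.add_assoc n (1 + n) 1)).trans ?_
    refine Eq.trans ?_ (congrArg (Cls.seq (castId ax (Nat.add_assoc n 1 (n + 1)))) e).symm
    exact (castId_castId _ _).symm
  have h3 : (α_ (⟨n⟩ : Wires ax) (⟨n⟩ ⊗ wire ax) (wire ax)).inv ≫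
      (Wires.castIso (ax := ax) ⟨n + (n + 1) + 1⟩ ⟨(n + n) + (1 + 1)⟩ h').hom
      = (⟨n⟩ ◁ (α_ (⟨n⟩ : Wires ax) (wire ax) (wire ax)).hom) ≫
        (α_ (⟨n⟩ : Wires ax) ⟨n⟩ (wire ax ⊗ wire ax)).inv := by
    have e := castId_par (ax := ax) (rfl : n = n) (Nat.add_assoc n 1 1)
    refine (castId_castId (Nat.add_assoc n (n + 1) 1).symm h').trans ?_
    refine Eq.trans ?_
      (congrArg (fun x => Cls.seq x (castId ax (Nat.add_assoc n n (1 + 1)).symm)) e).symm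
    exact (castId_castId _ _).symm
  rw [h1, whisker_assoc, tensorμ]
  simp only [Category.assoc]
  rw [reassoc_of% h2, h3]

lemma mulB_eq (n : ℕ) : mulB ax n = arrow ax (mergeBundle n) := by
  induction n with
  | zero => rfl
  | succ n ih =>
    rw [mulB_succ, ih, mergeBundle, arrow_seq, arrow_shuffle, arrow_par]
    rfl

lemma oneB_eq (n : ℕ) : oneB ax n = arrow ax (units n) := by
  induction n with
  | zero => rfl
  | succ n ih =>
    rw [oneB_succ, ih, units, arrow_par]
    exact Category.id_comp _

/-! ### Matrices of wires -/

lemma mulB_tensor {n : ℕ} {X X' Y Y' : Wires ax} (f : X ⟶ ⟨n⟩) (g : Y ⟶ wire ax)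
    (f' : X' ⟶ ⟨n⟩) (g' : Y' ⟶ wire ax) :
    ((f ⊗ₘ g) ⊗ₘ (f' ⊗ₘ g')) ≫ mulB ax (n + 1)
      = tensorμ X Y X' Y' ≫ (((f ⊗ₘ f') ≫ mulB ax n) ⊗ₘ ((g ⊗ₘ g') ≫ mulW ax)) := by
  rw [mulB_succ]
  refine (tensorμ_natural_assoc f g f' g' _).trans ?_
  rw [tensorHom_comp_tensorHom]

/-- The endomorphism `r` on one wire. -/
def scale (ax : Rules) [IncludesPath ax] (r : ℂ) : wire ax ⟶ wire ax := arrow ax (endo r)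

/-- A wire copied to `q` weighted wires. -/
def row (ax : Rules) [IncludesPath ax] (q : ℕ) (r : Fin q → ℂ) : wire ax ⟶ ⟨q⟩ :=
  arrow ax ((copyN q).seq (parN q fun j => endo (r j)))

lemma row_zero (r : Fin 0 → ℂ) : row ax 0 r = counitW ax := by
  rw [row, arrow_seq]
  exact Category.comp_id _

lemma row_succ (q : ℕ) (r : Fin (q + 1) → ℂ) :
    row ax (q + 1) r
      = comulW ax ≫ (row ax q (fun j => r j.castSucc) ⊗ₘ scale ax (r (Fin.last q))) := by
  rw [row, row, arrow_seq, arrow_seq, ← Category.id_comp (scale ax _), ← tensorHom_comp_tensorHom,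
    ← arrow_idn]
  have h1 : arrow ax (copyN (q + 1)) = comulW ax ≫ (arrow ax (copyN q) ⊗ₘ arrow ax (idn 1)) := by
    rw [copyN, arrow_seq, arrow_par]; rfl
  have h2 : arrow ax (parN (q + 1) fun j => endo (r j))
      = arrow ax (parN q fun j => endo (r j.castSucc)) ⊗ₘ scale ax (r (Fin.last q)) := by
    rw [parN, arrow_par]; rfl
  rw [h1, h2]
  exact Category.assoc _ _ _

lemma counitW_comul : comulW ax ≫ (counitW ax ▷ wire ax) = (λ_ (wire ax)).inv := by
  have h := arrow_eq (ax := ax) .copy_discard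
  rw [arrow_seq, arrow_par] at h
  exact h

lemma comulW_comm : comulW ax ≫ (β_ (wire ax) (wire ax)).hom = comulW ax := by
  have h := arrow_eq (ax := ax) .copy_comm
  rw [arrow_seq] at h
  exact h

lemma comulW_assoc : comulW ax ≫ (comulW ax ▷ wire ax) ≫ (α_ _ _ _).hom
    = comulW ax ≫ (wire ax ◁ comulW ax) := by
  have h := arrow_eq (ax := ax) .copy_assoc
  rw [arrow_seq, arrow_seq, arrow_par, arrow_par] at h
  refine Eq.trans ?_ h
  exact congrArg (comulW ax ≫ ·) (Category.comp_id (comulW ax ▷ wire ax))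

lemma counit_comulW : comulW ax ≫ (wire ax ◁ counitW ax) = (ρ_ (wire ax)).inv := by
  rw [← comulW_comm, Category.assoc, ← BraidedCategory.braiding_naturality_left,
    reassoc_of% (counitW_comul (ax := ax))]
  simp

/-- By coassociativity the two middle copies among four come from one copy, so exchanging them is
cocommutativity. -/
lemma comulW_shuffle : comulW ax ≫ (comulW ax ⊗ₘ comulW ax) ≫ tensorμ _ _ _ _
    = comulW ax ≫ (comulW ax ⊗ₘ comulW ax) := by
  have h : comulW ax ≫ (comulW ax ⊗ₘ comulW ax) ≫ (α_ _ _ _).hom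
      = comulW ax ≫ wire ax ◁ (comulW ax ≫ wire ax ◁ comulW ax) := by
    rw [MonoidalCategory.tensorHom_def, Category.assoc, associator_naturality_right,
      reassoc_of% (comulW_assoc (ax := ax)), MonoidalCategory.whiskerLeft_comp]
  have h' : comulW ax ≫ wire ax ◁ comulW ax ≫ (α_ _ _ _).inv
      = comulW ax ≫ comulW ax ▷ wire ax := by
    rw [← reassoc_of% (comulW_assoc (ax := ax)), Iso.hom_inv_id, Category.comp_id]
  rw [tensorμ, reassoc_of% h]
  simp only [← MonoidalCategory.whiskerLeft_comp_assoc, Category.assoc]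
  rw [reassoc_of% h', ← comp_whiskerRight_assoc, comulW_comm, comulW_assoc, ← reassoc_of% h]
  simp

lemma mulW_comulW : mulW ax ≫ comulW ax
    = (comulW ax ⊗ₘ comulW ax) ≫ tensorμ _ _ _ _ ≫ (mulW ax ⊗ₘ mulW ax) := by
  have h := arrow_eq (ax := ax) .merge_copy
  rw [arrow_seq, arrow_seq, arrow_par, arrow_seq, arrow_par merge] at h
  refine h.trans ?_
  exact congrArg (fun x => (comulW ax ⊗ₘ comulW ax) ≫ x ≫ (mulW ax ⊗ₘ mulW ax))
    (arrow_shuffle 1 rfl rfl)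

lemma oneW_comulW : oneW ax ≫ comulW ax = (λ_ (𝟙_ (Wires ax))).inv ≫ (oneW ax ⊗ₘ oneW ax) := by
  have h := arrow_eq (ax := ax) .unit_copy
  rw [arrow_seq, arrow_par] at h
  exact h.trans (Category.id_comp _).symm

lemma mulW_counitW : mulW ax ≫ counitW ax = (counitW ax ⊗ₘ counitW ax) ≫ (λ_ _).hom := by
  have h := arrow_eq (ax := ax) .merge_discard
  rw [arrow_seq, arrow_par] at h
  exact h.trans (Category.comp_id _).symm

lemma oneW_counitW : oneW ax ≫ counitW ax = 𝟙 _ := by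
  have h := arrow_eq (ax := ax) .unit_discard
  rw [arrow_seq] at h
  exact h

lemma mulW_scale (r : ℂ) : mulW ax ≫ scale ax r = (scale ax r ⊗ₘ scale ax r) ≫ mulW ax := by
  have h := arrow_eq (ax := ax) (.merge_endo r)
  rw [arrow_seq, arrow_seq, arrow_par] at h
  exact h

lemma oneW_scale (r : ℂ) : oneW ax ≫ scale ax r = oneW ax := by
  have h := arrow_eq (ax := ax) (.unit_endo r)
  rw [arrow_seq] at h
  exact h

lemma scale_comulW (r : ℂ) :
    scale ax r ≫ comulW ax = comulW ax ≫ (scale ax r ⊗ₘ scale ax r) := by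
  have h := arrow_eq (ax := ax) (.endo_copy r)
  rw [arrow_seq, arrow_seq, arrow_par] at h
  exact h

lemma scale_counitW (r : ℂ) : scale ax r ≫ counitW ax = counitW ax := by
  have h := arrow_eq (ax := ax) (.endo_discard r)
  rw [arrow_seq] at h
  exact h

lemma scale_scale (r s : ℂ) : scale ax r ≫ scale ax s = scale ax (r * s) := by
  have h := arrow_eq (ax := ax) (.endo_mul r s)
  rw [arrow_seq] at h
  exact h

lemma scale_zero : scale ax 0 = counitW ax ≫ oneW ax := by
  have h := arrow_eq (ax := ax) .endo_zero
  rw [arrow_seq] at h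
  exact h

lemma scale_one : scale ax 1 = 𝟙 _ := arrow_eq (ax := ax) .endo_one

lemma scale_add (r s : ℂ) :
    comulW ax ≫ (scale ax r ⊗ₘ scale ax s) ≫ mulW ax = scale ax (r + s) := by
  have h := arrow_eq (ax := ax) (.endo_add r s)
  rw [arrow_seq, arrow_seq, arrow_par] at h
  exact h

/-- With `oneW_row`, this says that a row is a monoid homomorphism: its constituents `comulW` and
`scale` are, by the bialgebra laws. -/
lemma mulW_row (q : ℕ) (r : Fin q → ℂ) :
    mulW ax ≫ row ax q r = (row ax q r ⊗ₘ row ax q r) ≫ mulB ax q := by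
  induction q with
  | zero => rw [row_zero]; exact mulW_counitW
  | succ q ih =>
    rw [row_succ, ← tensorHom_comp_tensorHom, Category.assoc, mulB_tensor, ← ih, ← mulW_scale,
      reassoc_of% (mulW_comulW (ax := ax)), tensorHom_comp_tensorHom]

lemma oneW_row (q : ℕ) (r : Fin q → ℂ) : oneW ax ≫ row ax q r = oneB ax q := by
  induction q with
  | zero => rw [row_zero]; exact oneW_counitW
  | succ q ih =>
    rw [row_succ, reassoc_of% (oneW_comulW (ax := ax)), tensorHom_comp_tensorHom, ih, oneW_scale,
      oneB_succ]

lemma counitW_oneB (q : ℕ) : counitW ax ≫ oneB ax q = row ax q 0 := by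
  induction q with
  | zero => rw [row_zero]; exact Category.comp_id _
  | succ q ih =>
    have h : (fun j : Fin q => (0 : Fin (q + 1) → ℂ) j.castSucc) = 0 := rfl
    rw [row_succ, h, ← ih, Pi.zero_apply, scale_zero, ← tensorHom_comp_tensorHom, oneB_succ,
      MonoidalCategory.tensorHom_def (counitW ax), Category.assoc,
      reassoc_of% (counitW_comul (ax := ax)), ← leftUnitor_inv_naturality_assoc]

lemma scale_row (q : ℕ) (s : ℂ) (r : Fin q → ℂ) :
    scale ax s ≫ row ax q r = row ax q fun j => s * r j := by
  induction q with
  | zero => rw [row_zero, row_zero, scale_counitW]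
  | succ q ih =>
    rw [row_succ, row_succ, reassoc_of% (scale_comulW (ax := ax)), tensorHom_comp_tensorHom, ih,
      scale_scale]

/-- Wires of weights r_j and s_j to the same output fuse by `scale_add`; `comulW_shuffle` first
brings the two copies for each output together. -/
lemma row_add (q : ℕ) (r s : Fin q → ℂ) :
    comulW ax ≫ (row ax q r ⊗ₘ row ax q s) ≫ mulB ax q = row ax q (r + s) := by
  induction q with
  | zero =>
    rw [row_zero, row_zero, row_zero, MonoidalCategory.tensorHom_def, Category.assoc,
      reassoc_of% (counitW_comul (ax := ax))]
    refine ((leftUnitor_inv_naturality_assoc (counitW ax) (λ_ (𝟙_ (Wires ax))).hom).symm).trans ?_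
    rw [Iso.inv_hom_id, Category.comp_id]
  | succ q ih =>
    have h : (fun j : Fin q => (r + s) j.castSucc)
      = (fun j => r j.castSucc) + fun j => s j.castSucc := rfl
    rw [row_succ, row_succ, row_succ, ← tensorHom_comp_tensorHom, Category.assoc, mulB_tensor,
      reassoc_of% (comulW_shuffle (ax := ax)), tensorHom_comp_tensorHom, h, ← ih, Pi.add_apply,
      ← scale_add]

/-- The bundle of wires with a given matrix of weights. -/
def wiresM (ax : Rules) [IncludesPath ax] (p q : ℕ) (M : Fin p → Fin q → ℂ) :
    (⟨p⟩ : Wires ax) ⟶ ⟨q⟩ := arrow ax (wires p q fun i j => endo (M i j))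

lemma wiresM_zero (q : ℕ) (M : Fin 0 → Fin q → ℂ) : wiresM ax 0 q M = oneB ax q :=
  (oneB_eq q).symm

lemma wiresM_succ (p q : ℕ) (M : Fin (p + 1) → Fin q → ℂ) :
    wiresM ax (p + 1) q M
      = (wiresM ax p q (fun i => M i.castSucc) ⊗ₘ row ax q (M (Fin.last p))) ≫ mulB ax q := by
  rw [wiresM, wires, arrow_seq, arrow_par, mulB_eq]
  rfl

lemma wiresM_one (q : ℕ) (M : Fin 1 → Fin q → ℂ) : wiresM ax 1 q M = row ax q (M 0) := by
  have h := wiresM_succ (ax := ax) 0 q M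
  rw [wiresM_zero, MonoidalCategory.tensorHom_def, ← whisker_exchange, Category.assoc,
    oneB_mulB] at h
  exact h.trans ((leftUnitor_naturality _).trans (Category.id_comp _))

lemma mulB_assoc_tensorHom {q : ℕ} {X Y Z : Wires ax} (f : X ⟶ ⟨q⟩) (g : Y ⟶ ⟨q⟩)
    (h : Z ⟶ ⟨q⟩) :
    (((f ⊗ₘ g) ≫ mulB ax q) ⊗ₘ h) ≫ mulB ax q
      = (α_ X Y Z).hom ≫ (f ⊗ₘ ((g ⊗ₘ h) ≫ mulB ax q)) ≫ mulB ax q := by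
  rw [← Category.comp_id h, ← tensorHom_comp_tensorHom, tensorHom_id, Category.assoc, mulB_assoc,
    associator_naturality_assoc, Category.comp_id, ← Category.comp_id f,
    ← tensorHom_comp_tensorHom, id_tensorHom, Category.comp_id, Category.assoc]

/-- Associativity of the bundle multiplication allows the rows to be grouped into two blocks, so
inputs in parallel can be treated separately. -/
lemma wiresM_add (n n' q : ℕ) (M : Fin (n + n') → Fin q → ℂ) :
    wiresM ax (n + n') q M
      = (wiresM ax n q (fun i => M (Fin.castAdd n' i)) ⊗ₘ
          wiresM ax n' q (fun i => M (Fin.natAdd n i))) ≫ mulB ax q := by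
  induction n' with
  | zero =>
    rw [wiresM_zero, MonoidalCategory.tensorHom_def, Category.assoc, mulB_oneB]
    exact ((rightUnitor_naturality (wiresM ax n q M)).trans (Category.id_comp _)).symm
  | succ n' ih =>
    refine (wiresM_succ (n + n') q M).trans ?_
    rw [ih, wiresM_succ, mulB_assoc_tensorHom]
    exact Category.id_comp _

/-- The morphisms that turn matrices of wires into matrices of wires. -/
def Absorbs {X Y : Wires ax} (f : X ⟶ Y) : Prop :=
  ∀ q M, ∃ N, f ≫ wiresM ax Y.num q M = wiresM ax X.num q N

/-! ### Morphisms that absorb matrices of wires -/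

lemma wiresM_append {n n' q : ℕ} (M : Fin n → Fin q → ℂ) (M' : Fin n' → Fin q → ℂ) :
    (wiresM ax n q M ⊗ₘ wiresM ax n' q M') ≫ mulB ax q
      = wiresM ax (n + n') q (Fin.append M M') := by
  rw [wiresM_add]
  simp only [Fin.append_left, Fin.append_right]

namespace Absorbs

lemma id (X : Wires ax) : Absorbs (𝟙 X) := fun _ M => ⟨M, Category.id_comp _⟩

lemma comp {X Y Z : Wires ax} {f : X ⟶ Y} {g : Y ⟶ Z} (hf : Absorbs f) (hg : Absorbs g) :
    Absorbs (f ≫ g) := fun q M => by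
  obtain ⟨M', hM'⟩ := hg q M
  obtain ⟨M'', hM''⟩ := hf q M'
  exact ⟨M'', by rw [Category.assoc, hM', hM'']⟩

lemma tensor {X Y X' Y' : Wires ax} {f : X ⟶ Y} {g : X' ⟶ Y'} (hf : Absorbs f)
    (hg : Absorbs g) : Absorbs (f ⊗ₘ g) := fun q M => by
  obtain ⟨M₁, h₁⟩ := hf q fun i => M (Fin.castAdd Y'.num i)
  obtain ⟨M₂, h₂⟩ := hg q fun i => M (Fin.natAdd Y.num i)
  refine ⟨Fin.append M₁ M₂, ?_⟩
  refine (congrArg ((f ⊗ₘ g) ≫ ·) (wiresM_add Y.num Y'.num q M)).trans ?_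
  refine (tensorHom_comp_tensorHom_assoc _ _ _ _ _).trans ?_
  rw [h₁, h₂]
  exact wiresM_append M₁ M₂

lemma whiskerLeft (X : Wires ax) {Y Z : Wires ax} {f : Y ⟶ Z} (hf : Absorbs f) :
    Absorbs (X ◁ f) := by
  rw [← id_tensorHom]; exact (id X).tensor hf

lemma whiskerRight (X : Wires ax) {Y Z : Wires ax} {f : Y ⟶ Z} (hf : Absorbs f) :
    Absorbs (f ▷ X) := by
  rw [← tensorHom_id]; exact hf.tensor (id X)

lemma castIso (X Y : Wires ax) (h : X.num = Y.num) : Absorbs (Wires.castIso X Y h).hom := by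
  obtain ⟨m⟩ := X
  obtain ⟨n⟩ := Y
  obtain rfl : m = n := h
  exact id _

lemma associator (X Y Z : Wires ax) : Absorbs (α_ X Y Z).hom := castIso _ _ _
lemma associator_inv (X Y Z : Wires ax) : Absorbs (α_ X Y Z).inv :=
  castIso _ _ (Nat.add_assoc _ _ _).symm
lemma leftUnitor (X : Wires ax) : Absorbs (λ_ X).hom := castIso _ _ _
lemma leftUnitor_inv (X : Wires ax) : Absorbs (λ_ X).inv := castIso _ _ (Nat.zero_add _).symm
lemma rightUnitor (X : Wires ax) : Absorbs (ρ_ X).hom := castIso _ _ _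
lemma rightUnitor_inv (X : Wires ax) : Absorbs (ρ_ X).inv := castIso _ _ (Nat.add_zero _).symm

/-- Commutativity of the bundle multiplication lets the two blocks of rows change places. -/
lemma braiding (X Y : Wires ax) : Absorbs (β_ X Y).hom := fun q M => by
  refine ⟨Fin.append (fun i => M (Fin.natAdd Y.num i)) fun i => M (Fin.castAdd X.num i), ?_⟩
  refine (congrArg ((β_ X Y).hom ≫ ·) (wiresM_add Y.num X.num q M)).trans ?_
  refine (BraidedCategory.braiding_naturality_assoc _ _ _).symm.trans ?_
  rw [mulB_comm]
  exact wiresM_append _ _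

lemma scale (r : ℂ) : Absorbs (scale ax r) := fun q M =>
  ⟨fun _ j => r * M 0 j, by rw [wiresM_one, scale_row, wiresM_one]⟩

lemma mulW : Absorbs (mulW ax) := fun q M => by
  rw [wiresM_one, mulW_row, ← wiresM_one]
  exact ⟨_, wiresM_append M M⟩

lemma oneW : Absorbs (oneW ax) := fun q M => by
  rw [wiresM_one, oneW_row]
  exact ⟨Fin.elim0, (wiresM_zero q _).symm⟩

lemma comulW : Absorbs (comulW ax) := fun q M => by
  refine ⟨fun _ => M (Fin.castAdd 1 0) + M (Fin.natAdd 1 0),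
    (congrArg (QPath.comulW ax ≫ ·) (wiresM_add 1 1 q M)).trans ?_⟩
  rw [wiresM_one, wiresM_one, row_add, wiresM_one]

lemma counitW : Absorbs (counitW ax) := fun q M => by
  refine ⟨fun _ => 0, (congrArg (QPath.counitW ax ≫ ·) (wiresM_zero q M)).trans ?_⟩
  rw [counitW_oneB, wiresM_one]

lemma mergeN (n : ℕ) : Absorbs (arrow ax (mergeN n)) := by
  induction n with
  | zero => exact oneW
  | succ n ih =>
    rw [Diag.mergeN, arrow_seq, arrow_par]
    exact (ih.tensor (id _)).comp mulW

lemma copyN (n : ℕ) : Absorbs (arrow ax (copyN n)) := by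
  induction n with
  | zero => exact counitW
  | succ n ih =>
    rw [Diag.copyN, arrow_seq, arrow_par]
    exact comulW.comp (ih.tensor (id _))

end Absorbs

/-! ### The identity as a matrix of wires -/

section Coherence

variable {C : Type*} [Category C] [MonoidalCategory C] [BraidedCategory C]

lemma rightUnitor_inv_tensorμ (X Y : C) :
    ((ρ_ X).inv ⊗ₘ (ρ_ Y).inv) ≫ tensorμ X (𝟙_ C) Y (𝟙_ C)
      = (ρ_ (X ⊗ Y)).inv ≫ (X ⊗ Y) ◁ (λ_ (𝟙_ C)).inv := by
  simp only [tensorμ, braiding_tensorUnit_left]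
  monoidal

lemma unitor_inv_tensorμ (X Y : C) :
    ((ρ_ X).inv ⊗ₘ (λ_ Y).inv) ≫ tensorμ X (𝟙_ C) (𝟙_ C) Y
      = ((ρ_ X).inv ⊗ₘ (λ_ Y).inv) := by
  simp only [tensorμ, braiding_tensorUnit_left]
  monoidal

end Coherence

lemma oneW_mulW_oneW :
    (oneW ax ⊗ₘ oneW ax) ≫ mulW ax = (λ_ (𝟙_ (Wires ax))).hom ≫ oneW ax := by
  rw [tensorHom_def', Category.assoc, oneW_mulW, leftUnitor_naturality]

lemma row_snoc_zero {q : ℕ} (r : Fin q → ℂ) :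
    row ax (q + 1) (Fin.snoc r 0 : Fin (q + 1) → ℂ)
      = (ρ_ (wire ax)).inv ≫ (row ax q r ⊗ₘ oneW ax) := by
  rw [row_succ]
  simp only [Fin.snoc_castSucc, Fin.snoc_last]
  rw [scale_zero, ← Category.id_comp (row ax q r), ← tensorHom_comp_tensorHom, id_tensorHom,
    reassoc_of% (counit_comulW (ax := ax)), Category.id_comp]

lemma row_snoc_one (q : ℕ) :
    row ax (q + 1) (Fin.snoc (0 : Fin q → ℂ) 1 : Fin (q + 1) → ℂ)
      = (λ_ (wire ax)).inv ≫ (oneB ax q ⊗ₘ 𝟙 (wire ax)) := by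
  rw [row_succ]
  simp only [Fin.snoc_castSucc, Fin.snoc_last]
  have h : row ax q (fun j => (0 : Fin q → ℂ) j) = counitW ax ≫ oneB ax q := (counitW_oneB q).symm
  rw [h, scale_one, tensorHom_id, tensorHom_id, comp_whiskerRight,
    reassoc_of% (counitW_comul (ax := ax))]

lemma wiresM_snoc_zero {p q : ℕ} (M : Fin p → Fin q → ℂ) :
    wiresM ax p (q + 1) (fun i => Fin.snoc (M i) 0)
      = (ρ_ (⟨p⟩ : Wires ax)).inv ≫ (wiresM ax p q M ⊗ₘ oneW ax) := by
  induction p with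
  | zero =>
    rw [wiresM_zero, wiresM_zero, oneB_succ]
    rfl
  | succ p ih =>
    rw [wiresM_succ, ih fun i => M i.castSucc, row_snoc_zero, ← tensorHom_comp_tensorHom,
      Category.assoc, mulB_tensor, oneW_mulW_oneW,
      reassoc_of% (rightUnitor_inv_tensorμ (⟨p⟩ : Wires ax) (wire ax)), wiresM_succ,
      ← id_tensorHom, tensorHom_comp_tensorHom, Category.id_comp,
      Iso.inv_hom_id_assoc]
    rfl

/-- The matrix is the direct sum of M and the 1 × 1 identity; this is the induction step for writing
the identity as a matrix of wires. -/
lemma wiresM_tensor_id {p q : ℕ} (M : Fin p → Fin q → ℂ) :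
    wiresM ax (p + 1) (q + 1) (Fin.snoc (fun i => Fin.snoc (M i) 0) (Fin.snoc 0 1))
      = wiresM ax p q M ⊗ₘ 𝟙 (wire ax) := by
  rw [wiresM_succ]
  simp only [Fin.snoc_castSucc, Fin.snoc_last]
  rw [wiresM_snoc_zero, row_snoc_one, ← tensorHom_comp_tensorHom, Category.assoc, mulB_tensor,
    reassoc_of% (unitor_inv_tensorμ (⟨p⟩ : Wires ax) (wire ax)), tensorHom_comp_tensorHom,
    tensorHom_id, oneW_mulW, Iso.inv_hom_id, tensorHom_id, MonoidalCategory.tensorHom_def,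
    Category.assoc, mulB_oneB, rightUnitor_naturality, Iso.inv_hom_id_assoc, tensorHom_id]

lemma exists_wiresM_eq_id (k : ℕ) : ∃ M, wiresM ax k k M = 𝟙 (⟨k⟩ : Wires ax) := by
  induction k with
  | zero => exact ⟨Fin.elim0, wiresM_zero 0 _⟩
  | succ k ih =>
    obtain ⟨M, hM⟩ := ih
    refine ⟨_, (wiresM_tensor_id M).trans ?_⟩
    rw [hM, id_tensorHom_id]
    rfl

/-- It suffices to absorb f into the identity, itself a matrix of wires. -/
lemma Absorbs.exists_eq {X Y : Wires ax} {f : X ⟶ Y} (hf : Absorbs f) :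
    ∃ M, f = wiresM ax X.num Y.num M := by
  obtain ⟨I, hI⟩ := exists_wiresM_eq_id (ax := ax) Y.num
  obtain ⟨M, hM⟩ := hf _ I
  refine ⟨M, hM ▸ ?_⟩
  exact ((congrArg (f ≫ ·) hI).trans (Category.comp_id f)).symm

/-! ### Existence of normal forms -/

instance (X Y : Wires ax) : SMul ℂ (X ⟶ Y) := inferInstanceAs (SMul ℂ (Cls ax X.num Y.num))

lemma Wires.comp_smul {X Y Z : Wires ax} (c : ℂ) (f : X ⟶ Y) (g : Y ⟶ Z) :
    f ≫ (c • g) = c • (f ≫ g) := seq_smul c f g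

lemma Wires.smul_comp {X Y Z : Wires ax} (c : ℂ) (f : X ⟶ Y) (g : Y ⟶ Z) :
    (c • f) ≫ g = c • (f ≫ g) := smul_seq c f g

lemma Wires.whiskerLeft_smul (X : Wires ax) {Y Z : Wires ax} (c : ℂ) (f : Y ⟶ Z) :
    X ◁ (c • f) = c • (X ◁ f) := par_smul c _ f

lemma Wires.smul_smul {X Y : Wires ax} (c c' : ℂ) (f : X ⟶ Y) : c • c' • f = (c * c') • f :=
  @_root_.smul_smul ℂ (Cls ax X.num Y.num) _ _ c c' f

lemma Wires.one_smul {X Y : Wires ax} (f : X ⟶ Y) : (1 : ℂ) • f = f :=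
  @_root_.one_smul ℂ (Cls ax X.num Y.num) _ _ f

/-- The preparation of one photon. -/
def prep (ax : Rules) [IncludesPath ax] : 𝟙_ (Wires ax) ⟶ wire ax := arrow ax (create 1)

/-- The annihilation of one photon. -/
def annih (ax : Rules) [IncludesPath ax] : wire ax ⟶ 𝟙_ (Wires ax) := arrow ax (annihilate 1)

/-- The preparation of one photon on each of `n` wires. -/
def preps (ax : Rules) [IncludesPath ax] (n : ℕ) : 𝟙_ (Wires ax) ⟶ ⟨n⟩ := arrow ax (creates n)

/-- The annihilation of one photon on each of `n` wires. -/
def annihs (ax : Rules) [IncludesPath ax] (n : ℕ) : (⟨n⟩ : Wires ax) ⟶ 𝟙_ (Wires ax) :=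
  arrow ax (annihilates n)

lemma preps_succ (n : ℕ) :
    preps ax (n + 1) = (λ_ (𝟙_ (Wires ax))).inv ≫ (preps ax n ⊗ₘ prep ax) :=
  (arrow_par (creates n) (create 1)).trans (Category.id_comp _).symm

lemma annihs_succ (n : ℕ) :
    annihs ax (n + 1) = (annihs ax n ⊗ₘ annih ax) ≫ (λ_ (𝟙_ (Wires ax))).hom :=
  (arrow_par (annihilates n) (annihilate 1)).trans (Category.comp_id _).symm

lemma preps_succ_braiding (n : ℕ) : preps ax (n + 1) ≫ (β_ (⟨n⟩ : Wires ax) (wire ax)).hom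
    = (λ_ (𝟙_ (Wires ax))).inv ≫ (prep ax ⊗ₘ preps ax n) := by
  rw [preps_succ, Category.assoc, BraidedCategory.braiding_naturality, braiding_tensorUnit_left]
  simp [unitors_equal]

/-- The effects that prepare auxiliary photons, apply a morphism that absorbs matrices, and
annihilate one photon on every remaining wire. -/
def NormalEffect {X : Wires ax} (x : X ⟶ 𝟙_ (Wires ax)) : Prop :=
  ∃ (a k : ℕ) (e : X ⊗ (⟨a⟩ : Wires ax) ⟶ ⟨k⟩), Absorbs e ∧
    x = (ρ_ X).inv ≫ X ◁ preps ax a ≫ e ≫ annihs ax k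

lemma NormalEffect.comp {X Y : Wires ax} {f : X ⟶ Y} (hf : Absorbs f)
    {x : Y ⟶ 𝟙_ (Wires ax)} (hx : NormalEffect x) : NormalEffect (f ≫ x) := by
  obtain ⟨a, k, e, he, rfl⟩ := hx
  refine ⟨a, k, f ▷ ⟨a⟩ ≫ e, (hf.whiskerRight _).comp he, ?_⟩
  rw [Category.assoc, whisker_exchange_assoc, ← rightUnitor_inv_naturality_assoc]

/-- The new photon becomes one more auxiliary photon; a braiding brings it to the wire that it
feeds. -/
lemma NormalEffect.prep {S : Wires ax} {x : S ⊗ wire ax ⟶ 𝟙_ (Wires ax)} (hx : NormalEffect x) :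
    NormalEffect (S ◁ prep ax ≫ x) := by
  obtain ⟨a, k, e, he, rfl⟩ := hx
  refine ⟨a + 1, k, (ρ_ S).hom ▷ ⟨a + 1⟩ ≫ S ◁ (β_ (⟨a⟩ : Wires ax) (wire ax)).hom ≫
    (α_ S (wire ax) ⟨a⟩).inv ≫ e, ?_, ?_⟩
  · exact ((Absorbs.rightUnitor S).whiskerRight _).comp (((Absorbs.braiding _ _).whiskerLeft S).comp
      ((Absorbs.associator_inv _ _ _).comp he))
  · have h : (ρ_ (S ⊗ 𝟙_ (Wires ax))).inv ≫ (S ⊗ 𝟙_ (Wires ax)) ◁ preps ax (a + 1) ≫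
        (ρ_ S).hom ▷ ⟨a + 1⟩ ≫ S ◁ (β_ (⟨a⟩ : Wires ax) (wire ax)).hom ≫ (α_ S (wire ax) ⟨a⟩).inv
        = S ◁ QPath.prep ax ≫ (ρ_ (S ⊗ wire ax)).inv ≫ (S ⊗ wire ax) ◁ preps ax a := by
      rw [whisker_exchange_assoc]
      refine (congrArg (fun z => (ρ_ (S ⊗ 𝟙_ (Wires ax))).inv ≫ (ρ_ S).hom ▷ _ ≫ z)
        (whiskerLeft_comp_assoc S (preps ax (a + 1))
        (β_ (⟨a⟩ : Wires ax) (wire ax)).hom (α_ S (wire ax) ⟨a⟩).inv).symm).trans ?_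
      rw [preps_succ_braiding, MonoidalCategory.tensorHom_def]
      monoidal
    have h' := congrArg (· ≫ e ≫ annihs ax k) h
    simp only [Category.assoc] at h' ⊢
    exact h'.symm

/-- The annihilated wire is moved past the auxiliary wires and runs alongside e, so its annihilation
joins the final ones. -/
lemma NormalEffect.annih {S : Wires ax} {x : S ⊗ 𝟙_ (Wires ax) ⟶ 𝟙_ (Wires ax)}
    (hx : NormalEffect x) : NormalEffect (S ◁ annih ax ≫ x) := by
  obtain ⟨a, k, e, he, rfl⟩ := hx
  refine ⟨a, k + 1, (α_ S (wire ax) ⟨a⟩).hom ≫ S ◁ (β_ (wire ax) (⟨a⟩ : Wires ax)).hom ≫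
    (α_ S ⟨a⟩ (wire ax)).inv ≫ ((ρ_ S).inv ▷ ⟨a⟩ ≫ e) ▷ wire ax, ?_, ?_⟩
  · exact (Absorbs.associator _ _ _).comp (((Absorbs.braiding _ _).whiskerLeft S).comp
      ((Absorbs.associator_inv _ _ _).comp
        ((((Absorbs.rightUnitor_inv S).whiskerRight _).comp he).whiskerRight _)))
  · have h : ((ρ_ S).inv ▷ ⟨a⟩ ≫ e) ▷ wire ax ≫ annihs ax (k + 1)
        = (S ⊗ ⟨a⟩) ◁ QPath.annih ax ≫ (ρ_ (S ⊗ ⟨a⟩)).hom ≫ (ρ_ S).inv ▷ ⟨a⟩ ≫ e ≫ annihs ax k := by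
      rw [annihs_succ, tensorHom_def', unitors_equal, Category.assoc, rightUnitor_naturality,
        ← whisker_exchange_assoc, rightUnitor_naturality_assoc, Category.assoc]
    have h' : (α_ S (wire ax) ⟨a⟩).hom ≫ S ◁ (β_ (wire ax) (⟨a⟩ : Wires ax)).hom ≫
        (α_ S ⟨a⟩ (wire ax)).inv ≫ (S ⊗ ⟨a⟩) ◁ QPath.annih ax ≫ (ρ_ (S ⊗ ⟨a⟩)).hom
        = (S ◁ QPath.annih ax) ▷ ⟨a⟩ ≫ (ρ_ S).hom ▷ ⟨a⟩ := by
      rw [tensor_whiskerLeft]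
      simp only [Category.assoc, Iso.inv_hom_id_assoc]
      rw [← whiskerLeft_comp_assoc, ← BraidedCategory.braiding_naturality_left,
        braiding_tensorUnit_left]
      monoidal
    simp only [Category.assoc]
    rw [h, reassoc_of% h', ← comp_whiskerRight_assoc, ← comp_whiskerRight_assoc,
      Category.assoc, Iso.hom_inv_id, Category.comp_id, whisker_exchange_assoc,
      rightUnitor_inv_naturality_assoc]

/-- Precomposition with `f` multiplies the effects by `c`, up to normal effects. -/
def Scales (c : ℂ) {X Y : Wires ax} (f : X ⟶ Y) : Prop :=
  ∀ (S : Wires ax) (x : S ⊗ Y ⟶ 𝟙_ (Wires ax)), NormalEffect x →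
    ∃ y : S ⊗ X ⟶ 𝟙_ (Wires ax), NormalEffect y ∧ S ◁ f ≫ x = c • y

lemma Absorbs.scales {X Y : Wires ax} {f : X ⟶ Y} (hf : Absorbs f) : Scales 1 f :=
  fun S x hx => ⟨S ◁ f ≫ x, hx.comp (hf.whiskerLeft S), (Wires.one_smul _).symm⟩

namespace Scales

lemma prep : Scales 1 (prep ax) := fun _ _ hx => ⟨_, hx.prep, (Wires.one_smul _).symm⟩

lemma annih : Scales 1 (annih ax) := fun _ _ hx => ⟨_, hx.annih, (Wires.one_smul _).symm⟩

lemma comp {X Y Z : Wires ax} {c c' : ℂ} {f : X ⟶ Y} {g : Y ⟶ Z} (hf : Scales c f)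
    (hg : Scales c' g) : Scales (c * c') (f ≫ g) := fun S x hx => by
  obtain ⟨y, hy, h⟩ := hg S x hx
  obtain ⟨z, hz, h'⟩ := hf S y hy
  refine ⟨z, hz, ?_⟩
  rw [MonoidalCategory.whiskerLeft_comp, Category.assoc, h, Wires.comp_smul, h', Wires.smul_smul,
    mul_comm]

lemma smul {X Y : Wires ax} {c : ℂ} {f : X ⟶ Y} (hf : Scales c f) (c' : ℂ) :
    Scales (c' * c) (c' • f) := fun S x hx => by
  obtain ⟨y, hy, h⟩ := hf S x hx
  exact ⟨y, hy, by rw [Wires.whiskerLeft_smul, Wires.smul_comp, h, Wires.smul_smul]⟩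

/-- `Scales` quantifies over a context S exactly so that Z can be added to it. -/
lemma whiskerLeft (Z : Wires ax) {X Y : Wires ax} {c : ℂ} {f : X ⟶ Y} (hf : Scales c f) :
    Scales c (Z ◁ f) := fun S x hx => by
  obtain ⟨y, hy, h⟩ := hf (S ⊗ Z) ((α_ S Z Y).hom ≫ x) (hx.comp (.associator _ _ _))
  refine ⟨(α_ S Z X).inv ≫ y, hy.comp (.associator_inv _ _ _), ?_⟩
  rw [← Wires.comp_smul, ← h, associator_naturality_right_assoc, Iso.inv_hom_id_assoc]

lemma whiskerRight (Z : Wires ax) {X Y : Wires ax} {c : ℂ} {f : X ⟶ Y} (hf : Scales c f) :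
    Scales c (f ▷ Z) := by
  have h := ((Absorbs.braiding X Z).scales.comp (hf.whiskerLeft Z)).comp
    (Absorbs.braiding Z Y).scales
  rwa [Category.assoc, BraidedCategory.braiding_naturality_right,
    SymmetricCategory.symmetry_assoc, one_mul, mul_one] at h

lemma tensor {X Y X' Y' : Wires ax} {c c' : ℂ} {f : X ⟶ Y} {g : X' ⟶ Y'} (hf : Scales c f)
    (hg : Scales c' g) : Scales (c * c') (f ⊗ₘ g) := by
  rw [MonoidalCategory.tensorHom_def]
  exact (hf.whiskerRight _).comp (hg.whiskerLeft _)

lemma preps (n : ℕ) : Scales 1 (preps ax n) := by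
  induction n with
  | zero => exact (Absorbs.id _).scales
  | succ n ih =>
    rw [preps_succ]
    simpa using (Absorbs.leftUnitor_inv _).scales.comp (ih.tensor prep)

lemma annihs (n : ℕ) : Scales 1 (annihs ax n) := by
  induction n with
  | zero => exact (Absorbs.id _).scales
  | succ n ih =>
    rw [annihs_succ]
    simpa using (ih.tensor annih).comp (Absorbs.leftUnitor _).scales

end Scales

lemma arrow_create (n : ℕ+) : arrow @NormAxiom (create n)
    = (1 / (Real.sqrt (Nat.factorial n) : ℂ)) • arrow @NormAxiom ((creates n).seq (mergeN n)) :=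
  Cls.ofLin_eq_iff.mpr (.rule (.create_norm n))

lemma arrow_annihilate (n : ℕ+) : arrow @NormAxiom (annihilate n)
    = (1 / (Real.sqrt (Nat.factorial n) : ℂ)) •
      arrow @NormAxiom ((copyN n).seq (annihilates n)) :=
  Cls.ofLin_eq_iff.mpr (.rule (.annihilate_norm n))

/-- Induction on the diagram: only photon creations and annihilations contribute a scalar, released
by the normalisation law. -/
lemma scales_normFactor {m n : ℕ} (d : Diag m n) :
    Scales d.normFactor (arrow @NormAxiom d) := by
  induction d with
  | idn n => exact (Absorbs.id _).scales
  | seq f g hf hg => rw [arrow_seq]; exact hf.comp hg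
  | par f g hf hg => rw [arrow_par]; exact hf.tensor hg
  | swap m n => exact (Absorbs.braiding ⟨m⟩ ⟨n⟩).scales
  | copy => exact Absorbs.comulW.scales
  | discard => exact Absorbs.counitW.scales
  | merge => exact Absorbs.mulW.scales
  | unit => exact Absorbs.oneW.scales
  | endo r => exact (Absorbs.scale r).scales
  | create n =>
    rw [arrow_create, arrow_seq]
    have h := ((Scales.preps (ax := @NormAxiom) n).comp (Absorbs.mergeN n).scales).smul
      (1 / (Real.sqrt (Nat.factorial n) : ℂ))
    rw [mul_one, mul_one] at h
    exact h
  | annihilate n =>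
    rw [arrow_annihilate, arrow_seq]
    have h := ((Absorbs.copyN (ax := @NormAxiom) n).scales.comp (Scales.annihs n)).smul
      (1 / (Real.sqrt (Nat.factorial n) : ℂ))
    rw [mul_one, mul_one] at h
    exact h

lemma normalEffect_unit {X : Wires ax} {f : X ⟶ 𝟙_ (Wires ax)} (hf : Absorbs f) :
    NormalEffect f := by
  refine ⟨0, 0, (ρ_ X).hom ≫ f, (Absorbs.rightUnitor X).comp hf, ?_⟩
  refine Eq.symm ?_
  refine (congrArg (fun z => (ρ_ X).inv ≫ z ≫ ((ρ_ X).hom ≫ f) ≫ 𝟙 _)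
    (whiskerLeft_id X (𝟙_ (Wires ax)))).trans ?_
  simp

lemma NormalEffect.exists_eq {x : 𝟙_ (Wires ax) ⟶ 𝟙_ (Wires ax)} (hx : NormalEffect x) :
    ∃ (a k : ℕ) (M : Fin a → Fin k → ℂ), x = preps ax a ≫ wiresM ax a k M ≫ annihs ax k := by
  obtain ⟨a, k, e, he, rfl⟩ := hx
  obtain ⟨M, hM⟩ := ((Absorbs.leftUnitor_inv _).comp he).exists_eq
  refine ⟨a, k, M, ?_⟩
  rw [← hM, ← unitors_inv_equal, ← leftUnitor_inv_naturality_assoc, Category.assoc]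

lemma exists_arrow_eq (d : Diag 0 0) : ∃ (a k : ℕ) (M : Fin a → Fin k → ℂ),
    arrow @NormAxiom d = d.normFactor • (preps _ a ≫ wiresM _ a k M ≫ annihs _ k) := by
  -- In the empty context, testing d against the trivial effect recovers d up to unitors.
  obtain ⟨y, hy, h⟩ := scales_normFactor d (𝟙_ _) (λ_ (𝟙_ (Wires @NormAxiom))).hom
    (normalEffect_unit (.leftUnitor _))
  obtain ⟨a, k, M, hM⟩ := (hy.comp (.leftUnitor_inv (𝟙_ (Wires @NormAxiom)))).exists_eq
  refine ⟨a, k, M, ?_⟩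
  rw [leftUnitor_naturality] at h
  rw [← hM, ← Wires.comp_smul]
  exact (Iso.inv_hom_id_assoc (λ_ (𝟙_ (Wires @NormAxiom))) (arrow _ d)).symm.trans
    (congrArg ((λ_ (𝟙_ (Wires @NormAxiom))).inv ≫ ·) h)

/-- The complete bipartite graph with a given matrix of weights. -/
def WeightedBipartiteGraph.ofMatrix {p q : ℕ} (M : Fin p → Fin q → ℂ) :
    WeightedBipartiteGraph p q where
  graph := completeBipartiteGraph (Fin p) (Fin q)
  bipartite := le_rfl
  weight e := Sym2.lift ⟨fun u v => match u, v with
    | .inl i, .inr j => M i j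
    | .inr j, .inl i => M i j
    | .inl _, .inl _ => 0
    | .inr _, .inr _ => 0, fun u v => by cases u <;> cases v <;> rfl⟩ e.1

lemma WeightedBipartiteGraph.diagram_ofMatrix {p q : ℕ} (M : Fin p → Fin q → ℂ) :
    (ofMatrix M).diagram
      = (creates p).seq ((wires p q fun i j => endo (M i j)).seq (annihilates q)) := by
  have h (i : Fin p) (j : Fin q) : (ofMatrix M).graph.Adj (Sum.inl i) (Sum.inr j) := by
    simp [ofMatrix]
  simp only [diagram, h, ↓reduceDIte]
  rfl

theorem exists_isNormalForm (d : Diag 0 0) : ∃ (p q : ℕ) (G : WeightedBipartiteGraph p q),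
    IsNormalForm d G d.normFactor := by
  obtain ⟨a, k, M, h⟩ := exists_arrow_eq d
  refine ⟨a, k, .ofMatrix M, Cls.ofLin_eq_iff.mp (h.trans ?_)⟩
  rw [WeightedBipartiteGraph.diagram_ofMatrix, map_smul]
  refine congrArg (d.normFactor • ·) ?_
  exact ((mk_seq _ _).trans (congrArg (Cls.seq _) (mk_seq _ _))).symm

end QPath

end

/-! ### Completeness: states are spanned by products of merged photons. -/

noncomputable section

namespace QPath

open Diag Cls

/-! ### Completeness for closed diagrams -/

lemma rule_eq {m n : ℕ} {x y : Lin m n} (h : QPathAxiom x y) :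
    ofLin @QPathAxiom x = ofLin @QPathAxiom y := Cls.ofLin_eq_iff.mpr (.rule h)

/-- The class of a diagram modulo the axioms of QPath. -/
abbrev cls {m n : ℕ} (d : Diag m n) : Cls @QPathAxiom m n := mk _ d

/-- One photon with amplitude `r`. -/
def photon (r : ℂ) : Cls @QPathAxiom 0 1 := (cls (create 1)).seq (cls (endo r))

/-- The state of one mode in which photons with the given amplitudes are merged. -/
def photons : List ℂ → Cls @QPathAxiom 0 1
  | [] => cls unit
  | r :: L => Cls.seq (l := 0) (m := 1 + 1) ((photons L).par (photon r)) (cls merge)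

/-- The products of merged photons. -/
inductive ProductState : ∀ n : ℕ, Cls @QPathAxiom 0 n → Prop
  | empty : ProductState 0 (cls (idn 0))
  | snoc {n : ℕ} {x : Cls @QPathAxiom 0 n} (hx : ProductState n x) (L : List ℂ) :
      ProductState (n + 1) (x.par (photons L))

/-- The span of the products of merged photons. -/
def states (n : ℕ) : Submodule ℂ (Cls @QPathAxiom 0 n) := Submodule.span ℂ {x | ProductState n x}

/-- On states the source 0 + 0 + 0 reduces to 0, so only the target needs a transport. -/
lemma par_assoc_states {l m n : ℕ} (x : Cls @QPathAxiom 0 l) (y : Cls @QPathAxiom 0 m)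
    (z : Cls @QPathAxiom 0 n) (h) :
    ((Cls.par (m := 0) (m' := 0) (x.par y) z).cast rfl h : Cls @QPathAxiom 0 (l + (m + n)))
      = x.par (y.par z) := par_assoc x y z

lemma ProductState.par {m n : ℕ} {x : Cls @QPathAxiom 0 m} {y : Cls @QPathAxiom 0 n}
    (hx : ProductState m x) (hy : ProductState n y) : ProductState (m + n) (x.par y) := by
  induction hy with
  | empty => rw [par_empty]; exact hx
  | snoc hy L ih =>
    have h := ih.snoc L
    rwa [← par_assoc_states _ _ _ rfl]

lemma ProductState.exists_par {m n : ℕ} {x : Cls @QPathAxiom 0 (m + n)}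
    (hx : ProductState (m + n) x) :
    ∃ y z, ProductState m y ∧ ProductState n z ∧ x = y.par z := by
  induction n with
  | zero => exact ⟨x, _, hx, .empty, (par_empty x).symm⟩
  | succ n ih =>
    obtain @⟨_⟩ | @⟨_, x, hx, L⟩ := hx
    obtain ⟨y, z, hy, hz, rfl⟩ := ih hx
    exact ⟨y, _, hy, hz.snoc L, par_assoc_states y z (photons L) rfl⟩

lemma states_par {m n : ℕ} {x : Cls @QPathAxiom 0 m} {y : Cls @QPathAxiom 0 n}
    (hx : x ∈ states m) (hy : y ∈ states n) : x.par y ∈ states (m + n) := by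
  induction hx using Submodule.span_induction with
  | zero => rw [zero_par]; exact zero_mem _
  | add x x' _ _ h h' => rw [add_par]; exact add_mem h h'
  | smul c x _ h => rw [smul_par]; exact Submodule.smul_mem _ c h
  | mem x hx =>
    induction hy using Submodule.span_induction with
    | zero => rw [par_zero]; exact zero_mem _
    | add x x' _ _ h h' => rw [par_add]; exact add_mem h h'
    | smul c x _ h => rw [par_smul]; exact Submodule.smul_mem _ c h
    | mem y hy => exact Submodule.subset_span (hx.par hy)

lemma empty_par_state {n : ℕ} (x : Cls @QPathAxiom 0 n) (h) :
    ((Cls.par (cls (idn 0)) x).cast rfl h : Cls @QPathAxiom 0 n) = x := empty_par x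

lemma productState_one {x : Cls @QPathAxiom 0 1} : ProductState 1 x ↔ ∃ L, x = photons L := by
  constructor
  · intro hx
    obtain @⟨_⟩ | @⟨_, x, hx, L⟩ := hx
    cases hx
    exact ⟨L, empty_par_state (photons L) rfl⟩
  · rintro ⟨L, rfl⟩
    have h := ProductState.empty.snoc L
    rwa [← empty_par_state (photons L) rfl]

lemma photons_mem (L : List ℂ) : photons L ∈ states 1 :=
  Submodule.subset_span (productState_one.mpr ⟨L, rfl⟩)

lemma unit_par_merge (x : Cls @QPathAxiom 0 1) :
    Cls.seq (l := 0) (m := 1 + 1) ((cls unit).par x) (cls merge) = x := by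
  have h := mk_eq (ax := @QPathAxiom) .merge_unit
  rw [mk_seq, mk_par] at h
  have h' : (cls unit).par x = Cls.seq (l := 0) (m := 1) x ((cls unit).par (cls (idn 1))) := by
    have := interchange (cls (idn 0)) (cls unit) x (cls (idn 1))
    rw [id_seq, seq_id] at this
    exact this.trans (congrArg (fun z => Cls.seq z ((cls unit).par (cls (idn 1))))
      (empty_par_state x rfl))
  rw [h', Cls.seq_assoc, h, seq_id]

/-- Naturality moves the swap to the inputs, of which there are none. -/
lemma par_seq_swap {m n : ℕ} (x : Cls @QPathAxiom 0 m) (y : Cls @QPathAxiom 0 n) :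
    Cls.seq (l := 0) (x.par y) (cls (swap m n)) = y.par x := by
  have h : cls (swap 0 0) = cls (idn 0) := mk_eq (.swap_zero 0)
  exact (swap_natural x y).trans ((congrArg (fun z => Cls.seq z (y.par x)) h).trans (id_seq _))

lemma par_unit_merge (x : Cls @QPathAxiom 0 1) :
    Cls.seq (l := 0) (m := 1 + 1) (x.par (cls unit)) (cls merge) = x := by
  have h := mk_eq (ax := @QPathAxiom) .merge_comm
  rw [mk_seq] at h
  refine (congrArg (Cls.seq (l := 0) (m := 1 + 1) (x.par (cls unit))) h).symm.trans ?_
  rw [← Cls.seq_assoc]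
  exact (congrArg (fun z => Cls.seq z (cls merge)) (par_seq_swap x (cls unit))).trans
    (unit_par_merge x)

lemma photon_mem (r : ℂ) : photon r ∈ states 1 := by
  have h : photons [r] = photon r := unit_par_merge (photon r)
  exact h ▸ photons_mem [r]

lemma idn_mem : cls (idn 0) ∈ states 0 := Submodule.subset_span .empty

/-- The diagrams that preserve the span of the products of merged photons. -/
def Preserves {m n : ℕ} (d : Diag m n) : Prop := ∀ x ∈ states m, x.seq (cls d) ∈ states n

lemma preserves_iff {m n : ℕ} {d : Diag m n} :
    Preserves d ↔ ∀ x, ProductState m x → x.seq (cls d) ∈ states n := by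
  refine ⟨fun h x hx => h x (Submodule.subset_span hx), fun h x hx => ?_⟩
  induction hx using Submodule.span_induction with
  | zero => rw [zero_seq]; exact zero_mem _
  | add x x' _ _ h h' => rw [add_seq]; exact add_mem h h'
  | smul c x _ h => rw [smul_seq]; exact Submodule.smul_mem _ c h
  | mem x hx => exact h x hx

lemma preserves_state {n : ℕ} {d : Diag 0 n} : Preserves d ↔ cls d ∈ states n := by
  rw [preserves_iff]
  constructor
  · intro h
    have := h _ .empty
    rwa [id_seq] at this
  · rintro h _ ⟨⟩
    rwa [id_seq]

lemma preserves_wire {n : ℕ} {d : Diag 1 n} :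
    Preserves d ↔ ∀ L, (photons L).seq (cls d) ∈ states n := by
  simp only [preserves_iff, productState_one, forall_exists_index, forall_eq_apply_imp_iff]

namespace Preserves

lemma idn (n : ℕ) : Preserves (idn n) := fun x hx => by rwa [seq_id]

lemma seq {l m n : ℕ} {d : Diag l m} {e : Diag m n} (hd : Preserves d) (he : Preserves e) :
    Preserves (d.seq e) := fun x hx => by
  rw [cls, mk_seq, ← Cls.seq_assoc]; exact he _ (hd x hx)

/-- A product state splits between any two wires, and each half goes through its own diagram. -/
lemma par {m n m' n' : ℕ} {d : Diag m n} {e : Diag m' n'} (hd : Preserves d)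
    (he : Preserves e) : Preserves (d.par e) := preserves_iff.mpr fun x hx => by
  obtain ⟨y, z, hy, hz, rfl⟩ := hx.exists_par
  have h := states_par (hd y (Submodule.subset_span hy)) (he z (Submodule.subset_span hz))
  rwa [interchange, ← mk_par] at h

lemma swap (m n : ℕ) : Preserves (swap m n) := preserves_iff.mpr fun x hx => by
  obtain ⟨y, z, hy, hz, rfl⟩ := hx.exists_par
  exact (par_seq_swap y z).symm ▸ Submodule.subset_span (hz.par hy)

end Preserves

lemma photons_merge (L L' : List ℂ) : ∃ L'', Cls.seq (l := 0) (m := 1 + 1)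
    ((photons L).par (photons L')) (cls merge) = photons L'' := by
  induction L' with
  | nil => exact ⟨L, par_unit_merge _⟩
  | cons r L' ih =>
    obtain ⟨L'', h⟩ := ih
    refine ⟨r :: L'', ?_⟩
    rw [photons, photons, ← h]
    have hm := mk_eq (ax := @QPathAxiom) .merge_assoc
    rw [mk_seq, mk_seq, mk_par, mk_par] at hm
    have h₁ := interchange (photons L) (cls (idn 1))
      ((photons L').par (photon r)) (cls merge)
    have h₂ := interchange ((photons L).par (photons L')) (cls merge) (photon r) (cls (idn 1))
    rw [seq_id] at h₁ h₂
    refine (congrArg (fun z => Cls.seq z (cls merge)) h₁).trans ?_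
    refine Eq.trans ?_ (congrArg (fun z => Cls.seq z (cls merge)) h₂).symm
    refine (Cls.seq_assoc _ _ _).trans (Eq.trans ?_ (Cls.seq_assoc _ _ _).symm)
    exact congrArg₂ Cls.seq (par_assoc_states (photons L) (photons L') (photon r) rfl).symm hm.symm

lemma preserves_merge : Preserves merge := preserves_iff.mpr fun x hx => by
  obtain ⟨y, z, hy, hz, rfl⟩ := ProductState.exists_par (m := 1) (n := 1) hx
  obtain ⟨L, rfl⟩ := productState_one.mp hy
  obtain ⟨L', rfl⟩ := productState_one.mp hz
  obtain ⟨L'', h⟩ := photons_merge L L'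
  exact h ▸ photons_mem L''

lemma preserves_unit : Preserves unit := preserves_state.mpr (photons_mem [])

lemma photon_endo (r s : ℂ) : (photon r).seq (cls (endo s)) = photon (r * s) := by
  rw [photon, Cls.seq_assoc, ← mk_seq, mk_eq (.endo_mul r s)]; rfl

lemma photons_endo (s : ℂ) (L : List ℂ) :
    (photons L).seq (cls (endo s)) = photons (L.map (· * s)) := by
  induction L with
  | nil =>
    have h := mk_eq (ax := @QPathAxiom) (.unit_endo s)
    rwa [mk_seq] at h
  | cons r L ih =>
    have h := mk_eq (ax := @QPathAxiom) (.merge_endo s)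
    rw [mk_seq, mk_seq, mk_par] at h
    rw [photons, Cls.seq_assoc, h, ← Cls.seq_assoc, List.map_cons, photons, ← ih, ← photon_endo]
    exact congrArg (fun z => Cls.seq z (cls merge)) (interchange _ _ _ _).symm

lemma preserves_endo (s : ℂ) : Preserves (endo s) :=
  preserves_wire.mpr fun L => by rw [photons_endo]; exact photons_mem _

/-- Discarding absorbs the weight, and then the first scalar law applies. -/
lemma photon_discard (r : ℂ) : (photon r).seq (cls .discard) = 0 := by
  have h := rule_eq .create_discard
  rw [map_zero] at h
  rw [photon, Cls.seq_assoc, ← mk_seq, mk_eq (.endo_discard r), ← mk_seq]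
  exact h

lemma preserves_discard : Preserves .discard := preserves_wire.mpr fun L => by
  cases L with
  | nil =>
    rw [photons, ← mk_seq, mk_eq .unit_discard]
    exact idn_mem
  | cons r L =>
    have h : (photons (r :: L)).seq (cls .discard)
        = ((photons L).seq (cls .discard)).par ((photon r).seq (cls .discard)) := by
      rw [photons, Cls.seq_assoc, ← mk_seq, mk_eq .merge_discard, mk_par]
      exact (interchange _ _ _ _).symm
    rw [h, photon_discard, par_zero]
    exact zero_mem _

/-- The weight r is copied to both legs; branching puts the photon on one leg, and the vacuum on the
other ignores r. -/
lemma photon_copy_mem (r : ℂ) : (photon r).seq (cls copy) ∈ states 2 := by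
  have h := rule_eq .create_branch
  rw [map_add] at h
  have h' : (photon r).seq (cls copy)
      = (photon r).par (cls unit) + (cls unit).par (photon r) := by
    have hc : (cls (create 1)).seq (cls copy)
        = Cls.par (m := 0) (m' := 0) (cls (create 1)) (cls unit)
          + Cls.par (m := 0) (m' := 0) (cls unit) (cls (create 1)) := by
      rw [← mk_seq, ← mk_par, ← mk_par]
      exact h
    have hu : (cls unit).seq (cls (endo r)) = cls unit := by
      rw [← mk_seq, mk_eq (.unit_endo r)]
    rw [photon, Cls.seq_assoc, ← mk_seq, mk_eq (.endo_copy r), mk_seq, mk_par, ← Cls.seq_assoc, hc,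
      add_seq]
    refine congrArg₂ (· + ·) ((interchange _ _ _ _).symm.trans ?_)
      ((interchange _ _ _ _).symm.trans ?_)
    · rw [hu]
    · rw [hu]
  rw [h']
  exact add_mem (states_par (photon_mem r) (photons_mem []))
    (states_par (photons_mem []) (photon_mem r))

/-- The bialgebra law moves the copy before the merge of the last photon, where induction and
branching apply; what follows uses only swaps and merges. -/
lemma preserves_copy : Preserves copy := preserves_wire.mpr fun L => by
  induction L with
  | nil =>
    rw [photons, ← mk_seq, mk_eq .unit_copy, mk_par]
    exact states_par (photons_mem []) (photons_mem [])
  | cons r L ih =>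
    have h : (photons (r :: L)).seq (cls copy)
        = Cls.seq (l := 0) (m := 2 + 2)
          (((photons L).seq (cls copy)).par ((photon r).seq (cls copy)))
          (cls (Diag.seq (m := 4) (((idn 1).par (swap 1 1)).par (idn 1)) (merge.par merge))) := by
      rw [photons, Cls.seq_assoc, ← mk_seq, mk_eq .merge_copy, mk_seq, mk_par, ← Cls.seq_assoc]
      exact congrArg (fun z => Cls.seq z _) (interchange _ _ _ _).symm
    rw [h]
    have hp : Preserves (Diag.seq (m := 4) (((Diag.idn 1).par (Diag.swap 1 1)).par (Diag.idn 1))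
        (merge.par merge)) :=
      (((Preserves.idn 1).par (.swap 1 1)).par (.idn 1)).seq (preserves_merge.par preserves_merge)
    exact hp _ (states_par ih (photon_copy_mem r))

lemma photon_annihilate (r : ℂ) : (photon r).seq (cls (annihilate 1)) = r • cls (idn 0) := by
  have h := rule_eq (.scalar r)
  rw [map_smul] at h
  rw [photon, Cls.seq_assoc, ← mk_seq, ← mk_seq]
  exact h

/-- By branching, either the last photon is discarded, which gives zero, or it is annihilated with
scalar r and the remaining photons are discarded. -/
lemma preserves_annihilate_one : Preserves (annihilate 1) := preserves_wire.mpr fun L => by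
  induction L with
  | nil =>
    have h := rule_eq .unit_annihilate
    rw [map_zero] at h
    rw [photons, ← mk_seq]
    rw [mk, h]
    exact zero_mem _
  | cons r L ih =>
    have h := rule_eq .annihilate_branch
    rw [map_add] at h
    have hb : (cls merge).seq (cls (annihilate 1))
        = (cls (annihilate 1)).par (cls .discard) + (cls .discard).par (cls (annihilate 1)) := by
      rw [← mk_seq, ← mk_par, ← mk_par]
      exact h
    have h' : (photons (r :: L)).seq (cls (annihilate 1))
        = ((photons L).seq (cls (annihilate 1))).par ((photon r).seq (cls .discard))
          + ((photons L).seq (cls .discard)).par ((photon r).seq (cls (annihilate 1))) := by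
      rw [photons, Cls.seq_assoc, hb, seq_add]
      exact congrArg₂ (· + ·) (interchange _ _ _ _).symm (interchange _ _ _ _).symm
    rw [h', photon_discard, par_zero, zero_add, photon_annihilate]
    exact states_par (preserves_discard _ (photons_mem L)) (Submodule.smul_mem _ r idn_mem)

lemma preserves_create_one : Preserves (create 1) := preserves_state.mpr <| by
  have h := photon_mem 1
  rwa [photon, cls, cls, mk_eq .endo_one, seq_id] at h

lemma preserves_creates (n : ℕ) : Preserves (creates n) := by
  induction n with
  | zero => exact .idn 0
  | succ n ih => exact ih.par preserves_create_one

lemma preserves_annihilates (n : ℕ) : Preserves (annihilates n) := by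
  induction n with
  | zero => exact .idn 0
  | succ n ih => exact ih.par preserves_annihilate_one

lemma preserves_mergeN (n : ℕ) : Preserves (mergeN n) := by
  induction n with
  | zero => exact preserves_unit
  | succ n ih => exact (ih.par (.idn 1)).seq preserves_merge

lemma preserves_copyN (n : ℕ) : Preserves (copyN n) := by
  induction n with
  | zero => exact preserves_discard
  | succ n ih => exact preserves_copy.seq (ih.par (.idn 1))

theorem preserves {m n : ℕ} (d : Diag m n) : Preserves d := by
  induction d with
  | idn n => exact .idn n
  | seq f g hf hg => exact hf.seq hg
  | par f g hf hg => exact hf.par hg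
  | swap m n => exact .swap m n
  | copy => exact preserves_copy
  | discard => exact preserves_discard
  | merge => exact preserves_merge
  | unit => exact preserves_unit
  | endo r => exact preserves_endo r
  | create n =>
    have h := rule_eq (.norm (.create_norm n))
    rw [map_smul] at h
    intro x hx
    have h' : cls (create n) = _ := h
    rw [h', seq_smul]
    exact Submodule.smul_mem _ _ ((preserves_creates n).seq (preserves_mergeN n) x hx)
  | annihilate n =>
    have h := rule_eq (.norm (.annihilate_norm n))
    rw [map_smul] at h
    intro x hx
    have h' : cls (annihilate n) = _ := h
    rw [h', seq_smul]
    exact Submodule.smul_mem _ _ ((preserves_copyN n).seq (preserves_annihilates n) x hx)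

/-- A product over no modes is the empty diagram. -/
lemma mem_states_zero (x : Cls @QPathAxiom 0 0) : ∃ c : ℂ, x = c • cls (idn 0) := by
  have h : x ∈ states 0 := by
    induction x using Cls.induction with
    | zero => exact zero_mem _
    | add x y hx hy => exact add_mem hx hy
    | smul c d => exact Submodule.smul_mem _ c (preserves_state.mp (preserves d))
  induction h using Submodule.span_induction with
  | zero => exact ⟨0, (zero_smul _ _).symm⟩
  | add x y _ _ hx hy =>
    obtain ⟨c, rfl⟩ := hx
    obtain ⟨c', rfl⟩ := hy
    exact ⟨c + c', (add_smul _ _ _).symm⟩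
  | smul c x _ hx =>
    obtain ⟨c', rfl⟩ := hx
    exact ⟨c * c', smul_smul _ _ _⟩
  | mem x hx =>
    cases hx
    exact ⟨1, (one_smul _ _).symm⟩

lemma exists_rewrites_smul_idn (x : Lin 0 0) :
    ∃ c : ℂ, Rewrites @QPathAxiom x (c • Lin.of (idn 0)) := by
  obtain ⟨c, hc⟩ := mem_states_zero (ofLin _ x)
  exact ⟨c, Cls.ofLin_eq_iff.mp (by rw [hc, map_smul]; rfl)⟩

theorem rewrites_of_bosonicLin_eq {x y : Lin 0 0} (h : bosonicLin x = bosonicLin y) :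
    Rewrites @QPathAxiom x y := by
  obtain ⟨c, hc⟩ := exists_rewrites_smul_idn x
  obtain ⟨c', hc'⟩ := exists_rewrites_smul_idn y
  have hc_s := hc.sound fun _ _ _ _ => QPathAxiom.sound
  have hc'_s := hc'.sound fun _ _ _ _ => QPathAxiom.sound
  have h₁ := hc_s.symm.trans (h.trans hc'_s)
  -- By soundness, c and c' are the vacuum matrix elements of the two interpretations, which agree
  -- by hypothesis.
  have h₂ : c = c' := by
    have := congrArg (fun f : Fock 0 →ₗ[ℂ] Fock 0 => f (ket ![]) ![]) h₁
    simpa [bosonicLin_of, bosonic, ket] using this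
  exact hc.trans (h₂ ▸ hc'.symm)

end QPath

end

theorem mainTheorem2 :
    -- soundness of the rewrite rules, for all diagrams
    (∀ (m n : ℕ) (x y : QPath.Lin m n), QPath.Rewrites @QPath.QPathAxiom x y →
      QPath.bosonicLin x = QPath.bosonicLin y) ∧
    -- completeness of the rewrite rules for closed diagrams
    (∀ d d' : QPath.Diag 0 0, QPath.bosonic d = QPath.bosonic d' →
      QPath.Rewrites @QPath.QPathAxiom (QPath.Lin.of d) (QPath.Lin.of d')) ∧
    -- completeness of the rewrite rules for formal sums of closed diagrams
    (∀ x y : QPath.Lin 0 0, QPath.bosonicLin x = QPath.bosonicLin y →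
      QPath.Rewrites @QPath.QPathAxiom x y) ∧
    -- every closed diagram has a normal form
    (∀ d : QPath.Diag 0 0, ∃ (p q : ℕ) (G : QPath.WeightedBipartiteGraph p q),
      QPath.IsNormalForm d G d.normFactor) ∧
    -- the interpretation of a closed diagram is read off from any normal form
    (∀ (d : QPath.Diag 0 0) (p q : ℕ) (G : QPath.WeightedBipartiteGraph p q) (N : ℂ),
      QPath.IsNormalForm d G N →
        QPath.amplitude d = N * G.matchingSum ∧
        (∀ e : Fin p ≃ Fin q,
          QPath.amplitude d = N * (G.adjacency.submatrix id e).permanent) ∧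
        (p ≠ q → QPath.amplitude d = 0)) := by
  refine ⟨fun m n x y h => h.sound fun _ _ _ _ => QPath.QPathAxiom.sound, fun d d' h => ?_,
    fun x y h => QPath.rewrites_of_bosonicLin_eq h, QPath.exists_isNormalForm,
    fun d p q G N h => ⟨?_, fun e => ?_, fun hpq => ?_⟩⟩
  · exact QPath.rewrites_of_bosonicLin_eq (by simpa using h)
  · rw [h.amplitude_eq, G.matchingSum_eq]
  · rw [h.amplitude_eq, QPath.sum_bijective_eq_permanent G.adjacency e]
  · rw [h.amplitude_eq, Finset.filter_false_of_mem, Finset.sum_empty, mul_zero]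
    intro σ _ hσ
    exact hpq (by simpa using Fintype.card_of_bijective hσ)
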